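/- Let $S=\{(u(z)\cos\theta,u(z)\sin\theta,z)\mid z\in[a,b],\ \theta\in\mathbb R\}\subset\mathbb R^3$ be a sphere of revolution: $u$ is continuous on $[a,b]$, smooth and positive on $(a,b)$, $u(a)=u(b)=0$, and $S$ is a smooth embedded surface, with the metric induced from $\mathbb R^3$. Assume that $S$ has exactly one equator, i.e. $u$ has exactly one critical point $z_0$ in $(a,b)$. Let $\lambda$ be the tautological one-form on $T^*S$ and $\omega_{can}=d\lambda$; let $D^*S=\{\|p\|\le 1\}$ and $S^*S=\{\|p\|=1\}$. Let $F=(H,J)\colon D^*S\to\mathbb R^2$, where $H(q,p)=\|p\|^2$ is the energy and $J(q,p)=p(\partial_\theta)$, $\partial_\theta=-y\partial_x+x\partial_y$, is the angular momentum. Call a point of $D^*S$ critical if it lies over one of the two poles of $S$ or if $dF$ has rank less than two there, and let the regular set be the set of the points $x\in D^*S$ such that $F(x)$ is not the value of $F$ at a critical point. Then the regular set consists of the points of $D^*S$ at which $dF$ has rank two and $J\ne0$. It has exactly two connected components, $U_+$ (where $J>0$) and $U_-$ (where $J<0$), and $U_\pm=F^{-1}(B_\pm)$, where $$B_\pm=\{(h,j)\mid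 0<h\le 1,\ 0<\pm j<u(z_0)\sqrt h\}.$$ For $0<h\le1$ and $|j|\le u(z_0)\sqrt h$ put $$I_2(h,j)=2\int_{\{z\in(a,b)\,\mid\, j^2<h\,u(z)^2\}}\sqrt{\Big(h-\frac{j^2}{u(z)^2}\Big)\big(u'(z)^2+1\big)}\,dz .$$ The sets $B_+$ and $B_-$ have the same image under $(h,j)\mapsto(2\pi|j|,I_2(h,j))$, namely $$\Omega=\{(x,y)\mid 0<x<2\pi u(z_0),\ 0<y\le f(x)\},\qquad f(x)=I_2\big(1,\tfrac{x}{2\pi}\big),$$ where $f$ is continuous on $[0,2\pi u(z_0)]$ and $f(2\pi u(z_0))=0$; the closure of $\Omega$ is the closure of the interior of $\Omega$. Let $\mu(z_1,z_2)=(\pi|z_1|^2,\pi|z_2|^2)$, $\mathbb X_\Omega=\mu^{-1}(\Omega)\subset\mathbb C^2$, $\lambda_0=\frac12\sum_i(x_i\,dy_i-y_i\,dx_i)$ and $\omega_0=d\lambda_0$. For each sign there is a symplectomorphism $\Phi_\pm\colon(U_\pm,\omega_{can})\to(\mathbb X_\Omega,\omega_0)$ such that $\mu\circ\Phi_\pm=(2\pi|J|,I_2(H,J))$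 and $\Phi_\pm^*\lambda_0=\lambda$. Moreover, $\Phi_\pm$ restricts to a strict contactomorphism from $(\partial U_\pm,\lambda)$ onto $(\partial\mathbb X_\Omega,\lambda_0)$, where $\partial U_\pm=U_\pm\cap S^*S$ is the boundary of the manifold with boundary $U_\pm$ and $\partial\mathbb X_\Omega=\mathbb X_\Omega\cap\mu^{-1}(\{(x,f(x))\})$ is the part of the topological boundary of $\mathbb X_\Omega$ that lies in $\mathbb X_\Omega$; in particular, $\lambda$ and $\lambda_0$ restrict to contact forms on these boundaries. -/

import Mathlib

open Set Filter Topology MeasureTheory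
open scoped ContDiff

noncomputable section

/-! ### Submanifolds of Euclidean spaces, forms and maps between them

A submanifold (possibly with boundary) is a subset `A` of a normed space `V`. Its tangent space at
`x` is Mathlib's `tangentConeAt ℝ A x`; as the scalars in that definition may have either sign, this
is the full linear tangent space also at boundary points. A smooth map on `A` is a map that is
`ContDiffOn ℝ ∞` on `A`; the values of `fderivWithin ℝ Φ A x` on `tangentConeAt ℝ A x` do not
depend on choices. -/

section Forms

variable {V W : Type*} [NormedAddCommGroup V] [NormedSpace ℝ V]
  [NormedAddCommGroup W] [NormedSpace ℝ W]

/-- The exterior derivative of a one-form `α`. -/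
def dOne (α : V → V →L[ℝ] ℝ) (x v w : V) : ℝ :=
  fderiv ℝ α x v w - fderiv ℝ α x w v

/-- `Φ` is a diffeomorphism from `A` onto `B`. -/
def IsDiffeoOn (Φ : V → W) (A : Set V) (B : Set W) : Prop :=
  BijOn Φ A B ∧ ContDiffOn ℝ ∞ Φ A ∧
    ∃ Ψ : W → V, InvOn Ψ Φ A B ∧ ContDiffOn ℝ ∞ Ψ B

/-- `Φ^* β = α` as one-forms on `A`. -/
def PullbackOneEqOn (Φ : V → W) (A : Set V) (β : W → W →L[ℝ] ℝ) (α : V → V →L[ℝ] ℝ) : Prop :=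
  ∀ x ∈ A, ∀ v ∈ tangentConeAt ℝ A x, β (Φ x) (fderivWithin ℝ Φ A x v) = α x v

/-- `Φ^* σ = τ` as two-forms on `A`. -/
def PullbackTwoEqOn (Φ : V → W) (A : Set V) (σ : W → W → W → ℝ) (τ : V → V → V → ℝ) : Prop :=
  ∀ x ∈ A, ∀ v ∈ tangentConeAt ℝ A x, ∀ w ∈ tangentConeAt ℝ A x,
    σ (Φ x) (fderivWithin ℝ Φ A x v) (fderivWithin ℝ Φ A x w) = τ x v w

/-- `Φ` is a symplectomorphism from `(A, τ)` onto `(B, σ)`. -/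
def IsSymplectomorphismOn (Φ : V → W) (A : Set V) (τ : V → V → V → ℝ)
    (B : Set W) (σ : W → W → W → ℝ) : Prop :=
  IsDiffeoOn Φ A B ∧ PullbackTwoEqOn Φ A σ τ

/-- `α` restricts to a contact form on `A`: at every point it is nonzero on the tangent space,
and `dα` is nondegenerate on its kernel. -/
def IsContactFormOn (A : Set V) (α : V → V →L[ℝ] ℝ) : Prop :=
  ∀ x ∈ A, (∃ v ∈ tangentConeAt ℝ A x, α x v ≠ 0) ∧
    ∀ v ∈ tangentConeAt ℝ A x, α x v = 0 →
      (∀ w ∈ tangentConeAt ℝ A x, α x w = 0 → dOne α x v w = 0) → v = 0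

/-- `Φ` is a strict contactomorphism from `(A, α)` onto `(B, β)`: both forms are contact forms, and
`Φ` is a diffeomorphism with `Φ^* β = α`. -/
def IsStrictContactomorphismOn (Φ : V → W) (A : Set V) (α : V → V →L[ℝ] ℝ)
    (B : Set W) (β : W → W →L[ℝ] ℝ) : Prop :=
  IsContactFormOn A α ∧ IsContactFormOn B β ∧ IsDiffeoOn Φ A B ∧ PullbackOneEqOn Φ A β α

end Forms

/-! ### Toric domains in `ℂ²` -/

/-- The moment map `(z₁, z₂) ↦ (π|z₁|², π|z₂|²)`. -/
def momentMap (z : ℂ × ℂ) : ℝ × ℝ := (Real.pi * ‖z.1‖ ^ 2, Real.pi * ‖z.2‖ ^ 2)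

/-- The toric domain over `Ω`. -/
def toricDomain (Ω : Set (ℝ × ℝ)) : Set (ℂ × ℂ) := {z | momentMap z ∈ Ω}

/-- The boundary points that belong to a codimension zero subset of `ℂ²`. -/
def ownBoundary (X : Set (ℂ × ℂ)) : Set (ℂ × ℂ) := X ∩ frontier X

/-- The standard Liouville form `λ₀ = ½ ∑ (xᵢ dyᵢ - yᵢ dxᵢ) = ½ ∑ rᵢ² dθᵢ` on `ℂ²`. -/
def stdLiouville (z : ℂ × ℂ) : ℂ × ℂ →L[ℝ] ℝ :=
  (1 / 2 : ℝ) •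
    ((z.1.re • Complex.imCLM.comp (ContinuousLinearMap.fst ℝ ℂ ℂ)
        - z.1.im • Complex.reCLM.comp (ContinuousLinearMap.fst ℝ ℂ ℂ)) +
      (z.2.re • Complex.imCLM.comp (ContinuousLinearMap.snd ℝ ℂ ℂ)
        - z.2.im • Complex.reCLM.comp (ContinuousLinearMap.snd ℝ ℂ ℂ)))

/-- The standard symplectic form `ω₀ = ∑ dxᵢ ∧ dyᵢ` on `ℂ²`. -/
def stdSymplectic (_z v w : ℂ × ℂ) : ℝ :=
  (v.1.re * w.1.im - v.1.im * w.1.re) + (v.2.re * w.2.im - v.2.im * w.2.re)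

/-- `dλ₀ = ω₀`. -/
theorem dOne_stdLiouville (z v w : ℂ × ℂ) : dOne stdLiouville z v w = stdSymplectic z v w := by
  have hl : IsLinearMap ℝ stdLiouville := by
    constructor
    · intro x y; ext t <;> simp [stdLiouville] <;> ring
    · intro c x; ext t <;> simp [stdLiouville] <;> ring
  have h' : fderiv ℝ stdLiouville z = LinearMap.toContinuousLinearMap hl.mk' := by
    exact (LinearMap.toContinuousLinearMap hl.mk').fderiv
  unfold dOne
  rw [h']
  simp [stdLiouville, stdSymplectic]
  ring

/-! ### Cotangent geometry of a surface in `ℝ³` -/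

/-- Euclidean three-space. -/
abbrev R3 := EuclideanSpace ℝ (Fin 3)

/-- `M` is a smooth embedded surface without boundary in `ℝ³`: locally a regular level set. -/
def IsSmoothSurface (M : Set R3) : Prop :=
  ∀ q ∈ M, ∃ (N : Set R3) (g : R3 → ℝ), IsOpen N ∧ q ∈ N ∧ ContDiffOn ℝ ∞ g N ∧
    (∀ x ∈ N, fderiv ℝ g x ≠ 0) ∧ M ∩ N = {x ∈ N | g x = 0}

/-- The cotangent bundle of a surface with the metric induced from `ℝ³`. A covector at `q` is
represented by the tangent vector at `q` that is dual to it under the metric. -/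
def cotangentBundle (M : Set R3) : Set (R3 × R3) :=
  {x | x.1 ∈ M ∧ x.2 ∈ tangentConeAt ℝ M x.1}

/-- The unit disk cotangent bundle `D^*M`. -/
def diskBundle (M : Set R3) : Set (R3 × R3) := {x ∈ cotangentBundle M | ‖x.2‖ ≤ 1}

/-- The unit cosphere bundle `S^*M`. -/
def cosphereBundle (M : Set R3) : Set (R3 × R3) := {x ∈ cotangentBundle M | ‖x.2‖ = 1}

/-- The tautological one-form: at `(q, p)` it sends a tangent vector `(δq, δp)` of the cotangent
bundle to `p(δq) = ⟪p, δq⟫`. -/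
def tautological (x : R3 × R3) : R3 × R3 →L[ℝ] ℝ :=
  (innerSL ℝ x.2).comp (ContinuousLinearMap.fst ℝ R3 R3)

/-- The canonical symplectic form `ω_can = dλ`. -/
def canSymplectic : R3 × R3 → R3 × R3 → R3 × R3 → ℝ := dOne tautological

/-- In coordinates, `ω_can = ∑ dpᵢ ∧ dqᵢ`. -/
theorem canSymplectic_apply (x v w : R3 × R3) :
    canSymplectic x v w = inner ℝ v.2 w.1 - inner ℝ w.2 v.1 := by
  have h : tautological = ⇑(((ContinuousLinearMap.compL ℝ (R3 × R3) R3 ℝ).flip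
      (ContinuousLinearMap.fst ℝ R3 R3)).comp
        ((innerSL ℝ (E := R3)).comp (ContinuousLinearMap.snd ℝ R3 R3))) := by
    funext y; rfl
  unfold canSymplectic dOne
  rw [h, ContinuousLinearMap.fderiv]
  rfl

/-- The energy `H(q, p) = ‖p‖²`. -/
def energy (x : R3 × R3) : ℝ := ‖x.2‖ ^ 2

/-- The rotation field `∂_θ = -y ∂_x + x ∂_y`. -/
def rotationField (q : R3) : R3 := !₂[-q 1, q 0, 0]

/-- The angular momentum `J(q, p) = p(∂_θ)`. -/
def angularMomentum (x : R3 × R3) : ℝ := inner ℝ x.2 (rotationField x.1)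

/-- The map `F = (H, J)`. -/
def energyMomentum (x : R3 × R3) : ℝ × ℝ := (energy x, angularMomentum x)

/-- The differential of `F` restricted to the cotangent bundle of `M` has rank two at `x`. -/
def IsRegularPoint (M : Set R3) (x : R3 × R3) : Prop :=
  SurjOn (fderiv ℝ energyMomentum x) (tangentConeAt ℝ (cotangentBundle M) x) univ

/-! ### Spheres of revolution -/

/-- A sphere of revolution: the smooth surface obtained by rotating the graph of `u` over `[a, b]`
about the `z`-axis. -/
structure SphereOfRevolution where
  /-- The height of the south pole. -/
  a : ℝ
  /-- The height of the north pole. -/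
  b : ℝ
  /-- The profile function; only its values on `[a, b]` matter. -/
  u : ℝ → ℝ
  a_lt_b : a < b
  continuousOn_u : ContinuousOn u (Icc a b)
  contDiffOn_u : ContDiffOn ℝ ∞ u (Ioo a b)
  u_pos : ∀ z ∈ Ioo a b, 0 < u z
  u_a : u a = 0
  u_b : u b = 0
  smooth : IsSmoothSurface
    {q : R3 | ∃ z ∈ Icc a b, ∃ θ : ℝ, q = !₂[u z * Real.cos θ, u z * Real.sin θ, z]}

namespace SphereOfRevolution

variable (S : SphereOfRevolution)

/-- The surface as a subset of `ℝ³`. -/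
def surface : Set R3 :=
  {q : R3 | ∃ z ∈ Icc S.a S.b, ∃ θ : ℝ, q = !₂[S.u z * Real.cos θ, S.u z * Real.sin θ, z]}

/-- The north pole. -/
def northPole : R3 := !₂[0, 0, S.b]

/-- The south pole. -/
def southPole : R3 := !₂[0, 0, S.a]

/-- The circle at height `z` is an equator: `z` is a critical point of `u`. -/
def IsEquatorHeight (z : ℝ) : Prop := z ∈ Ioo S.a S.b ∧ deriv S.u z = 0

/-- The critical points of `F` on `D^*S`, where the fibres over the two poles (at which the
coordinates `(z, θ)` degenerate) are counted as critical. -/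
def criticalSet : Set (R3 × R3) :=
  {x ∈ diskBundle S.surface |
    x.1 = S.southPole ∨ x.1 = S.northPole ∨ ¬ IsRegularPoint S.surface x}

/-- The regular set of `F` on `D^*S`: the points whose value under `F` is not the value of a
critical point. -/
def regularSet : Set (R3 × R3) :=
  {x ∈ diskBundle S.surface | energyMomentum x ∉ energyMomentum '' S.criticalSet}

/-- The part `U₊` of the regular set where `J > 0`. -/
def Uplus : Set (R3 × R3) := {x ∈ S.regularSet | 0 < angularMomentum x}

/-- The part `U₋` of the regular set where `J < 0`. -/
def Uminus : Set (R3 × R3) := {x ∈ S.regularSet | angularMomentum x < 0}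

/-- The action `I₂(h, j) = 2 ∫ √((h - j²/u²)(u'² + 1)) dz`, where the integral is over the interval
`(z₋(h, j), z₊(h, j))` of those `z` for which `j² < h u(z)²`. -/
def action₂ (h j : ℝ) : ℝ :=
  2 * ∫ z in {z : ℝ | z ∈ Ioo S.a S.b ∧ j ^ 2 < h * S.u z ^ 2},
    Real.sqrt ((h - j ^ 2 / S.u z ^ 2) * (deriv S.u z ^ 2 + 1))

/-- The action map `(h, j) ↦ (2π|j|, I₂(h, j))`. -/
def actionMap (y : ℝ × ℝ) : ℝ × ℝ := (2 * Real.pi * |y.2|, S.action₂ y.1 y.2)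

end SphereOfRevolution

/-- The set `B₊` of the `(h, j)` with `0 < h ≤ 1` and `0 < j < r √h`. -/
def Bplus (r : ℝ) : Set (ℝ × ℝ) :=
  {y | 0 < y.1 ∧ y.1 ≤ 1 ∧ 0 < y.2 ∧ y.2 < r * Real.sqrt y.1}

/-- The set `B₋` of the `(h, j)` with `0 < h ≤ 1` and `-r √h < j < 0`. -/
def Bminus (r : ℝ) : Set (ℝ × ℝ) :=
  {y | 0 < y.1 ∧ y.1 ≤ 1 ∧ -(r * Real.sqrt y.1) < y.2 ∧ y.2 < 0}

end

/-!
The proof uses explicit coordinates `(s, (c, τ), θ)` on the part of `T^*S` where `J` has a given sign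
`ε = ±1` and the covector is not tangent to the equator. Here `s` is the norm of the covector, `c` is
its Clairaut constant `|J| / s`, and `θ` is `ε` times the polar angle on the surface. The fourth
coordinate `τ` comes from the reduced phase plane: let `z` be the height and `ξ` the component of the
normalized covector along the meridian. As `z₀` is the only critical point of `u`, the level curves
`u(z)² (1 - ξ²) = c²`, `0 < c < u(z₀)`, are star-shaped about `(z₀, 0)`, and the radial derivative of
the left side does not vanish. So the polar radius is a smooth function of `(c, τ)`, with `τ` the
polar angle (`IsRadius.unique`, `IsRadius.exists_isRadius`, `HasUniqueEquator.contDiffOn_radius`).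

On unit covectors `λ = p_z dz + c dθ`. Integrating `p_z dz` along the level curves from a turning
point gives a function `w(c, τ)` with `dw = p_z dz + k dc`, and its value over a full turn is the
action `g(c) = I₂(1, c)`. The Legendre transform `t = w - c k` increases along the level curves, being
the length of the geodesic, and grows by the period `T = g - c g' > 0` in each turn. Put `B = t / T`
and `A = k - B g'`. Then `w = c A + g B`, whence `c dA + g dB = p_z dz` with no exact remainder
(`HasUniqueEquator.angle_identity`), and therefore, as `λ` is homogeneous in `s`,
  `λ = s c d(θ + A) + s g(c) dB`.
This is `λ₀` at the point of `ℂ²` with actions `(2π s c, s g(c))` and angles `(θ + A, 2π B)`. The map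
`Φ` is equality of coordinates. It is well defined and bijective because `τ` and `θ` are determined up
to multiples of `2π` on both sides (`HasUniqueEquator.phasePoint_eq_iff`,
`HasUniqueEquator.toricPoint_eq_iff`). The positivity of `T` enters three times: `B` is monotone in
`τ`; for fixed `j` the function `s ↦ s g(j / s)` has derivative `T`, so that the actions determine
`(s, c)` and sweep out exactly `Ω` (`HasUniqueEquator.strictMonoOn_scaled_action`); and on `{s = 1}`
the form `c dα + g(c) dβ` is a contact form (`HasUniqueEquator.isContactFormOn_slice`).

The regular set is found from Clairaut's inequality `J² ≤ u(z₀)² H`: equality makes `u(z₀)² H - J²`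
minimal, so `dH` and `dJ` are dependent there, while off `J = 0` a strict inequality places the point
in the coordinate domain. The fibres over the poles have all the values `(h, 0)`, `0 ≤ h ≤ 1`, so no
point with `J = 0` belongs to the regular set.

All manifolds here are images of parametrizations with smooth local sections (`HasSmoothSections`);
tangent cones, diffeomorphisms, pullbacks of forms and contact forms are transported from the domains
of the parametrizations.
-/

/-! ### Calculus -/

section Calculus

variable {E F : Type*} [NormedAddCommGroup E] [NormedSpace ℝ E] [NormedAddCommGroup F]
  [NormedSpace ℝ F]

/-- The inverse function theorem for spaces of equal finite dimension. -/
theorem ContDiffAt.exists_local_inverse [FiniteDimensional ℝ E] [FiniteDimensional ℝ F]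
    (hdim : Module.finrank ℝ E = Module.finrank ℝ F) {f : E → F} {e : E}
    (hf : ContDiffAt ℝ ∞ f e) (hinj : ∀ v, fderiv ℝ f e v = 0 → v = 0) :
    ∃ g : F → E, ContDiffAt ℝ ∞ g (f e) ∧ g (f e) = e ∧ ∀ᶠ y in 𝓝 (f e), f (g y) = y := by
  have : CompleteSpace E := FiniteDimensional.complete ℝ E
  have hi : Function.Injective (fderiv ℝ f e : E →ₗ[ℝ] F) := by
    rw [← LinearMap.ker_eq_bot, LinearMap.ker_eq_bot']
    exact hinj
  let A : E ≃L[ℝ] F := (LinearEquiv.ofInjectiveOfFinrankEq (fderiv ℝ f e : E →ₗ[ℝ] F) hi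
    hdim).toContinuousLinearEquiv
  have hA : (A : E →L[ℝ] F) = fderiv ℝ f e := by
    ext v; rfl
  have hd : HasFDerivAt f (A : E →L[ℝ] F) e := by
    rw [hA]; exact (hf.differentiableAt (by simp)).hasFDerivAt
  refine ⟨hf.localInverse hd (by simp), hf.to_localInverse hd (by simp),
    hf.localInverse_apply_image hd (by simp), ?_⟩
  exact (hf.hasStrictFDerivAt' hd (by simp)).eventually_right_inverse

/-- Iterated differentiation under the integral sign. The target space varies in the induction, as
the derivative of the integrand takes its place. -/
theorem contDiffOn_integral_of_contDiffOn {U : Set (ℝ × ℝ)} (hU : IsOpen U) (n : ℕ) :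
    ∀ {G : Type} [NormedAddCommGroup G] [NormedSpace ℝ G] [CompleteSpace G]
      (f : (ℝ × ℝ) × ℝ → G), ContDiffOn ℝ ∞ f (U ×ˢ univ) →
      ContDiffOn ℝ n (fun x => ∫ σ in (0 : ℝ)..1, f (x, σ)) U := by
  have hV : IsOpen (U ×ˢ (univ : Set ℝ)) := hU.prod isOpen_univ
  have key : ∀ {G : Type} [NormedAddCommGroup G] [NormedSpace ℝ G] [CompleteSpace G]
      (f : (ℝ × ℝ) × ℝ → G), ContDiffOn ℝ ∞ f (U ×ˢ univ) → ∀ x ∈ U,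
      HasFDerivAt (fun x => ∫ σ in (0 : ℝ)..1, f (x, σ))
        (∫ σ in (0 : ℝ)..1, (fderiv ℝ f (x, σ)).comp (ContinuousLinearMap.inl ℝ (ℝ × ℝ) ℝ)) x := by
    intro G _ _ _ f hf x hx
    have hf' : ContinuousOn (fun p => (fderiv ℝ f p).comp (ContinuousLinearMap.inl ℝ (ℝ × ℝ) ℝ))
        (U ×ˢ univ) := by
      have := hf.continuousOn_fderiv_of_isOpen hV (by simp)
      exact this.clm_comp continuousOn_const
    obtain ⟨ε, hε, hεU⟩ := Metric.nhds_basis_closedBall.mem_iff.1 (hU.mem_nhds hx)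
    have hK : IsCompact (Metric.closedBall x ε ×ˢ Icc (0 : ℝ) 1) :=
      (isCompact_closedBall x ε).prod isCompact_Icc
    obtain ⟨C, hC⟩ := hK.exists_bound_of_continuousOn
      (hf'.mono (prod_mono hεU (subset_univ _)))
    have hline : ∀ y ∈ U, ∀ {G' : Type} [NormedAddCommGroup G'] (h : (ℝ × ℝ) × ℝ → G'),
        ContinuousOn h (U ×ˢ univ) → Continuous (fun σ => h (y, σ)) := by
      intro y hy G' _ h hh
      exact hh.comp_continuous (by fun_prop) (fun σ => ⟨hy, mem_univ _⟩)
    refine intervalIntegral.hasFDerivAt_integral_of_dominated_of_fderiv_le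
      (F := fun x σ => f (x, σ))
      (F' := fun x σ => (fderiv ℝ f (x, σ)).comp (ContinuousLinearMap.inl ℝ (ℝ × ℝ) ℝ))
      (bound := fun _ => C) (Metric.ball_mem_nhds x hε) ?_ ?_ ?_ ?_ ?_ ?_
    · filter_upwards [hU.mem_nhds hx] with y hy
      exact (hline y hy f hf.continuousOn).aestronglyMeasurable
    · exact (hline x hx f hf.continuousOn).intervalIntegrable _ _
    · exact (hline x hx _ hf').aestronglyMeasurable
    · refine Eventually.of_forall fun t ht y hy => hC (y, t) ⟨Metric.ball_subset_closedBall hy, ?_⟩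
      rw [uIoc_of_le zero_le_one] at ht
      exact Ioc_subset_Icc_self ht
    · exact intervalIntegrable_const
    · refine Eventually.of_forall fun t _ y hy => ?_
      have hyU : y ∈ U := hεU (Metric.ball_subset_closedBall hy)
      have h1 : HasFDerivAt f (fderiv ℝ f (y, t)) (y, t) :=
        ((hf.contDiffAt (hV.mem_nhds ⟨hyU, mem_univ _⟩)).differentiableAt (by simp)).hasFDerivAt
      exact h1.comp y (hasFDerivAt_prodMk_left y t)
  induction n with
  | zero =>
    intro G _ _ _ f hf
    exact contDiffOn_zero.2 fun x hx => (key f hf x hx).continuousAt.continuousWithinAt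
  | succ n ih =>
    intro G _ _ _ f hf
    rw [show ((n + 1 : ℕ) : WithTop ℕ∞) = (n : WithTop ℕ∞) + 1 by norm_cast,
      contDiffOn_succ_iff_fderiv_of_isOpen hU]
    refine ⟨fun x hx => (key f hf x hx).differentiableAt.differentiableWithinAt, by simp, ?_⟩
    refine (ih (fun p => (fderiv ℝ f p).comp (ContinuousLinearMap.inl ℝ (ℝ × ℝ) ℝ)) ?_).congr
      fun x hx => (key f hf x hx).fderiv
    exact (hf.fderiv_of_isOpen hV (by simp)).clm_comp contDiffOn_const

/-- The primitive in the second variable of a smooth function on a strip is smooth in both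
variables. -/
theorem contDiffOn_primitive {I : Set ℝ} (hI : IsOpen I) {f : ℝ × ℝ → ℝ}
    (hf : ContDiffOn ℝ ∞ f (I ×ˢ univ)) :
    ContDiffOn ℝ ∞ (fun x : ℝ × ℝ => ∫ σ in (0 : ℝ)..x.2, f (x.1, σ)) (I ×ˢ univ) := by
  have hU : IsOpen (I ×ˢ (univ : Set ℝ)) := hI.prod isOpen_univ
  have h1 : ContDiffOn ℝ ∞ (fun x : ℝ × ℝ => ∫ σ in (0 : ℝ)..1, f (x.1, x.2 * σ)) (I ×ˢ univ) := by
    rw [contDiffOn_infty]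
    intro n
    refine contDiffOn_integral_of_contDiffOn hU n
      (fun p : (ℝ × ℝ) × ℝ => f (p.1.1, p.1.2 * p.2)) ?_
    refine hf.comp (t := I ×ˢ univ)
      (g := f) (f := fun p : (ℝ × ℝ) × ℝ => (p.1.1, p.1.2 * p.2)) ?_ ?_
    · exact ContDiff.contDiffOn (by fun_prop)
    · intro p hp; exact ⟨hp.1.1, mem_univ _⟩
  refine (contDiffOn_snd.mul h1).congr fun x _ => ?_
  have := intervalIntegral.mul_integral_comp_mul_left (a := 0) (b := 1)
    (f := fun σ => f (x.1, σ)) x.2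
  simpa using this.symm

end Calculus

/-! ### Branches of the polar angle -/

/-- The branch of the polar angle of `z` that takes the value `τ` on the ray of angle `τ`. -/
noncomputable def angleNear (τ : ℝ) (z : ℂ) : ℝ :=
  τ + Complex.arg (Complex.exp (-(τ * Complex.I)) * z)

theorem contDiffAt_angleNear {τ r : ℝ} (hr : 0 < r) :
    ContDiffAt ℝ ∞ (angleNear τ) (r * Complex.exp (τ * Complex.I)) := by
  have h0 : Complex.exp (-(τ * Complex.I)) * (r * Complex.exp (τ * Complex.I)) = r := by
    rw [mul_left_comm, ← Complex.exp_add]; simp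
  have h1 : ContDiffAt ℝ ∞ (fun z : ℂ => (Complex.log (Complex.exp (-(τ * Complex.I)) * z)).im)
      (r * Complex.exp (τ * Complex.I)) := by
    have h2 : ContDiffAt ℝ ∞ Complex.log
        (Complex.exp (-(τ * Complex.I)) * (r * Complex.exp (τ * Complex.I))) := by
      refine (Complex.contDiffAt_log ?_).restrict_scalars ℝ
      rw [h0]; exact Complex.ofReal_mem_slitPlane.2 hr
    have h3 := h2.comp (r * Complex.exp (τ * Complex.I))
      (f := fun z : ℂ => Complex.exp (-(τ * Complex.I)) * z) (by fun_prop)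
    exact Complex.imCLM.contDiff.contDiffAt.comp _ h3
  exact contDiffAt_const.add (by simpa [Complex.log_im] using h1)

/-- The branch agrees with every other choice of the angle up to a multiple of `2π`. -/
theorem exists_angleNear_eq (τ : ℝ) {r : ℝ} (hr : 0 < r) (σ : ℝ) :
    ∃ n : ℤ, angleNear τ (r * Complex.exp (σ * Complex.I)) = σ + n * (2 * Real.pi) := by
  have h : Complex.exp (-(τ * Complex.I)) * (r * Complex.exp (σ * Complex.I)) =
      r * (Complex.cos ((σ - τ : ℝ)) + Complex.sin ((σ - τ : ℝ)) * Complex.I) := by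
    rw [← Complex.exp_mul_I, mul_left_comm, ← Complex.exp_add]
    congr 2; push_cast; ring
  have := Complex.arg_mul_cos_add_sin_mul_I_sub hr (σ - τ)
  refine ⟨⌊(Real.pi - (σ - τ)) / (2 * Real.pi)⌋, ?_⟩
  rw [angleNear, h]
  linarith

theorem angleNear_self (τ : ℝ) {r : ℝ} (hr : 0 < r) :
    angleNear τ (r * Complex.exp (τ * Complex.I)) = τ := by
  have h0 : Complex.exp (-(τ * Complex.I)) * (r * Complex.exp (τ * Complex.I)) = r := by
    rw [mul_left_comm, ← Complex.exp_add]; simp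
  rw [angleNear, h0, Complex.arg_ofReal_of_nonneg hr.le, add_zero]

/-! ### Parametrized submanifolds -/

section Parametrizations

variable {E V W : Type*} [NormedAddCommGroup E] [NormedSpace ℝ E]
  [NormedAddCommGroup V] [NormedSpace ℝ V] [NormedAddCommGroup W] [NormedSpace ℝ W]

/-- Through every point `e ∈ D` the map `Q` has a smooth local section on `Q(D)`, with values
in `D`. It is the restriction of a smooth map on a neighbourhood of `Q e` in the ambient space.
Hence `Q` parametrizes the submanifold `Q(D)`; it need not be injective. -/
def HasSmoothSections (Q : E → V) (D : Set E) : Prop :=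
  ∀ e ∈ D, ∃ L : V → E, ContDiffAt ℝ ∞ L (Q e) ∧ L (Q e) = e ∧
    ∀ᶠ x in 𝓝[Q '' D] (Q e), L x ∈ D ∧ Q (L x) = x

/-- The restriction to a union of fibres inherits the sections. -/
theorem HasSmoothSections.restrict {Q : E → V} {D D' : Set E} (h : HasSmoothSections Q D)
    (hsub : D' ⊆ D) (hsat : ∀ e ∈ D', ∀ e' ∈ D, Q e = Q e' → e' ∈ D') :
    HasSmoothSections Q D' := by
  intro e he
  obtain ⟨L, hL, hLe, hev⟩ := h e (hsub he)
  refine ⟨L, hL, hLe, ?_⟩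
  filter_upwards [hev.filter_mono (nhdsWithin_mono _ (image_mono hsub)), self_mem_nhdsWithin]
    with x hx hxD
  obtain ⟨e', he', rfl⟩ := hxD
  exact ⟨hsat e' he' _ hx.1 hx.2.symm, hx.2⟩

theorem HasSmoothSections.tangentConeAt_image {Q : E → V} {D : Set E} (h : HasSmoothSections Q D)
    {e : E} (he : e ∈ D) (hQ : DifferentiableAt ℝ Q e) :
    tangentConeAt ℝ (Q '' D) (Q e) = fderiv ℝ Q e '' tangentConeAt ℝ D e := by
  apply Subset.antisymm
  · intro v hv
    obtain ⟨L, hL, hLe, hev⟩ := h e he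
    have hL' : HasFDerivAt L (fderiv ℝ L (Q e)) (Q e) :=
      (hL.differentiableAt (by simp)).hasFDerivAt
    obtain ⟨N, hN, hNsub⟩ := mem_nhdsWithin_iff_exists_mem_nhds_inter.1 hev
    have h1 : tangentConeAt ℝ (Q '' D) (Q e) = tangentConeAt ℝ (Q '' D ∩ N) (Q e) :=
      (tangentConeAt_inter_nhds hN).symm
    refine ⟨fderiv ℝ L (Q e) v, ?_, ?_⟩
    · have h2 := (hL'.hasFDerivWithinAt (s := Q '' D ∩ N)).mapsTo_tangent_cone (h1 ▸ hv)
      rw [hLe] at h2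
      refine tangentConeAt_mono ?_ h2
      rintro _ ⟨x, hx, rfl⟩
      exact (hNsub ⟨hx.2, hx.1⟩).1
    · have h3 : HasFDerivWithinAt (Q ∘ L) ((fderiv ℝ Q e).comp (fderiv ℝ L (Q e))) (Q '' D)
          (Q e) := by
        refine HasFDerivAt.hasFDerivWithinAt (HasFDerivAt.comp (Q e) ?_ hL')
        rw [hLe]; exact hQ.hasFDerivAt
      have h4 : HasFDerivWithinAt (Q ∘ L) (ContinuousLinearMap.id ℝ V) (Q '' D) (Q e) := by
        refine (hasFDerivWithinAt_id (Q e) (Q '' D)).congr_of_eventuallyEq ?_ (by simp [hLe])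
        filter_upwards [hev] with x hx
        exact hx.2
      exact h3.unique_on h4 hv
  · rintro _ ⟨w, hw, rfl⟩
    exact hQ.hasFDerivAt.hasFDerivWithinAt.mapsTo_tangent_cone hw

variable {Q : E → V} {P : E → W} {D : Set E}

/-- A map `Φ` with `Φ ∘ Q = P` is smooth if `Q` has smooth sections. -/
theorem HasSmoothSections.contDiffOn_of_comp_eq (hQ : HasSmoothSections Q D)
    (hP : ∀ e ∈ D, ContDiffAt ℝ ∞ P e) {Φ : V → W} (hΦ : ∀ e ∈ D, Φ (Q e) = P e) :
    ContDiffOn ℝ ∞ Φ (Q '' D) := by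
  rintro _ ⟨e, he, rfl⟩
  obtain ⟨L, hL, hLe, hev⟩ := hQ e he
  have h1 : ContDiffAt ℝ ∞ (P ∘ L) (Q e) := by
    refine ContDiffAt.comp (Q e) ?_ hL
    rw [hLe]; exact hP e he
  refine h1.contDiffWithinAt.congr_of_eventuallyEq ?_ (by simp [hLe, hΦ e he])
  filter_upwards [hev] with x hx
  rw [Function.comp, ← hΦ _ hx.1, hx.2]

/-- Two parametrizations over the same domain with the same fibres parametrize diffeomorphic
submanifolds. -/
theorem HasSmoothSections.isDiffeoOn (hQ : HasSmoothSections Q D) (hP : HasSmoothSections P D)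
    (hQs : ∀ e ∈ D, ContDiffAt ℝ ∞ Q e) (hPs : ∀ e ∈ D, ContDiffAt ℝ ∞ P e)
    (hfib : ∀ e ∈ D, ∀ e' ∈ D, Q e = Q e' ↔ P e = P e') {Φ : V → W}
    (hΦ : ∀ e ∈ D, Φ (Q e) = P e) :
    IsDiffeoOn Φ (Q '' D) (P '' D) := by
  classical
  let Ψ : W → V := fun y => if h : ∃ e ∈ D, P e = y then Q h.choose else 0
  have hΨ : ∀ e ∈ D, Ψ (P e) = Q e := by
    intro e he
    have h : ∃ e' ∈ D, P e' = P e := ⟨e, he, rfl⟩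
    simp only [Ψ, dif_pos h]
    exact (hfib _ h.choose_spec.1 e he).2 h.choose_spec.2
  have hinv : InvOn Ψ Φ (Q '' D) (P '' D) := by
    constructor
    · rintro _ ⟨e, he, rfl⟩
      rw [hΦ e he, hΨ e he]
    · rintro _ ⟨e, he, rfl⟩
      rw [hΨ e he, hΦ e he]
  refine ⟨hinv.bijOn ?_ ?_, hQ.contDiffOn_of_comp_eq hPs hΦ, Ψ, hinv,
    hP.contDiffOn_of_comp_eq hQs hΨ⟩
  · rintro _ ⟨e, he, rfl⟩
    exact ⟨e, he, (hΦ e he).symm⟩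
  · rintro _ ⟨e, he, rfl⟩
    exact ⟨e, he, (hΨ e he).symm⟩

/-- The derivative of `Φ` on a tangent vector of `Q(D)`, in terms of the parametrizations. -/
theorem HasSmoothSections.exists_fderivWithin_eq (hQ : HasSmoothSections Q D)
    (hQs : ∀ e ∈ D, ContDiffAt ℝ ∞ Q e) (hPs : ∀ e ∈ D, ContDiffAt ℝ ∞ P e) {Φ : V → W}
    (hΦ : ∀ e ∈ D, Φ (Q e) = P e) {e : E} (he : e ∈ D) {v : V}
    (hv : v ∈ tangentConeAt ℝ (Q '' D) (Q e)) :
    ∃ w ∈ tangentConeAt ℝ D e, v = fderiv ℝ Q e w ∧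
      fderivWithin ℝ Φ (Q '' D) (Q e) v = fderiv ℝ P e w := by
  have hQe := (hQs e he).differentiableAt (by simp)
  rw [hQ.tangentConeAt_image he hQe] at hv
  obtain ⟨w, hw, rfl⟩ := hv
  refine ⟨w, hw, rfl, ?_⟩
  have h1 := ((hQ.contDiffOn_of_comp_eq hPs hΦ _ ⟨e, he, rfl⟩).differentiableWithinAt
    (by simp)).hasFDerivWithinAt
  have h2 := h1.comp e hQe.hasFDerivAt.hasFDerivWithinAt (mapsTo_image Q D)
  have h3 : HasFDerivWithinAt (Φ ∘ Q) (fderiv ℝ P e) D e :=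
    ((hPs e he).differentiableAt (by simp)).hasFDerivAt.hasFDerivWithinAt.congr
      (fun x hx => hΦ x hx) (hΦ e he)
  exact h2.unique_on h3 hw

theorem HasSmoothSections.pullbackOneEqOn (hQ : HasSmoothSections Q D)
    (hQs : ∀ e ∈ D, ContDiffAt ℝ ∞ Q e) (hPs : ∀ e ∈ D, ContDiffAt ℝ ∞ P e) {Φ : V → W}
    (hΦ : ∀ e ∈ D, Φ (Q e) = P e) {α : V → V →L[ℝ] ℝ} {β : W → W →L[ℝ] ℝ}
    (h : ∀ e ∈ D, ∀ w, β (P e) (fderiv ℝ P e w) = α (Q e) (fderiv ℝ Q e w)) :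
    PullbackOneEqOn Φ (Q '' D) β α := by
  rintro _ ⟨e, he, rfl⟩ v hv
  obtain ⟨w, -, rfl, hw⟩ := hQ.exists_fderivWithin_eq hQs hPs hΦ he hv
  rw [hw, hΦ e he, h e he]

theorem HasSmoothSections.pullbackTwoEqOn (hQ : HasSmoothSections Q D)
    (hQs : ∀ e ∈ D, ContDiffAt ℝ ∞ Q e) (hPs : ∀ e ∈ D, ContDiffAt ℝ ∞ P e) {Φ : V → W}
    (hΦ : ∀ e ∈ D, Φ (Q e) = P e) {α : V → V → V → ℝ} {β : W → W → W → ℝ}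
    (h : ∀ e ∈ D, ∀ w w', β (P e) (fderiv ℝ P e w) (fderiv ℝ P e w') =
      α (Q e) (fderiv ℝ Q e w) (fderiv ℝ Q e w')) :
    PullbackTwoEqOn Φ (Q '' D) β α := by
  rintro _ ⟨e, he, rfl⟩ v hv v' hv'
  obtain ⟨w, -, rfl, hw⟩ := hQ.exists_fderivWithin_eq hQs hPs hΦ he hv
  obtain ⟨w', -, rfl, hw'⟩ := hQ.exists_fderivWithin_eq hQs hPs hΦ he hv'
  rw [hw, hw', hΦ e he, h e he]

theorem two_le_infty : (2 : WithTop ℕ∞) ≤ ∞ := by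
  norm_cast

/-- The exterior derivative commutes with pullback. -/
theorem dOne_pullback {α : V → V →L[ℝ] ℝ} {e : E} (hα : DifferentiableAt ℝ α (Q e))
    (hQ : ContDiffAt ℝ ∞ Q e) (v w : E) :
    dOne (fun e => (α (Q e)).comp (fderiv ℝ Q e)) e v w =
      dOne α (Q e) (fderiv ℝ Q e v) (fderiv ℝ Q e w) := by
  have hQd : HasFDerivAt Q (fderiv ℝ Q e) e := (hQ.differentiableAt (by simp)).hasFDerivAt
  have hQ2 : HasFDerivAt (fderiv ℝ Q) (fderiv ℝ (fderiv ℝ Q) e) e :=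
    ((hQ.fderiv_right (m := 1) (by norm_cast)).differentiableAt (by simp)).hasFDerivAt
  have h1 : HasFDerivAt (fun e => α (Q e)) ((fderiv ℝ α (Q e)).comp (fderiv ℝ Q e)) e :=
    hα.hasFDerivAt.comp e hQd
  have hsymm : fderiv ℝ (fderiv ℝ Q) e v w = fderiv ℝ (fderiv ℝ Q) e w v :=
    (hQ.isSymmSndFDerivAt (by simpa using two_le_infty)).eq v w
  rw [dOne, (h1.clm_comp hQ2).fderiv]
  simp [dOne, hsymm]

/-- If two pullbacks of one-forms agree on an open set, so do the pullbacks of their exterior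
derivatives. -/
theorem dOne_eq_of_pullback_eq (hD : IsOpen D) (hQs : ∀ e ∈ D, ContDiffAt ℝ ∞ Q e)
    (hPs : ∀ e ∈ D, ContDiffAt ℝ ∞ P e) {α : V → V →L[ℝ] ℝ} {β : W → W →L[ℝ] ℝ}
    (hα : Differentiable ℝ α) (hβ : Differentiable ℝ β)
    (h : ∀ e ∈ D, ∀ w, β (P e) (fderiv ℝ P e w) = α (Q e) (fderiv ℝ Q e w)) {e : E} (he : e ∈ D)
    (v w : E) : dOne β (P e) (fderiv ℝ P e v) (fderiv ℝ P e w) =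
      dOne α (Q e) (fderiv ℝ Q e v) (fderiv ℝ Q e w) := by
  rw [← dOne_pullback (hα _) (hQs e he), ← dOne_pullback (hβ _) (hPs e he)]
  have : (fun e => (β (P e)).comp (fderiv ℝ P e)) =ᶠ[𝓝 e]
      fun e => (α (Q e)).comp (fderiv ℝ Q e) := by
    filter_upwards [hD.mem_nhds he] with x hx
    ext w; exact h x hx w
  rw [dOne, dOne, this.fderiv_eq]

/-- A one-form is a contact form on a parametrized submanifold if its pullback to the domain of the
parametrization is one. -/
theorem HasSmoothSections.isContactFormOn (hD : IsOpen D) (hQ : HasSmoothSections Q D)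
    (hQs : ∀ e ∈ D, ContDiffAt ℝ ∞ Q e) {α : V → V →L[ℝ] ℝ} (hα : Differentiable ℝ α)
    {η : E → E →L[ℝ] ℝ} (hη : ∀ e ∈ D, ∀ w, α (Q e) (fderiv ℝ Q e w) = η e w)
    (hc : IsContactFormOn D η) : IsContactFormOn (Q '' D) α := by
  have hd : ∀ e ∈ D, ∀ v w, dOne α (Q e) (fderiv ℝ Q e v) (fderiv ℝ Q e w) = dOne η e v w := by
    intro e he v w
    rw [← dOne_pullback (hα _) (hQs e he)]
    have : (fun e => (α (Q e)).comp (fderiv ℝ Q e)) =ᶠ[𝓝 e] η := by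
      filter_upwards [hD.mem_nhds he] with x hx
      ext w; exact hη x hx w
    rw [dOne, dOne, this.fderiv_eq]
  rintro _ ⟨e, he, rfl⟩
  rw [hQ.tangentConeAt_image he ((hQs e he).differentiableAt (by simp))]
  obtain ⟨⟨v, hv, hv0⟩, h2⟩ := hc e he
  refine ⟨⟨_, ⟨v, hv, rfl⟩, by rwa [hη e he]⟩, ?_⟩
  rintro _ ⟨w, hw, rfl⟩ hw0 hker
  rw [h2 w hw (by rwa [← hη e he]) ?_, map_zero]
  intro w' hw' hw0'
  rw [← hd e he]
  exact hker _ ⟨w', hw', rfl⟩ (by rwa [hη e he])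

end Parametrizations

/-! ### Functions of two variables -/

section PartialDerivatives

/-- The partial derivative in the first variable. -/
noncomputable def partialFst (f : ℝ × ℝ → ℝ) (x : ℝ × ℝ) : ℝ := fderiv ℝ f x (1, 0)

/-- The partial derivative in the second variable. -/
noncomputable def partialSnd (f : ℝ × ℝ → ℝ) (x : ℝ × ℝ) : ℝ := fderiv ℝ f x (0, 1)

theorem fderiv_eq_partials (f : ℝ × ℝ → ℝ) (x v : ℝ × ℝ) :
    fderiv ℝ f x v = v.1 * partialFst f x + v.2 * partialSnd f x := by
  have : v = v.1 • ((1 : ℝ), (0 : ℝ)) + v.2 • ((0 : ℝ), (1 : ℝ)) := by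
    ext <;> simp
  rw [this, map_add, map_smul, map_smul]
  simp [partialFst, partialSnd]

theorem DifferentiableAt.hasDerivAt_partialFst {f : ℝ × ℝ → ℝ} {c τ : ℝ}
    (hf : DifferentiableAt ℝ f (c, τ)) :
    HasDerivAt (fun t => f (t, τ)) (partialFst f (c, τ)) c :=
  HasFDerivAt.comp_hasDerivAt c hf.hasFDerivAt ((hasDerivAt_id c).prodMk (hasDerivAt_const c τ))

theorem DifferentiableAt.hasDerivAt_partialSnd {f : ℝ × ℝ → ℝ} {c τ : ℝ}
    (hf : DifferentiableAt ℝ f (c, τ)) :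
    HasDerivAt (fun t => f (c, t)) (partialSnd f (c, τ)) τ :=
  HasFDerivAt.comp_hasDerivAt τ hf.hasFDerivAt ((hasDerivAt_const τ c).prodMk (hasDerivAt_id τ))

variable {D : Set (ℝ × ℝ)} (hD : IsOpen D)
include hD

theorem ContDiffOn.partialFst {f : ℝ × ℝ → ℝ} (hf : ContDiffOn ℝ ∞ f D) :
    ContDiffOn ℝ ∞ (partialFst f) D :=
  (hf.fderiv_of_isOpen hD (by simp)).clm_apply contDiffOn_const

theorem ContDiffOn.partialSnd {f : ℝ × ℝ → ℝ} (hf : ContDiffOn ℝ ∞ f D) :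
    ContDiffOn ℝ ∞ (partialSnd f) D :=
  (hf.fderiv_of_isOpen hD (by simp)).clm_apply contDiffOn_const

theorem ContDiffOn.differentiableAt_of_isOpen {f : ℝ × ℝ → ℝ} (hf : ContDiffOn ℝ ∞ f D)
    {x : ℝ × ℝ} (hx : x ∈ D) : DifferentiableAt ℝ f x :=
  (hf.contDiffAt (hD.mem_nhds hx)).differentiableAt (by simp)

theorem partialSnd_partialFst {f : ℝ × ℝ → ℝ} (hf : ContDiffOn ℝ ∞ f D) {x : ℝ × ℝ} (hx : x ∈ D) :
    _root_.partialSnd (_root_.partialFst f) x = _root_.partialFst (_root_.partialSnd f) x := by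
  have h := hf.contDiffAt (hD.mem_nhds hx)
  have h2 : DifferentiableAt ℝ (fderiv ℝ f) x :=
    (h.fderiv_right (m := 1) (by norm_cast)).differentiableAt (by simp)
  have hs := (h.isSymmSndFDerivAt (by simpa using two_le_infty)).eq (0, 1) (1, 0)
  have e1 : ∀ v : ℝ × ℝ, fderiv ℝ (fun y => fderiv ℝ f y v) x =
      (fderiv ℝ (fderiv ℝ f) x).flip v := by
    intro v
    have := (h2.hasFDerivAt.clm_apply (hasFDerivAt_const v x)).fderiv
    rw [this]; ext <;> simp
  change fderiv ℝ (fun y => fderiv ℝ f y (1, 0)) x (0, 1) =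
    fderiv ℝ (fun y => fderiv ℝ f y (0, 1)) x (1, 0)
  rw [e1, e1]
  exact hs

end PartialDerivatives

section Primitive

variable {I : Set ℝ} (hI : IsOpen I)
include hI

/-- If `w` is the primitive of the restriction of the one-form `a df` to the lines of constant first
coordinate `c`, then `dw = a df + k dc`, where `k` is a primitive of the density of
`da ∧ df`. -/
theorem partialSnd_primitive_sub {a f : ℝ × ℝ → ℝ}
    (ha : ContDiffOn ℝ ∞ a (I ×ˢ univ)) (hf : ContDiffOn ℝ ∞ f (I ×ˢ univ)) {w : ℝ × ℝ → ℝ}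
    (hw : ContDiffOn ℝ ∞ w (I ×ˢ univ))
    (hwτ : ∀ x ∈ I ×ˢ (univ : Set ℝ), partialSnd w x = a x * partialSnd f x)
    {x : ℝ × ℝ} (hx : x ∈ I ×ˢ (univ : Set ℝ)) :
    partialSnd (fun x => partialFst w x - a x * partialFst f x) x =
      partialFst a x * partialSnd f x - partialSnd a x * partialFst f x := by
  have hD : IsOpen (I ×ˢ (univ : Set ℝ)) := hI.prod isOpen_univ
  have hda := ha.differentiableAt_of_isOpen hD hx
  have h1 := (hw.partialFst hD).differentiableAt_of_isOpen hD hx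
  have h2 := (hf.partialFst hD).differentiableAt_of_isOpen hD hx
  have h3 := (hf.partialSnd hD).differentiableAt_of_isOpen hD hx
  have e1 : partialSnd (fun x => partialFst w x - a x * partialFst f x) x =
      partialSnd (partialFst w) x -
        (a x * partialSnd (partialFst f) x + partialFst f x * partialSnd a x) := by
    have := (h1.hasFDerivAt.sub (hda.hasFDerivAt.mul h2.hasFDerivAt)).fderiv
    simp only [Pi.sub_def, Pi.mul_def] at this
    rw [partialSnd, this]
    simp [partialSnd]
  have e2 : partialFst (partialSnd w) x =
      a x * partialFst (partialSnd f) x + partialSnd f x * partialFst a x := by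
    have h4 : partialSnd w =ᶠ[𝓝 x] fun x => a x * partialSnd f x := by
      filter_upwards [hD.mem_nhds hx] with y hy using hwτ y hy
    rw [partialFst, h4.fderiv_eq]
    have := (hda.hasFDerivAt.mul h3.hasFDerivAt).fderiv
    simp only [Pi.mul_def] at this
    rw [this]
    simp [partialFst]
  rw [e1, partialSnd_partialFst hD hw hx, e2, partialSnd_partialFst hD hf hx]
  ring

end Primitive

/-! ### The profile curve -/

namespace SphereOfRevolution

variable (S : SphereOfRevolution)

theorem hasDerivAt_u {z : ℝ} (hz : z ∈ Ioo S.a S.b) : HasDerivAt S.u (deriv S.u z) z :=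
  ((S.contDiffOn_u.contDiffAt (isOpen_Ioo.mem_nhds hz)).differentiableAt (by simp)).hasDerivAt

theorem contDiffOn_deriv_u : ContDiffOn ℝ ∞ (deriv S.u) (Ioo S.a S.b) :=
  S.contDiffOn_u.deriv_of_isOpen isOpen_Ioo (by simp)

/-- The length element `√(1 + u'²)` of the profile curve. -/
noncomputable def speed (z : ℝ) : ℝ := √(deriv S.u z ^ 2 + 1)

theorem speed_pos (z : ℝ) : 0 < S.speed z := Real.sqrt_pos.2 (by positivity)

theorem speed_sq (z : ℝ) : S.speed z ^ 2 = deriv S.u z ^ 2 + 1 := Real.sq_sqrt (by positivity)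

theorem contDiffOn_speed : ContDiffOn ℝ ∞ S.speed (Ioo S.a S.b) := by
  refine ContDiffOn.sqrt ((S.contDiffOn_deriv_u.pow 2).add contDiffOn_const) ?_
  intro z _
  positivity

/-- The height `z₀` is the height of the only equator. -/
structure HasUniqueEquator (z₀ : ℝ) : Prop where
  isEquatorHeight : S.IsEquatorHeight z₀
  eq_of_isEquatorHeight : ∀ z, S.IsEquatorHeight z → z = z₀

namespace HasUniqueEquator

variable {S} {z₀ : ℝ} (h : S.HasUniqueEquator z₀)
include h

theorem mem_Ioo : z₀ ∈ Ioo S.a S.b := h.isEquatorHeight.1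

theorem u_pos : 0 < S.u z₀ := S.u_pos z₀ h.mem_Ioo

theorem deriv_pos {z : ℝ} (hz : z ∈ Ioo S.a z₀) : 0 < deriv S.u z := by
  have hsub : Ioo S.a z₀ ⊆ Ioo S.a S.b := Ioo_subset_Ioo_right h.mem_Ioo.2.le
  have hne : ∀ x ∈ Ioo S.a z₀, deriv S.u x ≠ 0 := fun x hx h0 =>
    hx.2.ne (h.eq_of_isEquatorHeight x ⟨hsub hx, h0⟩)
  rcases hasDerivWithinAt_forall_lt_or_forall_gt_of_forall_ne (convex_Ioo S.a z₀)
    (fun x hx => (S.hasDerivAt_u (hsub hx)).hasDerivWithinAt) hne with h1 | h1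
  · exfalso
    obtain ⟨y, hy, hy'⟩ := exists_deriv_eq_slope S.u h.mem_Ioo.1
      (S.continuousOn_u.mono (Icc_subset_Icc_right h.mem_Ioo.2.le))
      (fun x hx => (S.hasDerivAt_u (hsub hx)).differentiableAt.differentiableWithinAt)
    have h2 := h1 y hy
    rw [hy', S.u_a, sub_zero] at h2
    exact absurd h2 (not_lt.2 (div_nonneg h.u_pos.le (sub_nonneg.2 h.mem_Ioo.1.le)))
  · exact h1 z hz

theorem deriv_neg {z : ℝ} (hz : z ∈ Ioo z₀ S.b) : deriv S.u z < 0 := by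
  have hsub : Ioo z₀ S.b ⊆ Ioo S.a S.b := Ioo_subset_Ioo_left h.mem_Ioo.1.le
  have hne : ∀ x ∈ Ioo z₀ S.b, deriv S.u x ≠ 0 := fun x hx h0 =>
    hx.1.ne' (h.eq_of_isEquatorHeight x ⟨hsub hx, h0⟩)
  rcases hasDerivWithinAt_forall_lt_or_forall_gt_of_forall_ne (convex_Ioo z₀ S.b)
    (fun x hx => (S.hasDerivAt_u (hsub hx)).hasDerivWithinAt) hne with h1 | h1
  · exact h1 z hz
  · exfalso
    obtain ⟨y, hy, hy'⟩ := exists_deriv_eq_slope S.u h.mem_Ioo.2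
      (S.continuousOn_u.mono (Icc_subset_Icc_left h.mem_Ioo.1.le))
      (fun x hx => (S.hasDerivAt_u (hsub hx)).differentiableAt.differentiableWithinAt)
    have h2 := h1 y hy
    rw [hy', S.u_b, zero_sub] at h2
    exact absurd h2 (not_lt.2 (div_nonpos_of_nonpos_of_nonneg (neg_nonpos.2 h.u_pos.le)
      (sub_nonneg.2 h.mem_Ioo.2.le)))

theorem strictMonoOn : StrictMonoOn S.u (Icc S.a z₀) := by
  refine strictMonoOn_of_deriv_pos (convex_Icc _ _)
    (S.continuousOn_u.mono (Icc_subset_Icc_right h.mem_Ioo.2.le)) ?_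
  rw [interior_Icc]
  exact fun z hz => h.deriv_pos hz

theorem strictAntiOn : StrictAntiOn S.u (Icc z₀ S.b) := by
  refine strictAntiOn_of_deriv_neg (convex_Icc _ _)
    (S.continuousOn_u.mono (Icc_subset_Icc_left h.mem_Ioo.1.le)) ?_
  rw [interior_Icc]
  exact fun z hz => h.deriv_neg hz

/-- The profile decreases strictly away from the equator. -/
theorem u_lt {t : ℝ} (ht : t ≠ 0) {r s : ℝ} (hr : 0 ≤ r) (hrs : r < s)
    (hs : z₀ - s * t ∈ Icc S.a S.b) : S.u (z₀ - s * t) < S.u (z₀ - r * t) := by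
  rcases lt_or_gt_of_ne ht with ht | ht
  · have h1 : r * -t < s * -t := mul_lt_mul_of_pos_right hrs (by linarith)
    have h2 : 0 ≤ r * -t := mul_nonneg hr (by linarith)
    exact h.strictAntiOn ⟨by linarith, by linarith [hs.2]⟩ ⟨by linarith, hs.2⟩ (by linarith)
  · have h1 : r * t < s * t := mul_lt_mul_of_pos_right hrs ht
    have h2 : 0 ≤ r * t := mul_nonneg hr ht.le
    exact h.strictMonoOn ⟨hs.1, by linarith⟩ ⟨by linarith [hs.1], by linarith⟩ (by linarith)

theorem u_lt_u {z : ℝ} (hz : z ∈ Icc S.a S.b) (hne : z ≠ z₀) : S.u z < S.u z₀ := by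
  have := h.u_lt (t := z₀ - z) (sub_ne_zero.2 hne.symm) le_rfl one_pos (by simpa using hz)
  simpa using this

theorem u_le {z : ℝ} (hz : z ∈ Icc S.a S.b) : S.u z ≤ S.u z₀ := by
  rcases eq_or_ne z z₀ with rfl | hne
  · exact le_rfl
  · exact (h.u_lt_u hz hne).le

theorem sub_mul_deriv_nonpos {z : ℝ} (hz : z ∈ Ioo S.a S.b) : (z - z₀) * deriv S.u z ≤ 0 := by
  rcases lt_trichotomy z z₀ with h1 | rfl | h1
  · exact mul_nonpos_of_nonpos_of_nonneg (by linarith) (h.deriv_pos ⟨hz.1, h1⟩).le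
  · simp
  · exact mul_nonpos_of_nonneg_of_nonpos (by linarith) (h.deriv_neg ⟨h1, hz.2⟩).le

end HasUniqueEquator

end SphereOfRevolution

/-! ### Polar coordinates around the equator in the reduced phase plane -/

namespace SphereOfRevolution

variable (S : SphereOfRevolution)

/-- The point with polar coordinates `(ρ, τ)` around `(z₀, 0)` in the `(z, ξ)`-plane, i.e.
`z = z₀ - ρ cos τ` and `ξ = ρ sin τ`, lies on the curve `u(z)² (1 - ξ²) = c²`, in the open rectangle
`(a, b) × (-1, 1)`. Here `ξ` is the component of a unit covector along the meridian, so that `c` is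
the Clairaut constant. -/
structure IsRadius (z₀ c τ ρ : ℝ) : Prop where
  pos : 0 < ρ
  mem_Ioo : z₀ - ρ * Real.cos τ ∈ Ioo S.a S.b
  sq_lt_one : (ρ * Real.sin τ) ^ 2 < 1
  level : S.u (z₀ - ρ * Real.cos τ) ^ 2 * (1 - (ρ * Real.sin τ) ^ 2) = c ^ 2

/-- The domain of the coordinates `(c, τ)`. -/
def strip (z₀ : ℝ) : Set (ℝ × ℝ) := Ioo 0 (S.u z₀) ×ˢ univ

theorem isOpen_strip (z₀ : ℝ) : IsOpen (S.strip z₀) := isOpen_Ioo.prod isOpen_univ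

open Classical in
/-- The polar radius of the curve `u(z)² (1 - ξ²) = c²` as a function of `(c, τ)`. -/
noncomputable def radius (z₀ : ℝ) (x : ℝ × ℝ) : ℝ :=
  if h : ∃ ρ, S.IsRadius z₀ x.1 x.2 ρ then h.choose else 0

/-- The height `z` as a function of `(c, τ)`. -/
noncomputable def height (z₀ : ℝ) (x : ℝ × ℝ) : ℝ := z₀ - S.radius z₀ x * Real.cos x.2

/-- The meridian component `ξ` as a function of `(c, τ)`. -/
noncomputable def slope (z₀ : ℝ) (x : ℝ × ℝ) : ℝ := S.radius z₀ x * Real.sin x.2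

variable {S} {z₀ : ℝ}

namespace IsRadius

/-- The level curves are transversal to the rays from the equator. Both factors of
`u(z)² (1 - ξ²)` have a nonpositive radial derivative, and one of the two derivatives is nonzero. -/
theorem deriv_ne_zero (h : S.HasUniqueEquator z₀) {c τ ρ : ℝ} (hr : S.IsRadius z₀ c τ ρ) :
    ∃ N' : ℝ, N' ≠ 0 ∧ HasDerivAt (fun ρ => S.u (z₀ - ρ * Real.cos τ) ^ 2 *
      (1 - (ρ * Real.sin τ) ^ 2)) N' ρ := by
  have hz : HasDerivAt (fun ρ : ℝ => z₀ - ρ * Real.cos τ) (-Real.cos τ) ρ := by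
    simpa using ((hasDerivAt_id ρ).mul_const (Real.cos τ)).const_sub z₀
  have hx : HasDerivAt (fun ρ : ℝ => ρ * Real.sin τ) (Real.sin τ) ρ := by
    simpa using (hasDerivAt_id ρ).mul_const (Real.sin τ)
  have hu := (S.hasDerivAt_u hr.mem_Ioo).comp ρ hz
  refine ⟨_, ?_, (hu.pow 2).mul ((hx.pow 2).const_sub 1)⟩
  have hupos := S.u_pos _ hr.mem_Ioo
  have hs := h.sub_mul_deriv_nonpos hr.mem_Ioo
  have h1 := hr.sq_lt_one
  have hρ := hr.pos
  simp only [Function.comp]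
  set U := S.u (z₀ - ρ * Real.cos τ)
  set U' := deriv S.u (z₀ - ρ * Real.cos τ) with hU'
  have hs' : 0 ≤ Real.cos τ * U' := by
    by_contra hcon
    push Not at hcon
    nlinarith
  apply ne_of_lt
  have hA : 0 ≤ (Real.cos τ * U') * U * (1 - (ρ * Real.sin τ) ^ 2) :=
    mul_nonneg (mul_nonneg hs' hupos.le) (by linarith)
  by_cases hsin : Real.sin τ = 0
  · have hcos : Real.cos τ ≠ 0 := by
      intro h0
      have := Real.sin_sq_add_cos_sq τ
      rw [hsin, h0] at this
      norm_num at this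
    have hU'0 : U' ≠ 0 := fun h0 => by
      have := h.eq_of_isEquatorHeight _ ⟨hr.mem_Ioo, h0⟩
      have h3 : ρ * Real.cos τ = 0 := by linarith
      exact (mul_ne_zero hρ.ne' hcos) h3
    have h2 : 0 < Real.cos τ * U' := lt_of_le_of_ne hs' (mul_ne_zero hcos hU'0).symm
    have h4 : 0 < (Real.cos τ * U') * U := mul_pos h2 hupos
    simp only [hsin]
    norm_num
    nlinarith
  · have h5 : 0 < U ^ 2 * (ρ * Real.sin τ ^ 2) := by positivity
    norm_num
    nlinarith

theorem unique (h : S.HasUniqueEquator z₀) {c τ ρ ρ' : ℝ} (hr : S.IsRadius z₀ c τ ρ)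
    (hr' : S.IsRadius z₀ c τ ρ') : ρ = ρ' := by
  by_contra hne
  wlog hlt : ρ < ρ' generalizing ρ ρ'
  · exact this hr' hr (Ne.symm hne) (lt_of_le_of_ne (not_lt.1 hlt) (Ne.symm hne))
  have hu := S.u_pos _ hr.mem_Ioo
  have hu' := S.u_pos _ hr'.mem_Ioo
  have h1 := hr.level.trans hr'.level.symm
  have h2 := hr'.sq_lt_one
  have hsq : (ρ * Real.sin τ) ^ 2 ≤ (ρ' * Real.sin τ) ^ 2 := by
    rw [mul_pow, mul_pow]
    have := hr.pos
    gcongr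
  rcases eq_or_ne (Real.cos τ) 0 with hc | hc
  · have hsin : 0 < Real.sin τ ^ 2 := by
      have := Real.sin_sq_add_cos_sq τ
      rw [hc] at this
      nlinarith
    rw [hc, mul_zero, mul_zero] at h1
    rw [hc, mul_zero, sub_zero] at hu
    have h3 : (ρ * Real.sin τ) ^ 2 < (ρ' * Real.sin τ) ^ 2 := by
      rw [mul_pow, mul_pow]
      have := hr.pos
      gcongr
    have h4 : 0 < S.u (z₀ - 0) ^ 2 := by rw [sub_zero]; positivity
    nlinarith
  · have hlt' := h.u_lt hc hr.pos.le hlt (Ioo_subset_Icc_self hr'.mem_Ioo)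
    have h3 : S.u (z₀ - ρ' * Real.cos τ) ^ 2 < S.u (z₀ - ρ * Real.cos τ) ^ 2 := by gcongr
    nlinarith [mul_pos (sub_pos.2 h3) (sub_pos.2 h2),
      mul_nonneg (sq_nonneg (S.u (z₀ - ρ * Real.cos τ))) (sub_nonneg.2 hsq)]

theorem exists_isRadius (h : S.HasUniqueEquator z₀) {c : ℝ} (hc : c ∈ Ioo 0 (S.u z₀)) (τ : ℝ) :
    ∃ ρ, S.IsRadius z₀ c τ ρ := by
  -- Extend `u` by zero outside `[a, b]` and truncate `1 - ξ²` at zero to get a continuous function.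
  let v : ℝ → ℝ := IccExtend S.a_lt_b.le (fun z : Icc S.a S.b => S.u z)
  have hv : Continuous v := (continuousOn_iff_continuous_domRestrict.1 S.continuousOn_u).Icc_extend'
  have hvin : ∀ z ∈ Icc S.a S.b, v z = S.u z := fun z hz => IccExtend_of_mem _ _ hz
  have hvl : ∀ z, z ≤ S.a → v z = 0 := fun z hz => by
    simp only [v, IccExtend_of_le_left _ _ hz, S.u_a]
  have hvr : ∀ z, S.b ≤ z → v z = 0 := fun z hz => by
    simp only [v, IccExtend_of_right_le _ _ hz, S.u_b]
  let N : ℝ → ℝ := fun ρ => v (z₀ - ρ * Real.cos τ) ^ 2 * max 0 (1 - (ρ * Real.sin τ) ^ 2)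
  have hN : Continuous N := by fun_prop
  have hN0 : N 0 = S.u z₀ ^ 2 := by
    simp [N, hvin _ (Ioo_subset_Icc_self h.mem_Ioo)]
  let M : ℝ := 1 + (S.b - S.a)
  have hM : 0 < M := by have := S.a_lt_b; simp only [M]; linarith
  have hNM : N M = 0 := by
    by_cases hs : (M * Real.sin τ) ^ 2 < 1
    · have h1 : (S.b - S.a) ^ 2 ≤ (M * Real.cos τ) ^ 2 := by
        have h2 : (M * Real.cos τ) ^ 2 = M ^ 2 - (M * Real.sin τ) ^ 2 := by
          have := Real.sin_sq_add_cos_sq τ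
          linear_combination M ^ 2 * this
        have := S.a_lt_b
        rw [h2]
        simp only [M]
        simp only [M] at hs
        nlinarith
      have h2 : S.b - S.a ≤ |M * Real.cos τ| := by
        have := S.a_lt_b
        rw [← abs_of_nonneg (sub_nonneg.2 S.a_lt_b.le)]
        exact sq_le_sq.1 h1
      have h3 := h.mem_Ioo
      have h4 : v (z₀ - M * Real.cos τ) = 0 := by
        rcases le_abs.1 h2 with h5 | h5
        · exact hvl _ (by linarith [h3.2])
        · exact hvr _ (by linarith [h3.1])
      simp [N, h4]
    · simp only [N]
      rw [max_eq_left (by linarith), mul_zero]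
  have hc2 : c ^ 2 ∈ Icc (N M) (N 0) := by
    rw [hNM, hN0]
    exact ⟨sq_nonneg c, by have := hc.1; have := hc.2; gcongr⟩
  obtain ⟨ρ, hρ, hρc⟩ := intermediate_value_Icc' hM.le hN.continuousOn hc2
  have hcpos : 0 < c ^ 2 := pow_pos hc.1 2
  have hin : z₀ - ρ * Real.cos τ ∈ Ioo S.a S.b := by
    by_contra hout
    have : v (z₀ - ρ * Real.cos τ) = 0 := by
      rcases le_or_gt (z₀ - ρ * Real.cos τ) S.a with h1 | h1
      · exact hvl _ h1
      · exact hvr _ (not_lt.1 fun h2 => hout ⟨h1, h2⟩)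
    simp [N, this] at hρc
    exact hcpos.ne hρc
  have hsq : (ρ * Real.sin τ) ^ 2 < 1 := by
    by_contra hout
    simp only [N] at hρc
    rw [max_eq_left (by linarith), mul_zero] at hρc
    exact hcpos.ne hρc
  refine ⟨ρ, lt_of_le_of_ne hρ.1 ?_, hin, hsq, ?_⟩
  · rintro rfl
    rw [hN0] at hρc
    have := hc.1
    have h6 : c ^ 2 < S.u z₀ ^ 2 := by have := hc.2; gcongr
    exact h6.ne' hρc
  · simp only [N] at hρc
    rwa [hvin _ (Ioo_subset_Icc_self hin), max_eq_right (by linarith)] at hρc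

end IsRadius

namespace HasUniqueEquator

variable (h : S.HasUniqueEquator z₀)
include h

theorem isRadius_radius {x : ℝ × ℝ} (hx : x ∈ S.strip z₀) :
    S.IsRadius z₀ x.1 x.2 (S.radius z₀ x) := by
  have hex := IsRadius.exists_isRadius h hx.1 x.2
  rw [radius, dif_pos hex]
  exact hex.choose_spec

theorem radius_eq {x : ℝ × ℝ} (hx : x ∈ S.strip z₀) {ρ : ℝ} (hr : S.IsRadius z₀ x.1 x.2 ρ) :
    S.radius z₀ x = ρ :=
  (h.isRadius_radius hx).unique h hr

theorem radius_pos {x : ℝ × ℝ} (hx : x ∈ S.strip z₀) : 0 < S.radius z₀ x :=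
  (h.isRadius_radius hx).pos

theorem height_mem {x : ℝ × ℝ} (hx : x ∈ S.strip z₀) : S.height z₀ x ∈ Ioo S.a S.b :=
  (h.isRadius_radius hx).mem_Ioo

theorem slope_sq_lt_one {x : ℝ × ℝ} (hx : x ∈ S.strip z₀) : S.slope z₀ x ^ 2 < 1 :=
  (h.isRadius_radius hx).sq_lt_one

theorem level {x : ℝ × ℝ} (hx : x ∈ S.strip z₀) :
    S.u (S.height z₀ x) ^ 2 * (1 - S.slope z₀ x ^ 2) = x.1 ^ 2 :=
  (h.isRadius_radius hx).level

/-- By the inverse function theorem for `(ρ, τ) ↦ (u(z)² (1 - ξ²), τ)`; the local inverse gives the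
radius by uniqueness. -/
theorem contDiffOn_radius : ContDiffOn ℝ ∞ (S.radius z₀) (S.strip z₀) := by
  intro x hx
  refine ContDiffAt.contDiffWithinAt ?_
  have hr := h.isRadius_radius hx
  set ρ := S.radius z₀ x with hρ
  let G : ℝ × ℝ → ℝ × ℝ := fun y =>
    (S.u (z₀ - y.1 * Real.cos y.2) ^ 2 * (1 - (y.1 * Real.sin y.2) ^ 2), y.2)
  let R : Set (ℝ × ℝ) := {y | 0 < y.1 ∧ z₀ - y.1 * Real.cos y.2 ∈ Ioo S.a S.b ∧
    (y.1 * Real.sin y.2) ^ 2 < 1}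
  have hcz : Continuous fun y : ℝ × ℝ => z₀ - y.1 * Real.cos y.2 := by fun_prop
  have hR : IsOpen R := by
    refine (isOpen_lt continuous_const continuous_fst).inter
      ((isOpen_Ioo.preimage hcz).inter
        (isOpen_lt (f := fun y : ℝ × ℝ => (y.1 * Real.sin y.2) ^ 2) (by fun_prop) continuous_const))
  have hmem : (ρ, x.2) ∈ R := ⟨hr.pos, hr.mem_Ioo, hr.sq_lt_one⟩
  have hG : ContDiffAt ℝ ∞ G (ρ, x.2) := by
    have h1 : ContDiffAt ℝ ∞ (fun y : ℝ × ℝ => S.u (z₀ - y.1 * Real.cos y.2)) (ρ, x.2) :=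
      ContDiffAt.comp (g := S.u) (f := fun y : ℝ × ℝ => z₀ - y.1 * Real.cos y.2) (ρ, x.2)
        (S.contDiffOn_u.contDiffAt (isOpen_Ioo.mem_nhds hr.mem_Ioo)) (by fun_prop)
    exact ((h1.pow 2).mul (by fun_prop)).prodMk contDiffAt_snd
  have hGd : HasFDerivAt G (fderiv ℝ G (ρ, x.2)) (ρ, x.2) :=
    (hG.differentiableAt (by simp)).hasFDerivAt
  have hinj : ∀ v, fderiv ℝ G (ρ, x.2) v = 0 → v = 0 := by
    intro v hv
    have h2 : v.2 = 0 := by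
      have h3 : HasFDerivAt (fun y => (G y).2) ((ContinuousLinearMap.snd ℝ ℝ ℝ).comp
        (fderiv ℝ G (ρ, x.2))) (ρ, x.2) := hasFDerivAt_snd.comp (ρ, x.2) hGd
      have h4 := h3.unique (hasFDerivAt_snd (𝕜 := ℝ) (p := (ρ, x.2)))
      have h5 := congrArg (fun l : ℝ × ℝ →L[ℝ] ℝ => l v) h4
      simpa [hv] using h5.symm
    obtain ⟨N', hN', hd⟩ := hr.deriv_ne_zero h
    have h6 := HasFDerivAt.comp_hasDerivAt ρ hGd
      ((hasDerivAt_id ρ).prodMk (hasDerivAt_const ρ x.2))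
    have h7 := (hd.prodMk (hasDerivAt_const ρ x.2)).unique h6
    have hv1 : v = v.1 • ((1 : ℝ), (0 : ℝ)) := by ext <;> simp [h2]
    rw [hv1, map_smul, ← h7] at hv
    have h8 : v.1 = 0 := by simpa [hN'] using hv
    exact Prod.ext h8 h2
  obtain ⟨g, hg, hge, hev⟩ := hG.exists_local_inverse rfl hinj
  have hGx : G (ρ, x.2) = (x.1 ^ 2, x.2) := by
    simp only [G]; rw [hr.level]
  rw [hGx] at hg hge hev
  have hsq : ContDiffAt ℝ ∞ (fun y : ℝ × ℝ => (y.1 ^ 2, y.2)) x := by fun_prop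
  have h9 : ContDiffAt ℝ ∞ (fun y : ℝ × ℝ => (g (y.1 ^ 2, y.2)).1) x :=
    contDiffAt_fst.comp x (ContDiffAt.comp x (g := g) hg hsq)
  refine h9.congr_of_eventuallyEq ?_
  have hgR : ∀ᶠ y in 𝓝 (x.1 ^ 2, x.2), g y ∈ R := by
    refine hg.continuousAt.eventually_mem ?_
    rw [hge]; exact hR.mem_nhds hmem
  filter_upwards [hsq.continuousAt.eventually hev, hsq.continuousAt.eventually hgR,
    (S.isOpen_strip z₀).mem_nhds hx] with y hy1 hy2 hy3
  have hy4 : (g (y.1 ^ 2, y.2)).2 = y.2 :=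
    (congrArg Prod.snd hy1 : (G (g (y.1 ^ 2, y.2))).2 = _)
  have hy5 := congrArg Prod.fst hy1
  simp only [G] at hy5
  have hy6 := hy2
  simp only [R, mem_ofPred_eq] at hy6
  rw [hy4] at hy5 hy6
  exact h.radius_eq hy3 ⟨hy6.1, hy6.2.1, hy6.2.2, hy5⟩

theorem contDiffOn_height : ContDiffOn ℝ ∞ (S.height z₀) (S.strip z₀) :=
  contDiffOn_const.sub (h.contDiffOn_radius.mul (Real.contDiff_cos.comp contDiff_snd).contDiffOn)

theorem contDiffOn_slope : ContDiffOn ℝ ∞ (S.slope z₀) (S.strip z₀) :=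
  h.contDiffOn_radius.mul (Real.contDiff_sin.comp contDiff_snd).contDiffOn

theorem radius_add_two_pi {c : ℝ} (hc : c ∈ Ioo 0 (S.u z₀)) (τ : ℝ) :
    S.radius z₀ (c, τ + 2 * Real.pi) = S.radius z₀ (c, τ) := by
  have hr := h.isRadius_radius (x := (c, τ)) ⟨hc, mem_univ _⟩
  refine h.radius_eq ⟨hc, mem_univ _⟩ ⟨hr.pos, ?_, ?_, ?_⟩ <;>
    simp only [Real.cos_add_two_pi, Real.sin_add_two_pi]
  exacts [hr.mem_Ioo, hr.sq_lt_one, hr.level]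

end HasUniqueEquator

end SphereOfRevolution

/-! ### Action and angle variables on the reduced phase plane -/

section QuasiPeriodic

variable {I : Set ℝ} {f : ℝ × ℝ → ℝ} {g : ℝ → ℝ} {p : ℝ}

theorem partialSnd_add_period (hf : ∀ x ∈ I ×ˢ (univ : Set ℝ), DifferentiableAt ℝ f x)
    (hp : ∀ c ∈ I, ∀ τ, f (c, τ + p) = f (c, τ) + g c) {c : ℝ} (hc : c ∈ I) (τ : ℝ) :
    partialSnd f (c, τ + p) = partialSnd f (c, τ) := by
  have h1 := (hf (c, τ) ⟨hc, mem_univ _⟩).hasDerivAt_partialSnd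
  have h2 := (hf (c, τ + p) ⟨hc, mem_univ _⟩).hasDerivAt_partialSnd.comp_add_const τ p
  have h3 : (fun t => f (c, t + p)) = fun t => f (c, t) + g c := funext fun t => hp c hc t
  rw [h3] at h2
  exact h2.unique (h1.add_const _)

theorem partialFst_add_period (hI : IsOpen I)
    (hf : ∀ x ∈ I ×ˢ (univ : Set ℝ), DifferentiableAt ℝ f x)
    (hp : ∀ c ∈ I, ∀ τ, f (c, τ + p) = f (c, τ) + g c) {c g' : ℝ} (hc : c ∈ I)
    (hg : HasDerivAt g g' c) (τ : ℝ) :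
    partialFst f (c, τ + p) = partialFst f (c, τ) + g' := by
  have h1 := (hf (c, τ) ⟨hc, mem_univ _⟩).hasDerivAt_partialFst.add hg
  have h2 := (hf (c, τ + p) ⟨hc, mem_univ _⟩).hasDerivAt_partialFst
  refine h2.unique (h1.congr_of_eventuallyEq ?_)
  filter_upwards [hI.mem_nhds hc] with t ht using hp t ht τ

end QuasiPeriodic

namespace SphereOfRevolution

variable (S : SphereOfRevolution)

/-- The momentum `ξ √(1 + u'²)` conjugate to `z` of the unit covector with coordinates `(c, τ)`. -/
noncomputable def momentum (z₀ : ℝ) (x : ℝ × ℝ) : ℝ := S.slope z₀ x * S.speed (S.height z₀ x)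

/-- The integral of `p_z dz` along the level curve of `c`, from the turning point `τ = 0`. -/
noncomputable def partialAction (z₀ : ℝ) (x : ℝ × ℝ) : ℝ :=
  ∫ σ in (0 : ℝ)..x.2, S.momentum z₀ (x.1, σ) * partialSnd (S.height z₀) (x.1, σ)

/-- The coefficient `k` in `dw = p_z dz + k dc`, where `w` is the partial action. The polar angle of
a geodesic changes by `-k` from the turning point on. -/
noncomputable def deflection (z₀ : ℝ) (x : ℝ × ℝ) : ℝ :=
  partialFst (S.partialAction z₀) x - S.momentum z₀ x * partialFst (S.height z₀) x

/-- The Legendre transform `w - c k` of the partial action; geometrically, the length of the unit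
speed geodesic from the turning point `τ = 0`. -/
noncomputable def arcLength (z₀ : ℝ) (x : ℝ × ℝ) : ℝ :=
  S.partialAction z₀ x - x.1 * S.deflection z₀ x

/-- The action `∮ p_z dz` of the level curve of `c` in the unit cotangent bundle. -/
noncomputable def loopAction (z₀ c : ℝ) : ℝ := S.partialAction z₀ (c, 2 * Real.pi)

/-- The length of a geodesic over one period of the height. -/
noncomputable def period (z₀ c : ℝ) : ℝ := S.arcLength z₀ (c, 2 * Real.pi)

/-- The angle (in units of `2π`) conjugate to the second action. -/
noncomputable def meridianAngle (z₀ : ℝ) (x : ℝ × ℝ) : ℝ := S.arcLength z₀ x / S.period z₀ x.1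

/-- The correction that turns the polar angle `θ` into the angle conjugate to `J`. -/
noncomputable def angleShift (z₀ : ℝ) (x : ℝ × ℝ) : ℝ :=
  S.deflection z₀ x - S.meridianAngle z₀ x * S.deflection z₀ (x.1, 2 * Real.pi)

variable {S} {z₀ : ℝ}

theorem differentiableAt_of_contDiffOn_strip {f : ℝ × ℝ → ℝ}
    (hf : ContDiffOn ℝ ∞ f (S.strip z₀)) {x : ℝ × ℝ} (hx : x ∈ S.strip z₀) :
    DifferentiableAt ℝ f x :=
  hf.differentiableAt_of_isOpen (S.isOpen_strip z₀) hx

theorem momentum_two_pi (c : ℝ) : S.momentum z₀ (c, 2 * Real.pi) = 0 := by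
  simp [momentum, slope]

theorem loopAction_sub (c : ℝ) :
    S.loopAction z₀ c - c * S.deflection z₀ (c, 2 * Real.pi) = S.period z₀ c := rfl

namespace HasUniqueEquator

variable (h : S.HasUniqueEquator z₀)
include h

theorem contDiffOn_momentum : ContDiffOn ℝ ∞ (S.momentum z₀) (S.strip z₀) :=
  h.contDiffOn_slope.mul (S.contDiffOn_speed.comp h.contDiffOn_height fun _ hx => h.height_mem hx)

theorem contDiffOn_partialAction : ContDiffOn ℝ ∞ (S.partialAction z₀) (S.strip z₀) :=
  contDiffOn_primitive isOpen_Ioo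
    (h.contDiffOn_momentum.mul (h.contDiffOn_height.partialSnd (S.isOpen_strip z₀)))

theorem contDiffOn_deflection : ContDiffOn ℝ ∞ (S.deflection z₀) (S.strip z₀) :=
  (h.contDiffOn_partialAction.partialFst (S.isOpen_strip z₀)).sub
    (h.contDiffOn_momentum.mul (h.contDiffOn_height.partialFst (S.isOpen_strip z₀)))

theorem contDiffOn_arcLength : ContDiffOn ℝ ∞ (S.arcLength z₀) (S.strip z₀) :=
  h.contDiffOn_partialAction.sub (contDiffOn_fst.mul h.contDiffOn_deflection)

/-- The partial derivatives of `u(z)² (1 - ξ²) = c²`, with `z` and `ξ` expressed through the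
radius. The last two items say that the area density `m = ξ_τ z_c - ξ_c z_τ` is positive and
that the level curve is a trajectory of the Hamiltonian vector field of `c`. -/
theorem area_density {x : ℝ × ℝ} (hx : x ∈ S.strip z₀) :
    0 < partialSnd (S.slope z₀) x * partialFst (S.height z₀) x -
        partialFst (S.slope z₀) x * partialSnd (S.height z₀) x ∧
    x.1 * partialSnd (S.height z₀) x = S.u (S.height z₀ x) ^ 2 * S.slope z₀ x *
      (partialSnd (S.slope z₀) x * partialFst (S.height z₀) x -
        partialFst (S.slope z₀) x * partialSnd (S.height z₀) x) := by
  obtain ⟨c, τ⟩ := x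
  have hR := differentiableAt_of_contDiffOn_strip h.contDiffOn_radius hx
  have hZ := differentiableAt_of_contDiffOn_strip h.contDiffOn_height hx
  have hX := differentiableAt_of_contDiffOn_strip h.contDiffOn_slope hx
  have hRpos := h.radius_pos hx
  have hZm := h.height_mem hx
  have hUpos := S.u_pos _ hZm
  have hX1 := h.slope_sq_lt_one hx
  have hsgn := h.sub_mul_deriv_nonpos hZm
  have hcpos : 0 < c := hx.1.1
  have ec1 : partialFst (S.height z₀) (c, τ) = -(partialFst (S.radius z₀) (c, τ) * Real.cos τ) :=
    hZ.hasDerivAt_partialFst.unique ((hR.hasDerivAt_partialFst.mul_const (Real.cos τ)).const_sub z₀)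
  have ec2 : partialFst (S.slope z₀) (c, τ) = partialFst (S.radius z₀) (c, τ) * Real.sin τ :=
    hX.hasDerivAt_partialFst.unique (hR.hasDerivAt_partialFst.mul_const (Real.sin τ))
  have et1 : partialSnd (S.height z₀) (c, τ) = -(partialSnd (S.radius z₀) (c, τ) * Real.cos τ +
      S.radius z₀ (c, τ) * -Real.sin τ) :=
    hZ.hasDerivAt_partialSnd.unique
      ((hR.hasDerivAt_partialSnd.mul (Real.hasDerivAt_cos τ)).const_sub z₀)
  have et2 : partialSnd (S.slope z₀) (c, τ) = partialSnd (S.radius z₀) (c, τ) * Real.sin τ +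
      S.radius z₀ (c, τ) * Real.cos τ :=
    hX.hasDerivAt_partialSnd.unique (hR.hasDerivAt_partialSnd.mul (Real.hasDerivAt_sin τ))
  have hUc := (S.hasDerivAt_u hZm).comp c hZ.hasDerivAt_partialFst
  have hUt := (S.hasDerivAt_u hZm).comp τ hZ.hasDerivAt_partialSnd
  have hc := (hUc.pow 2).mul ((hX.hasDerivAt_partialFst.pow 2).const_sub 1)
  have ht := (hUt.pow 2).mul ((hX.hasDerivAt_partialSnd.pow 2).const_sub 1)
  have hc' : HasDerivAt (fun t : ℝ => t ^ 2) _ c := hc.congr_of_eventuallyEq (by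
    filter_upwards [isOpen_Ioo.mem_nhds hx.1] with t ht
    exact (h.level (x := (t, τ)) ⟨ht, mem_univ _⟩).symm)
  have ht' : HasDerivAt (fun _ : ℝ => c ^ 2) _ τ := ht.congr_of_eventuallyEq (by
    filter_upwards with t
    exact (h.level (x := (c, t)) ⟨hx.1, mem_univ _⟩).symm)
  have e1 := hc'.unique (hasDerivAt_pow 2 c)
  have e2 := ht'.unique (hasDerivAt_const τ _)
  have hzz : S.height z₀ (c, τ) - z₀ = -(S.radius z₀ (c, τ) * Real.cos τ) := by
    simp [height]
  have hslope : S.slope z₀ (c, τ) = S.radius z₀ (c, τ) * Real.sin τ := rfl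
  simp only [Function.comp] at e1 e2
  norm_num at e1 e2
  rw [hzz] at hsgn
  generalize deriv S.u (S.height z₀ (c, τ)) = U' at *
  generalize S.u (S.height z₀ (c, τ)) = U at *
  generalize S.slope z₀ (c, τ) = X at *
  generalize S.radius z₀ (c, τ) = R at *
  generalize partialFst (S.radius z₀) (c, τ) = Rc at *
  generalize partialSnd (S.radius z₀) (c, τ) = Rt at *
  generalize partialFst (S.height z₀) (c, τ) = Zc at *
  generalize partialSnd (S.height z₀) (c, τ) = Zt at *
  generalize partialFst (S.slope z₀) (c, τ) = Xc at *
  generalize partialSnd (S.slope z₀) (c, τ) = Xt at *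
  have e1' : U * U' * Zc * (1 - X ^ 2) - U ^ 2 * X * Xc = c := by linarith
  have e2' : U * U' * Zt * (1 - X ^ 2) - U ^ 2 * X * Xt = 0 := by linarith
  constructor
  · have hm : Xt * Zc - Xc * Zt = -(R * Rc) := by
      rw [ec1, ec2, et1, et2]
      linear_combination (-(R * Rc)) * Real.sin_sq_add_cos_sq τ
    rw [hm]
    have hq : 0 ≤ Real.cos τ * U' := by
      by_contra hcon
      push Not at hcon
      nlinarith
    have hp : 0 ≤ U * (Real.cos τ * U') * (1 - X ^ 2) + U ^ 2 * R * Real.sin τ ^ 2 := by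
      have := mul_nonneg (mul_nonneg hUpos.le hq) (sub_nonneg.2 hX1.le)
      positivity
    have e3 : (-Rc) * (U * (Real.cos τ * U') * (1 - X ^ 2) + U ^ 2 * R * Real.sin τ ^ 2) = c := by
      rw [← e1', ec1, ec2, hslope]; ring
    have hRc : 0 < -Rc := by
      by_contra hcon
      push Not at hcon
      nlinarith
    nlinarith
  · simp only
    linear_combination (-Zt) * e1' + Zc * e2'

theorem partialSnd_partialAction {x : ℝ × ℝ} (hx : x ∈ S.strip z₀) :
    partialSnd (S.partialAction z₀) x = S.momentum z₀ x * partialSnd (S.height z₀) x := by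
  obtain ⟨c, τ⟩ := x
  have h1 :=
    (differentiableAt_of_contDiffOn_strip h.contDiffOn_partialAction hx).hasDerivAt_partialSnd
  have hcont : Continuous fun σ => S.momentum z₀ (c, σ) * partialSnd (S.height z₀) (c, σ) :=
    (h.contDiffOn_momentum.mul
      (h.contDiffOn_height.partialSnd (S.isOpen_strip z₀))).continuousOn.comp_continuous
        (by fun_prop) fun σ => ⟨hx.1, mem_univ _⟩
  exact h1.unique (intervalIntegral.integral_hasDerivAt_right (hcont.intervalIntegrable _ _)
    (hcont.stronglyMeasurableAtFilter _ _) hcont.continuousAt)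

theorem partialSnd_deflection {x : ℝ × ℝ} (hx : x ∈ S.strip z₀) :
    partialSnd (S.deflection z₀) x = -(S.speed (S.height z₀ x) *
      (partialSnd (S.slope z₀) x * partialFst (S.height z₀) x -
        partialFst (S.slope z₀) x * partialSnd (S.height z₀) x)) := by
  have h1 := partialSnd_primitive_sub isOpen_Ioo h.contDiffOn_momentum h.contDiffOn_height
    h.contDiffOn_partialAction (fun x hx => h.partialSnd_partialAction hx) hx
  have hZ := differentiableAt_of_contDiffOn_strip h.contDiffOn_height hx
  have hX := differentiableAt_of_contDiffOn_strip h.contDiffOn_slope hx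
  have hM := differentiableAt_of_contDiffOn_strip h.contDiffOn_momentum hx
  have hl : DifferentiableAt ℝ S.speed (S.height z₀ x) :=
    (S.contDiffOn_speed.contDiffAt (isOpen_Ioo.mem_nhds (h.height_mem hx))).differentiableAt
      (by simp)
  obtain ⟨c, τ⟩ := x
  have e1 : partialFst (S.momentum z₀) (c, τ) = _ := hM.hasDerivAt_partialFst.unique
    (hX.hasDerivAt_partialFst.mul (hl.hasDerivAt.comp (h₂ := S.speed)
      (h := fun t => S.height z₀ (t, τ)) c
      hZ.hasDerivAt_partialFst))
  have e2 : partialSnd (S.momentum z₀) (c, τ) = _ := hM.hasDerivAt_partialSnd.unique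
    (hX.hasDerivAt_partialSnd.mul (hl.hasDerivAt.comp (h₂ := S.speed)
      (h := fun t => S.height z₀ (c, t)) τ
      hZ.hasDerivAt_partialSnd))
  refine h1.trans ?_
  rw [e1, e2]
  ring

/-- The arc length has derivative `p_z z_τ + c √(1 + u'²) m`, where `m` is the area density and
`c z_τ = u² ξ m`. -/
theorem partialSnd_arcLength_pos {x : ℝ × ℝ} (hx : x ∈ S.strip z₀) :
    0 < partialSnd (S.arcLength z₀) x := by
  obtain ⟨hm, hZt⟩ := h.area_density hx
  have hk := h.partialSnd_deflection hx
  have hw := h.partialSnd_partialAction hx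
  have hdw := differentiableAt_of_contDiffOn_strip h.contDiffOn_partialAction hx
  have hdk := differentiableAt_of_contDiffOn_strip h.contDiffOn_deflection hx
  have hdt := differentiableAt_of_contDiffOn_strip h.contDiffOn_arcLength hx
  have hl := S.speed_pos (S.height z₀ x)
  have hc : 0 < x.1 := hx.1.1
  obtain ⟨c, τ⟩ := x
  have e : partialSnd (S.arcLength z₀) (c, τ) = _ := hdt.hasDerivAt_partialSnd.unique
    (hdw.hasDerivAt_partialSnd.sub (hdk.hasDerivAt_partialSnd.const_mul c))
  rw [e, hw, hk, momentum]
  simp only at hc hZt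
  set m := partialSnd (S.slope z₀) (c, τ) * partialFst (S.height z₀) (c, τ) -
        partialFst (S.slope z₀) (c, τ) * partialSnd (S.height z₀) (c, τ)
  refine pos_of_mul_pos_right (a := c) ?_ hc.le
  have : c * (S.slope z₀ (c, τ) * S.speed (S.height z₀ (c, τ)) * partialSnd (S.height z₀) (c, τ) -
      c * -(S.speed (S.height z₀ (c, τ)) * m)) = S.speed (S.height z₀ (c, τ)) * m *
      ((S.u (S.height z₀ (c, τ)) * S.slope z₀ (c, τ)) ^ 2 + c ^ 2) := by
    linear_combination S.slope z₀ (c, τ) * S.speed (S.height z₀ (c, τ)) * hZt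
  rw [this]
  positivity

theorem hasDerivAt_loopAction {c : ℝ} (hc : c ∈ Ioo 0 (S.u z₀)) :
    HasDerivAt (S.loopAction z₀) (S.deflection z₀ (c, 2 * Real.pi)) c := by
  have h1 := (differentiableAt_of_contDiffOn_strip h.contDiffOn_partialAction
    (x := (c, 2 * Real.pi)) ⟨hc, mem_univ _⟩).hasDerivAt_partialFst
  rw [deflection, momentum_two_pi, zero_mul, sub_zero]
  exact h1

theorem arcLength_zero {c : ℝ} (hc : c ∈ Ioo 0 (S.u z₀)) : S.arcLength z₀ (c, 0) = 0 := by
  have h0 : ∀ t, S.partialAction z₀ (t, 0) = 0 := fun t => by simp [partialAction]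
  have h1 := (differentiableAt_of_contDiffOn_strip h.contDiffOn_partialAction
    (x := (c, 0)) ⟨hc, mem_univ _⟩).hasDerivAt_partialFst
  simp only [h0] at h1
  have h2 := h1.unique (hasDerivAt_const c (0 : ℝ))
  simp [arcLength, deflection, h2, h0, momentum, slope]

theorem strictMono_arcLength {c : ℝ} (hc : c ∈ Ioo 0 (S.u z₀)) :
    StrictMono fun τ => S.arcLength z₀ (c, τ) := by
  refine strictMono_of_hasDerivAt_pos (f' := fun τ => partialSnd (S.arcLength z₀) (c, τ))
    (fun τ => ?_) fun τ => h.partialSnd_arcLength_pos ⟨hc, mem_univ _⟩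
  exact (differentiableAt_of_contDiffOn_strip h.contDiffOn_arcLength
    ⟨hc, mem_univ _⟩).hasDerivAt_partialSnd

theorem period_pos {c : ℝ} (hc : c ∈ Ioo 0 (S.u z₀)) : 0 < S.period z₀ c := by
  have := h.strictMono_arcLength hc Real.two_pi_pos
  simp only [h.arcLength_zero hc] at this
  exact this

theorem height_add_two_pi {c : ℝ} (hc : c ∈ Ioo 0 (S.u z₀)) (τ : ℝ) :
    S.height z₀ (c, τ + 2 * Real.pi) = S.height z₀ (c, τ) := by
  simp [height, h.radius_add_two_pi hc]

theorem slope_add_two_pi {c : ℝ} (hc : c ∈ Ioo 0 (S.u z₀)) (τ : ℝ) :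
    S.slope z₀ (c, τ + 2 * Real.pi) = S.slope z₀ (c, τ) := by
  simp [slope, h.radius_add_two_pi hc]

theorem momentum_add_two_pi {c : ℝ} (hc : c ∈ Ioo 0 (S.u z₀)) (τ : ℝ) :
    S.momentum z₀ (c, τ + 2 * Real.pi) = S.momentum z₀ (c, τ) := by
  simp [momentum, h.slope_add_two_pi hc, h.height_add_two_pi hc]

theorem partialAction_add_two_pi {c : ℝ} (hc : c ∈ Ioo 0 (S.u z₀)) (τ : ℝ) :
    S.partialAction z₀ (c, τ + 2 * Real.pi) = S.partialAction z₀ (c, τ) + S.loopAction z₀ c := by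
  have hcont : Continuous fun σ => S.momentum z₀ (c, σ) * partialSnd (S.height z₀) (c, σ) :=
    (h.contDiffOn_momentum.mul
      (h.contDiffOn_height.partialSnd (S.isOpen_strip z₀))).continuousOn.comp_continuous
        (by fun_prop) fun σ => ⟨hc, mem_univ _⟩
  have hper : Function.Periodic
      (fun σ => S.momentum z₀ (c, σ) * partialSnd (S.height z₀) (c, σ)) (2 * Real.pi) := by
    intro σ
    have h1 := partialSnd_add_period (I := Ioo 0 (S.u z₀)) (f := S.height z₀) (g := fun _ => 0)
      (p := 2 * Real.pi) (fun x hx => differentiableAt_of_contDiffOn_strip h.contDiffOn_height hx)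
      (fun c hc τ => by rw [h.height_add_two_pi hc, add_zero]) hc σ
    simp only [h1, h.momentum_add_two_pi hc]
  have := hper.intervalIntegral_add_eq τ 0
  rw [zero_add] at this
  simp only [partialAction, loopAction]
  rw [← this, intervalIntegral.integral_add_adjacent_intervals] <;>
    exact hcont.intervalIntegrable _ _

theorem deflection_add_two_pi {c : ℝ} (hc : c ∈ Ioo 0 (S.u z₀)) (τ : ℝ) :
    S.deflection z₀ (c, τ + 2 * Real.pi) =
      S.deflection z₀ (c, τ) + S.deflection z₀ (c, 2 * Real.pi) := by
  have h1 := partialFst_add_period (I := Ioo 0 (S.u z₀)) (f := S.height z₀) (g := fun _ => 0)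
      (p := 2 * Real.pi) isOpen_Ioo
      (fun x hx => differentiableAt_of_contDiffOn_strip h.contDiffOn_height hx)
      (fun c hc τ => by rw [h.height_add_two_pi hc, add_zero]) hc (hasDerivAt_const c 0) τ
  have h2 := partialFst_add_period (I := Ioo 0 (S.u z₀)) (f := S.partialAction z₀)
      (g := S.loopAction z₀) (p := 2 * Real.pi) isOpen_Ioo
      (fun x hx => differentiableAt_of_contDiffOn_strip h.contDiffOn_partialAction hx)
      (fun c hc τ => h.partialAction_add_two_pi hc τ) hc (h.hasDerivAt_loopAction hc) τ
  rw [deflection, h1, h2, h.momentum_add_two_pi hc]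
  simp only [deflection]
  ring

theorem arcLength_add_two_pi {c : ℝ} (hc : c ∈ Ioo 0 (S.u z₀)) (τ : ℝ) :
    S.arcLength z₀ (c, τ + 2 * Real.pi) = S.arcLength z₀ (c, τ) + S.period z₀ c := by
  simp only [arcLength, period, h.partialAction_add_two_pi hc, h.deflection_add_two_pi hc,
    loopAction]
  ring

theorem meridianAngle_add_two_pi {c : ℝ} (hc : c ∈ Ioo 0 (S.u z₀)) (τ : ℝ) :
    S.meridianAngle z₀ (c, τ + 2 * Real.pi) = S.meridianAngle z₀ (c, τ) + 1 := by
  simp only [meridianAngle, h.arcLength_add_two_pi hc]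
  rw [add_div, div_self (h.period_pos hc).ne']

theorem angleShift_add_two_pi {c : ℝ} (hc : c ∈ Ioo 0 (S.u z₀)) (τ : ℝ) :
    S.angleShift z₀ (c, τ + 2 * Real.pi) = S.angleShift z₀ (c, τ) := by
  simp only [angleShift, h.meridianAngle_add_two_pi hc, h.deflection_add_two_pi hc]
  ring

theorem contDiffOn_loopAction : ContDiffOn ℝ ∞ (S.loopAction z₀) (Ioo 0 (S.u z₀)) :=
  h.contDiffOn_partialAction.comp (f := fun c : ℝ => (c, 2 * Real.pi))
    (by fun_prop) fun _ hc => ⟨hc, mem_univ _⟩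

theorem contDiffOn_meridianAngle : ContDiffOn ℝ ∞ (S.meridianAngle z₀) (S.strip z₀) := by
  refine h.contDiffOn_arcLength.div ?_ fun x hx => (h.period_pos hx.1).ne'
  exact h.contDiffOn_arcLength.comp (f := fun x : ℝ × ℝ => (x.1, 2 * Real.pi))
    (by fun_prop) fun _ hx => ⟨hx.1, mem_univ _⟩

theorem contDiffOn_angleShift : ContDiffOn ℝ ∞ (S.angleShift z₀) (S.strip z₀) := by
  refine h.contDiffOn_deflection.sub (h.contDiffOn_meridianAngle.mul ?_)
  exact h.contDiffOn_deflection.comp (f := fun x : ℝ × ℝ => (x.1, 2 * Real.pi))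
    (by fun_prop) fun _ hx => ⟨hx.1, mem_univ _⟩

theorem partialSnd_meridianAngle_pos {x : ℝ × ℝ} (hx : x ∈ S.strip z₀) :
    0 < partialSnd (S.meridianAngle z₀) x := by
  have h1 := (differentiableAt_of_contDiffOn_strip h.contDiffOn_arcLength hx)
  have h2 := (differentiableAt_of_contDiffOn_strip h.contDiffOn_meridianAngle hx)
  have hp := h.partialSnd_arcLength_pos hx
  obtain ⟨c, τ⟩ := x
  rw [h2.hasDerivAt_partialSnd.unique (h1.hasDerivAt_partialSnd.div_const (S.period z₀ c))]
  exact div_pos hp (h.period_pos hx.1)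

theorem strictMono_meridianAngle {c : ℝ} (hc : c ∈ Ioo 0 (S.u z₀)) :
    StrictMono fun τ => S.meridianAngle z₀ (c, τ) := fun _ _ hlt =>
  div_lt_div_of_pos_right (h.strictMono_arcLength hc hlt) (h.period_pos hc)

theorem meridianAngle_add_int_mul {c : ℝ} (hc : c ∈ Ioo 0 (S.u z₀)) (τ : ℝ) (n : ℤ) :
    S.meridianAngle z₀ (c, τ + n * (2 * Real.pi)) = S.meridianAngle z₀ (c, τ) + n := by
  have hper : Function.Periodic (fun τ => S.meridianAngle z₀ (c, τ) - τ / (2 * Real.pi))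
      (2 * Real.pi) := by
    intro τ
    simp only [h.meridianAngle_add_two_pi hc]
    rw [add_div, div_self Real.two_pi_pos.ne']
    ring
  have := hper.int_mul n τ
  rw [add_div, mul_div_cancel_right₀ _ Real.two_pi_pos.ne'] at this
  linarith

theorem surjective_meridianAngle {c : ℝ} (hc : c ∈ Ioo 0 (S.u z₀)) :
    Function.Surjective fun τ => S.meridianAngle z₀ (c, τ) := by
  have hcont : Continuous fun τ => S.meridianAngle z₀ (c, τ) :=
    h.contDiffOn_meridianAngle.continuousOn.comp_continuous (by fun_prop)
      fun σ => ⟨hc, mem_univ _⟩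
  have h0 : S.meridianAngle z₀ (c, 0) = 0 := by
    simp [meridianAngle, h.arcLength_zero hc]
  have hn : ∀ n : ℤ, S.meridianAngle z₀ (c, n * (2 * Real.pi)) = n := fun n => by
    have := h.meridianAngle_add_int_mul hc 0 n
    rwa [zero_add, h0, zero_add] at this
  intro y
  refine mem_range_of_exists_le_of_exists_ge hcont ⟨⌊y⌋ * (2 * Real.pi), ?_⟩
    ⟨⌈y⌉ * (2 * Real.pi), ?_⟩
  · simpa only [hn] using Int.floor_le y
  · simpa only [hn] using Int.le_ceil y

/-- The homogeneity of the generating function: `c dA + g dB = p_z dz` for the angle shift `A`, the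
meridian angle `B` and the loop action `g`, with no exact remainder. -/
theorem angle_identity {x : ℝ × ℝ} (hx : x ∈ S.strip z₀) (v : ℝ × ℝ) :
    x.1 * fderiv ℝ (S.angleShift z₀) x v + S.loopAction z₀ x.1 * fderiv ℝ (S.meridianAngle z₀) x v =
      S.momentum z₀ x * fderiv ℝ (S.height z₀) x v := by
  have hA := (differentiableAt_of_contDiffOn_strip h.contDiffOn_angleShift hx).hasFDerivAt
  have hB := (differentiableAt_of_contDiffOn_strip h.contDiffOn_meridianAngle hx).hasFDerivAt
  have hfst : HasFDerivAt (Prod.fst : ℝ × ℝ → ℝ) (ContinuousLinearMap.fst ℝ ℝ ℝ) x :=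
    hasFDerivAt_fst
  have hg := (h.hasDerivAt_loopAction hx.1).comp_hasFDerivAt x hfst
  have hw := differentiableAt_of_contDiffOn_strip h.contDiffOn_partialAction hx
  have hsum := (hfst.mul hA).add (hg.mul hB)
  have hev : S.partialAction z₀ =ᶠ[𝓝 x] (Prod.fst * S.angleShift z₀ +
      (fun y : ℝ × ℝ => S.loopAction z₀ y.1) * S.meridianAngle z₀) := by
    filter_upwards [(S.isOpen_strip z₀).mem_nhds hx] with y hy
    have hT := (h.period_pos hy.1).ne'
    have h1 : S.meridianAngle z₀ y * S.period z₀ y.1 = S.arcLength z₀ y := div_mul_cancel₀ _ hT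
    have h2 := S.loopAction_sub (z₀ := z₀) y.1
    simp only [Pi.add_apply, Pi.mul_apply, angleShift]
    rw [← h2] at h1
    simp only [arcLength] at h1
    linarith
  have h3 := congrArg (fun l => l v) ((hsum.congr_of_eventuallyEq hev).unique hw.hasFDerivAt)
  have h4 := fderiv_eq_partials (S.partialAction z₀) x v
  have h5 := fderiv_eq_partials (S.height z₀) x v
  have h6 := h.partialSnd_partialAction hx
  have h7 : S.deflection z₀ x = partialFst (S.partialAction z₀) x -
    S.momentum z₀ x * partialFst (S.height z₀) x := rfl
  have h8 : S.angleShift z₀ x = S.deflection z₀ x - S.meridianAngle z₀ x *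
    S.deflection z₀ (x.1, 2 * Real.pi) := rfl
  simp at h3
  rw [h4, h6] at h3
  rw [h5]
  linear_combination h3 - v.1 * h7 - v.1 * h8

end HasUniqueEquator

end SphereOfRevolution

/-! ### The action integral and the region `Ω` -/

namespace SphereOfRevolution

variable (S : SphereOfRevolution)

theorem action₂_neg (h j : ℝ) : S.action₂ h (-j) = S.action₂ h j := by
  simp [action₂]

theorem action₂_eq_sqrt_mul {h : ℝ} (hh : 0 < h) (j : ℝ) :
    S.action₂ h j = √h * S.action₂ 1 (j / √h) := by
  have hs : (j / √h) ^ 2 = j ^ 2 / h := by rw [div_pow, Real.sq_sqrt hh.le]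
  have hset : {z : ℝ | z ∈ Ioo S.a S.b ∧ (j / √h) ^ 2 < 1 * S.u z ^ 2} =
      {z : ℝ | z ∈ Ioo S.a S.b ∧ j ^ 2 < h * S.u z ^ 2} := by
    ext z
    simp only [mem_ofPred_eq, hs, one_mul, div_lt_iff₀' hh]
  rw [action₂, action₂, hset, mul_left_comm, ← integral_const_mul (√h)]
  refine congrArg (2 * ·) (integral_congr_ae (Eventually.of_forall fun z => ?_))
  simp only
  rw [← Real.sqrt_mul hh.le, hs]
  congr 1
  field_simp

/-- The integrand of the action may be integrated over all of `(a, b)`, as the square root vanishes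
on negative numbers. -/
theorem action₂_one_eq (c : ℝ) : S.action₂ 1 c =
    2 * ∫ z in Ioo S.a S.b, √((1 - c ^ 2 / S.u z ^ 2) * (deriv S.u z ^ 2 + 1)) := by
  rw [action₂]
  congr 1
  symm
  refine setIntegral_eq_of_subset_of_forall_sdiff_eq_zero measurableSet_Ioo (fun z hz => hz.1) ?_
  rintro z ⟨hz, hz'⟩
  have hu : 0 < S.u z ^ 2 := pow_pos (S.u_pos z hz) 2
  have h1 : S.u z ^ 2 ≤ c ^ 2 := by
    by_contra hcon
    exact hz' ⟨hz, by rw [one_mul]; exact not_le.1 hcon⟩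
  have h2 : 1 ≤ c ^ 2 / S.u z ^ 2 := (one_le_div hu).2 h1
  exact Real.sqrt_eq_zero_of_nonpos
    (mul_nonpos_of_nonpos_of_nonneg (by linarith) (by positivity))

theorem continuousOn_action_integrand (c : ℝ) :
    ContinuousOn (fun z => √((1 - c ^ 2 / S.u z ^ 2) * (deriv S.u z ^ 2 + 1))) (Ioo S.a S.b) := by
  refine ContinuousOn.sqrt (ContinuousOn.mul (continuousOn_const.sub (continuousOn_const.div
    (S.contDiffOn_u.continuousOn.pow 2) ?_))
    ((S.contDiffOn_deriv_u.continuousOn.pow 2).add continuousOn_const))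
  exact fun z hz => (pow_pos (S.u_pos z hz) 2).ne'

variable {S} {z₀ : ℝ}

namespace HasUniqueEquator

variable (h : S.HasUniqueEquator z₀)
include h

/-- The profile curve has finite length, since `u` is monotone on either side of the equator. -/
theorem integrableOn_speed : IntegrableOn S.speed (Ioo S.a S.b) := by
  have h1 : IntegrableOn (deriv S.u) (Ioc S.a z₀) := by
    refine intervalIntegral.integrableOn_deriv_of_nonneg
      (S.continuousOn_u.mono (Icc_subset_Icc_right h.mem_Ioo.2.le))
      (fun z hz => S.hasDerivAt_u ⟨hz.1, hz.2.trans h.mem_Ioo.2⟩) fun z hz => (h.deriv_pos hz).le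
  have h2 : IntegrableOn (deriv S.u) (Ioc z₀ S.b) := by
    have := intervalIntegral.integrableOn_deriv_of_nonneg (g := fun z => -S.u z)
      (g' := fun z => -deriv S.u z) (a := z₀) (b := S.b)
      (S.continuousOn_u.mono (Icc_subset_Icc_left h.mem_Ioo.1.le)).neg
      (fun z hz => (S.hasDerivAt_u ⟨h.mem_Ioo.1.trans hz.1, hz.2⟩).neg)
      fun z hz => neg_nonneg.2 (h.deriv_neg hz).le
    simpa using this.neg
  have h3 : IntegrableOn (deriv S.u) (Ioo S.a S.b) := by
    refine (h1.union h2).mono_set ?_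
    rw [Ioc_union_Ioc_eq_Ioc h.mem_Ioo.1.le h.mem_Ioo.2.le]
    exact Ioo_subset_Ioc_self
  have h4 : IntegrableOn (fun z => ‖deriv S.u z‖ + 1) (Ioo S.a S.b) :=
    h3.norm.add (integrableOn_const (by simp))
  refine Integrable.mono' h4
    (S.contDiffOn_speed.continuousOn.aestronglyMeasurable measurableSet_Ioo) ?_
  refine Eventually.of_forall fun z => ?_
  rw [Real.norm_of_nonneg (S.speed_pos z).le, Real.norm_eq_abs]
  refine Real.sqrt_le_iff.2 ⟨by positivity, ?_⟩
  nlinarith [sq_abs (deriv S.u z), abs_nonneg (deriv S.u z)]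

theorem continuous_action₂ : Continuous (S.action₂ 1) := by
  have : S.action₂ 1 = fun c => 2 * ∫ z in Ioo S.a S.b,
      √((1 - c ^ 2 / S.u z ^ 2) * (deriv S.u z ^ 2 + 1)) := funext S.action₂_one_eq
  rw [this]
  refine continuous_const.mul (continuous_of_dominated (bound := S.speed) ?_ ?_
    h.integrableOn_speed ?_)
  · exact fun c => (S.continuousOn_action_integrand c).aestronglyMeasurable measurableSet_Ioo
  · refine fun c => Eventually.of_forall fun z => ?_
    rw [Real.norm_of_nonneg (Real.sqrt_nonneg _), speed]
    refine Real.sqrt_le_sqrt ?_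
    have : 0 ≤ c ^ 2 / S.u z ^ 2 := by positivity
    nlinarith [sq_nonneg (deriv S.u z)]
  · exact Eventually.of_forall fun z => by fun_prop

theorem action₂_u : S.action₂ 1 (S.u z₀) = 0 := by
  have : {z : ℝ | z ∈ Ioo S.a S.b ∧ S.u z₀ ^ 2 < 1 * S.u z ^ 2} = ∅ := by
    rw [eq_empty_iff_forall_notMem]
    rintro z ⟨hz, hlt⟩
    have h1 := h.u_le (Ioo_subset_Icc_self hz)
    have h2 := S.u_pos z hz
    rw [one_mul] at hlt
    exact absurd hlt (not_lt.2 (by gcongr))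
  rw [action₂, this]
  simp

theorem u_height_of_slope_eq_zero {x : ℝ × ℝ} (hx : x ∈ S.strip z₀) (h0 : S.slope z₀ x = 0) :
    S.u (S.height z₀ x) = x.1 := by
  have h1 := h.level hx
  rw [h0] at h1
  have h2 := S.u_pos _ (h.height_mem hx)
  exact (sq_eq_sq₀ h2.le hx.1.1.le).1 (by linarith)

/-- The heights reached by geodesics of Clairaut constant `c` lie between those of the two
turning points. -/
theorem setOf_lt_eq_Ioo {c : ℝ} (hc : c ∈ Ioo 0 (S.u z₀)) :
    {z : ℝ | z ∈ Ioo S.a S.b ∧ c ^ 2 < 1 * S.u z ^ 2} =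
      Ioo (S.height z₀ (c, 0)) (S.height z₀ (c, Real.pi)) := by
  have hx0 : (c, (0 : ℝ)) ∈ S.strip z₀ := ⟨hc, mem_univ _⟩
  have hx1 : (c, Real.pi) ∈ S.strip z₀ := ⟨hc, mem_univ _⟩
  have hu0 := h.u_height_of_slope_eq_zero hx0 (by simp [slope])
  have hu1 := h.u_height_of_slope_eq_zero hx1 (by simp [slope])
  have hm0 := h.height_mem hx0
  have hm1 := h.height_mem hx1
  have hl : S.height z₀ (c, 0) < z₀ := by
    have := h.radius_pos hx0
    simp only [height, Real.cos_zero]; linarith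
  have hr : z₀ < S.height z₀ (c, Real.pi) := by
    have := h.radius_pos hx1
    simp only [height, Real.cos_pi]; linarith
  simp only at hu0 hu1
  ext z
  simp only [mem_ofPred_eq, one_mul]
  constructor
  · rintro ⟨hz, hlt⟩
    have hlt' : c < S.u z := lt_of_pow_lt_pow_left₀ 2 (S.u_pos z hz).le hlt
    constructor
    · by_contra hcon
      push Not at hcon
      have := h.strictMonoOn.monotoneOn ⟨hz.1.le, hcon.trans hl.le⟩ ⟨hm0.1.le, hl.le⟩ hcon
      linarith
    · by_contra hcon
      push Not at hcon
      have := h.strictAntiOn.antitoneOn ⟨hr.le, hm1.2.le⟩ ⟨hr.le.trans hcon, hz.2.le⟩ hcon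
      linarith
  · rintro ⟨hz1, hz2⟩
    have hz : z ∈ Ioo S.a S.b := ⟨hm0.1.trans hz1, hz2.trans hm1.2⟩
    have hc0 := hc.1
    refine ⟨hz, ?_⟩
    have : c < S.u z := by
      rcases le_total z z₀ with hle | hle
      · have := h.strictMonoOn ⟨hm0.1.le, hl.le⟩ ⟨hz.1.le, hle⟩ hz1
        linarith
      · have := h.strictAntiOn ⟨hle, hz.2.le⟩ ⟨hr.le, hm1.2.le⟩ hz2
        linarith
    gcongr

theorem sqrt_integrand_eq {x : ℝ × ℝ} (hx : x ∈ S.strip z₀) :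
    √((1 - x.1 ^ 2 / S.u (S.height z₀ x) ^ 2) * (deriv S.u (S.height z₀ x) ^ 2 + 1)) =
      |S.slope z₀ x| * S.speed (S.height z₀ x) := by
  have hu := S.u_pos _ (h.height_mem hx)
  have h1 : 1 - x.1 ^ 2 / S.u (S.height z₀ x) ^ 2 = S.slope z₀ x ^ 2 := by
    rw [← h.level hx]
    field_simp
    ring
  rw [h1, Real.sqrt_mul (sq_nonneg _), Real.sqrt_sq_eq_abs, speed]

/-- Substituting `z = z(c, τ)` on the two halves of the level curve. -/
theorem action₂_eq_loopAction {c : ℝ} (hc : c ∈ Ioo 0 (S.u z₀)) :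
    S.action₂ 1 c = S.loopAction z₀ c := by
  have hx : ∀ τ, (c, τ) ∈ S.strip z₀ := fun τ => ⟨hc, mem_univ _⟩
  set g : ℝ → ℝ := fun z => √((1 - c ^ 2 / S.u z ^ 2) * (deriv S.u z ^ 2 + 1)) with hg
  have hd : ∀ τ, HasDerivAt (fun τ => S.height z₀ (c, τ)) (partialSnd (S.height z₀) (c, τ)) τ :=
    fun τ => (differentiableAt_of_contDiffOn_strip h.contDiffOn_height (hx τ)).hasDerivAt_partialSnd
  have hcont : Continuous fun τ => S.height z₀ (c, τ) :=
    continuous_iff_continuousAt.2 fun τ => (hd τ).continuousAt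
  have hsign : ∀ τ, ∃ m > 0, partialSnd (S.height z₀) (c, τ) = m * Real.sin τ := fun τ => by
    obtain ⟨hm, he⟩ := h.area_density (hx τ)
    simp only at he
    set m := partialSnd (S.slope z₀) (c, τ) * partialFst (S.height z₀) (c, τ) -
        partialFst (S.slope z₀) (c, τ) * partialSnd (S.height z₀) (c, τ)
    have hu := S.u_pos _ (h.height_mem (hx τ))
    have hr := h.radius_pos (hx τ)
    have hc0 := hc.1
    refine ⟨S.u (S.height z₀ (c, τ)) ^ 2 * S.radius z₀ (c, τ) * m / c, by positivity, ?_⟩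
    rw [← mul_div_cancel_left₀ (partialSnd (S.height z₀) (c, τ)) hc.1.ne', he, slope]
    ring
  have hint : ∀ τ, S.momentum z₀ (c, τ) * partialSnd (S.height z₀) (c, τ) =
      SignType.sign (Real.sin τ) * ((g ∘ fun τ => S.height z₀ (c, τ)) τ *
        partialSnd (S.height z₀) (c, τ)) := fun τ => by
    have h1 := h.sqrt_integrand_eq (hx τ)
    simp only [Function.comp, hg]
    simp only at h1
    rw [h1, momentum, slope, abs_mul, abs_of_pos (h.radius_pos (hx τ))]
    have : (SignType.sign (Real.sin τ) : ℝ) * |Real.sin τ| = Real.sin τ := sign_mul_abs _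
    linear_combination (-(S.radius z₀ (c, τ) * S.speed (S.height z₀ (c, τ)) *
      partialSnd (S.height z₀) (c, τ))) * this
  have h1 : ∫ τ in (0 : ℝ)..Real.pi, S.momentum z₀ (c, τ) * partialSnd (S.height z₀) (c, τ) =
      ∫ z in S.height z₀ (c, 0)..S.height z₀ (c, Real.pi), g z := by
    rw [← intervalIntegral.integral_comp_mul_deriv_of_deriv_nonneg (g := g)
      (f := fun τ => S.height z₀ (c, τ)) (f' := fun τ => partialSnd (S.height z₀) (c, τ))
      hcont.continuousOn (fun τ _ => hd τ)]
    · refine intervalIntegral.integral_congr_Ioo_of_le Real.pi_pos.le fun τ hτ => ?_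
      rw [hint, sign_pos (Real.sin_pos_of_mem_Ioo hτ)]
      simp
    · intro τ hτ
      rw [min_eq_left Real.pi_pos.le, max_eq_right Real.pi_pos.le] at hτ
      obtain ⟨m, hm, he⟩ := hsign τ
      rw [he]
      exact mul_nonneg hm.le (Real.sin_pos_of_mem_Ioo hτ).le
  have hpi : Real.pi ≤ 2 * Real.pi := by linarith [Real.pi_pos]
  have hsin : ∀ τ ∈ Ioo Real.pi (2 * Real.pi), Real.sin τ < 0 := fun τ hτ => by
    have := Real.sin_neg_of_neg_of_neg_pi_lt (x := τ - 2 * Real.pi) (by linarith [hτ.2])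
      (by linarith [hτ.1])
    rwa [Real.sin_sub_two_pi] at this
  have h2 : ∫ τ in Real.pi..2 * Real.pi, S.momentum z₀ (c, τ) * partialSnd (S.height z₀) (c, τ) =
      ∫ z in S.height z₀ (c, 0)..S.height z₀ (c, Real.pi), g z := by
    have h0 : S.height z₀ (c, 0) = S.height z₀ (c, 2 * Real.pi) := by
      simpa using (h.height_add_two_pi hc 0).symm
    rw [h0, intervalIntegral.integral_symm (S.height z₀ (c, Real.pi)),
      ← intervalIntegral.integral_comp_mul_deriv_of_deriv_nonpos (g := g)
      (a := Real.pi) (b := 2 * Real.pi)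
      (f := fun τ => S.height z₀ (c, τ)) (f' := fun τ => partialSnd (S.height z₀) (c, τ))
      hcont.continuousOn (fun τ _ => hd τ)]
    · rw [← intervalIntegral.integral_neg]
      refine intervalIntegral.integral_congr_Ioo_of_le hpi fun τ hτ => ?_
      rw [hint, sign_neg (hsin τ hτ)]
      simp
    · intro τ hτ
      rw [min_eq_left hpi, max_eq_right hpi] at hτ
      obtain ⟨m, hm, he⟩ := hsign τ
      rw [he]
      exact mul_nonpos_of_nonneg_of_nonpos hm.le (hsin τ hτ).le
  have hc' : Continuous fun σ => S.momentum z₀ (c, σ) * partialSnd (S.height z₀) (c, σ) :=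
    (h.contDiffOn_momentum.mul
      (h.contDiffOn_height.partialSnd (S.isOpen_strip z₀))).continuousOn.comp_continuous
        (by fun_prop) fun σ => ⟨hc, mem_univ _⟩
  have hle : S.height z₀ (c, 0) ≤ S.height z₀ (c, Real.pi) := by
    have h3 := h.radius_pos (hx 0)
    have h4 := h.radius_pos (hx Real.pi)
    simp only [height, Real.cos_zero, Real.cos_pi]
    linarith
  rw [loopAction, partialAction, ← intervalIntegral.integral_add_adjacent_intervals
    (hc'.intervalIntegrable 0 Real.pi) (hc'.intervalIntegrable _ _)]
  simp only
  rw [h1, h2, ← two_mul, action₂, h.setOf_lt_eq_Ioo hc, intervalIntegral.integral_of_le hle,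
    integral_Ioc_eq_integral_Ioo]

/-- For fixed angular momentum `j` the second action increases with the energy `s²`, because its
derivative in `s` is the length of the geodesic over one period of the height. -/
theorem strictMonoOn_scaled_action {j : ℝ} (hj : 0 < j) :
    StrictMonoOn (fun s => s * S.action₂ 1 (j / s)) (Ici (j / S.u z₀)) := by
  have hpos : 0 < j / S.u z₀ := div_pos hj h.u_pos
  have hne : ∀ s ∈ Ici (j / S.u z₀), s ≠ 0 := fun s hs => (hpos.trans_le hs).ne'
  refine strictMonoOn_of_deriv_pos (convex_Ici _) ?_ ?_
  · exact continuousOn_id.mul (h.continuous_action₂.comp_continuousOn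
      (continuousOn_const.div continuousOn_id hne))
  · intro s hs
    rw [interior_Ici] at hs
    have hs0 : 0 < s := hpos.trans hs
    have hc : j / s ∈ Ioo 0 (S.u z₀) := by
      refine ⟨div_pos hj hs0, ?_⟩
      have : j / S.u z₀ < s := hs
      rw [div_lt_iff₀ h.u_pos] at this
      rw [div_lt_iff₀ hs0]
      linarith
    have h1 : HasDerivAt (S.action₂ 1) (S.deflection z₀ (j / s, 2 * Real.pi)) (j / s) := by
      refine (h.hasDerivAt_loopAction hc).congr_of_eventuallyEq ?_
      filter_upwards [isOpen_Ioo.mem_nhds hc] with c hc' using h.action₂_eq_loopAction hc'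
    have h2 : HasDerivAt (fun s : ℝ => j / s) (-j / s ^ 2) s := by
      have := (hasDerivAt_const s j).div (hasDerivAt_id s) hs0.ne'
      simpa using! this
    have h3 := (hasDerivAt_id s).mul (h1.comp s h2)
    have h4 : HasDerivAt (fun s => s * S.action₂ 1 (j / s)) _ s := h3
    rw [h4.deriv]
    have h5 := h.period_pos hc
    rw [← S.loopAction_sub, ← h.action₂_eq_loopAction hc] at h5
    simp only [Function.comp, id]
    convert! h5 using 1
    field_simp
    ring

end HasUniqueEquator

variable (S) in
/-- The region in the open quadrant on and below the graph of `x ↦ I₂(1, x / 2π)`. -/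
def region (z₀ : ℝ) : Set (ℝ × ℝ) :=
  {y | 0 < y.1 ∧ y.1 < 2 * Real.pi * S.u z₀ ∧ 0 < y.2 ∧ y.2 ≤ S.action₂ 1 (y.1 / (2 * Real.pi))}

namespace HasUniqueEquator

variable (h : S.HasUniqueEquator z₀)
include h

/-- The region is swept out by the rescalings of the graph of the loop action. -/
theorem mem_region_iff {y : ℝ × ℝ} : y ∈ S.region z₀ ↔ ∃ s ∈ Ioc (0 : ℝ) 1,
    ∃ c ∈ Ioo 0 (S.u z₀), y = (2 * Real.pi * (s * c), s * S.loopAction z₀ c) := by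
  have hpi := Real.two_pi_pos
  have hu := h.u_pos
  constructor
  · rintro ⟨h1, h2, h3, h4⟩
    set j := y.1 / (2 * Real.pi) with hj
    have hjpos : 0 < j := div_pos h1 hpi
    have hju : j < S.u z₀ := by rw [hj, div_lt_iff₀ hpi]; linarith
    have hl : j / S.u z₀ ≤ 1 := ((div_lt_one hu).2 hju).le
    have hpos : 0 < j / S.u z₀ := div_pos hjpos hu
    have hcont : ContinuousOn (fun s => s * S.action₂ 1 (j / s)) (Icc (j / S.u z₀) 1) :=
      continuousOn_id.mul (h.continuous_action₂.comp_continuousOn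
        (continuousOn_const.div continuousOn_id fun s hs => (hpos.trans_le hs.1).ne'))
    have h0 : j / S.u z₀ * S.action₂ 1 (j / (j / S.u z₀)) = 0 := by
      rw [div_div_cancel₀ hjpos.ne', h.action₂_u, mul_zero]
    have hy : y.2 ∈ Ioc (j / S.u z₀ * S.action₂ 1 (j / (j / S.u z₀)))
        (1 * S.action₂ 1 (j / 1)) := by
      rw [h0, one_mul, div_one]; exact ⟨h3, h4⟩
    obtain ⟨s, hs, hsy⟩ := intermediate_value_Ioc hl hcont hy
    simp only at hsy
    have hs0 : 0 < s := hpos.trans hs.1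
    have hc : j / s ∈ Ioo 0 (S.u z₀) := by
      refine ⟨div_pos hjpos hs0, ?_⟩
      have := hs.1
      rw [div_lt_iff₀ hu] at this
      rw [div_lt_iff₀ hs0]
      linarith
    refine ⟨s, ⟨hs0, hs.2⟩, j / s, hc, ?_⟩
    rw [← h.action₂_eq_loopAction hc, hsy, mul_div_cancel₀ _ hs0.ne', hj,
      mul_div_cancel₀ _ hpi.ne']
  · rintro ⟨s, hs, c, hc, rfl⟩
    have hsc : 0 < s * c := mul_pos hs.1 hc.1
    have hmono := h.strictMonoOn_scaled_action hsc
    have hs1 : s * c / S.u z₀ < s := by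
      rw [div_lt_iff₀ hu]; exact mul_lt_mul_of_pos_left hc.2 hs.1
    have h0 : s * c / S.u z₀ * S.action₂ 1 (s * c / (s * c / S.u z₀)) = 0 := by
      rw [div_div_cancel₀ hsc.ne', h.action₂_u, mul_zero]
    have hcs : s * c / s = c := mul_div_cancel_left₀ c hs.1.ne'
    rw [← h.action₂_eq_loopAction hc]
    refine ⟨by positivity, ?_, ?_, ?_⟩
    · have : s * c < S.u z₀ := lt_of_le_of_lt (mul_le_of_le_one_left hc.1.le hs.2) hc.2
      exact mul_lt_mul_of_pos_left this hpi
    · have := hmono (mem_Ici.2 le_rfl) (mem_Ici.2 hs1.le) hs1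
      simp only at this
      rwa [h0, hcs] at this
    · have := hmono.monotoneOn (mem_Ici.2 hs1.le) (mem_Ici.2 (hs1.le.trans hs.2)) hs.2
      rw [hcs, one_mul, div_one] at this
      rwa [mul_div_cancel_left₀ _ hpi.ne']

/-- The actions determine the norm and the Clairaut constant. -/
theorem scaled_injective {s c s' c' : ℝ} (hs : 0 < s) (hc : c ∈ Ioo 0 (S.u z₀)) (hs' : 0 < s')
    (hc' : c' ∈ Ioo 0 (S.u z₀)) (h1 : s * c = s' * c')
    (h2 : s * S.loopAction z₀ c = s' * S.loopAction z₀ c') : s = s' ∧ c = c' := by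
  have hsc : 0 < s * c := mul_pos hs hc.1
  have hss : s = s' := by
    refine (h.strictMonoOn_scaled_action hsc).injOn ?_ ?_ ?_
    · rw [mem_Ici, div_le_iff₀ h.u_pos]; exact mul_le_mul_of_nonneg_left hc.2.le hs.le
    · rw [mem_Ici, div_le_iff₀ h.u_pos, h1]; exact mul_le_mul_of_nonneg_left hc'.2.le hs'.le
    · rw [mul_div_cancel_left₀ c hs.ne', h1, mul_div_cancel_left₀ c' hs'.ne',
        h.action₂_eq_loopAction hc, h.action₂_eq_loopAction hc', h2]
  subst hss
  exact ⟨rfl, mul_left_cancel₀ hs.ne' h1⟩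

theorem actionMap_mem_region {y : ℝ × ℝ} (hy : y ∈ Bplus (S.u z₀)) :
    S.actionMap y ∈ S.region z₀ := by
  obtain ⟨h1, h2, h3, h4⟩ := hy
  have hs : 0 < √y.1 := Real.sqrt_pos.2 h1
  have hc : y.2 / √y.1 ∈ Ioo 0 (S.u z₀) := ⟨div_pos h3 hs, by rwa [div_lt_iff₀ hs]⟩
  refine h.mem_region_iff.2 ⟨√y.1, ⟨hs, Real.sqrt_le_one.2 h2⟩, y.2 / √y.1, hc, ?_⟩
  rw [actionMap, mul_div_cancel₀ _ hs.ne', abs_of_pos h3, S.action₂_eq_sqrt_mul h1,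
    h.action₂_eq_loopAction hc]

theorem actionMap_image_Bplus : S.actionMap '' Bplus (S.u z₀) = S.region z₀ := by
  apply Subset.antisymm
  · rintro _ ⟨y, hy, rfl⟩
    exact h.actionMap_mem_region hy
  · intro y hy
    obtain ⟨s, hs, c, hc, rfl⟩ := h.mem_region_iff.1 hy
    have hs0 := hs.1
    have hc0 := hc.1
    have hsq : √(s ^ 2) = s := Real.sqrt_sq hs0.le
    refine ⟨(s ^ 2, s * c), ⟨by positivity, pow_le_one₀ hs0.le hs.2, by positivity, ?_⟩, ?_⟩
    · simp only
      rw [hsq, mul_comm]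
      exact mul_lt_mul_of_pos_right hc.2 hs0
    · rw [actionMap, abs_of_pos (mul_pos hs0 hc0), S.action₂_eq_sqrt_mul (by positivity), hsq,
        mul_div_cancel_left₀ c hs0.ne', h.action₂_eq_loopAction hc]

theorem actionMap_image_Bminus : S.actionMap '' Bminus (S.u z₀) = S.region z₀ := by
  rw [← h.actionMap_image_Bplus]
  apply Subset.antisymm
  · rintro _ ⟨y, ⟨h1, h2, h3, h4⟩, rfl⟩
    refine ⟨(y.1, -y.2), ⟨h1, h2, by simpa using h4, by simpa using neg_lt.1 h3⟩, ?_⟩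
    simp [actionMap, action₂_neg]
  · rintro _ ⟨y, ⟨h1, h2, h3, h4⟩, rfl⟩
    refine ⟨(y.1, -y.2), ⟨h1, h2, by simpa using h4, by simpa using h3⟩, ?_⟩
    simp [actionMap, action₂_neg]

theorem continuous_graph : Continuous fun x : ℝ => S.action₂ 1 (x / (2 * Real.pi)) :=
  h.continuous_action₂.comp (continuous_id.div_const _)

/-- The part of the region strictly below the graph is open. -/
theorem isOpen_below_graph : IsOpen {y : ℝ × ℝ | 0 < y.1 ∧ y.1 < 2 * Real.pi * S.u z₀ ∧ 0 < y.2 ∧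
    y.2 < S.action₂ 1 (y.1 / (2 * Real.pi))} :=
  (isOpen_lt continuous_const continuous_fst).inter <|
    (isOpen_lt continuous_fst continuous_const).inter <|
    (isOpen_lt continuous_const continuous_snd).inter <|
    isOpen_lt continuous_snd (h.continuous_graph.comp continuous_fst)

theorem closure_interior_region : closure (interior (S.region z₀)) = closure (S.region z₀) := by
  refine Subset.antisymm (closure_mono interior_subset) (closure_minimal ?_ isClosed_closure)
  rintro ⟨x, y⟩ ⟨h1, h2, h3, h4⟩
  have hsub : {y : ℝ × ℝ | 0 < y.1 ∧ y.1 < 2 * Real.pi * S.u z₀ ∧ 0 < y.2 ∧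
      y.2 < S.action₂ 1 (y.1 / (2 * Real.pi))} ⊆ interior (S.region z₀) :=
    interior_maximal (fun y hy => ⟨hy.1, hy.2.1, hy.2.2.1, hy.2.2.2.le⟩) h.isOpen_below_graph
  have hlim : Tendsto (fun t : ℝ => (x, t * y)) (𝓝[<] 1) (𝓝 (x, y)) := by
    have : Continuous fun t : ℝ => (x, t * y) := by fun_prop
    simpa using this.continuousWithinAt (s := Iio 1) (x := 1) |>.tendsto
  refine mem_closure_of_tendsto hlim ?_
  filter_upwards [self_mem_nhdsWithin, nhdsWithin_le_nhds (lt_mem_nhds one_pos)] with t ht ht0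
  simp only at h1 h2 h3 h4
  refine hsub ⟨h1, h2, mul_pos ht0 h3, ?_⟩
  exact lt_of_lt_of_le (mul_lt_of_lt_one_left h3 ht) h4

/-- A point of the toric domain is a boundary point exactly if it lies over the graph. -/
theorem ownBoundary_toricDomain : ownBoundary (toricDomain (S.region z₀)) =
    {z | ∃ c ∈ Ioo 0 (S.u z₀), momentMap z = (2 * Real.pi * c, S.loopAction z₀ c)} := by
  have hmm : Continuous momentMap := by unfold momentMap; fun_prop
  have hpi := Real.two_pi_pos
  ext z
  constructor
  · rintro ⟨hz, hz'⟩
    obtain ⟨h1, h2, h3, h4⟩ := id hz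
    have hge : S.action₂ 1 ((momentMap z).1 / (2 * Real.pi)) ≤ (momentMap z).2 := by
      by_contra hcon
      push Not at hcon
      refine hz'.2 (mem_interior.2 ⟨_, ?_, h.isOpen_below_graph.preimage hmm,
        ⟨h1, h2, h3, hcon⟩⟩)
      exact fun w hw => ⟨hw.1, hw.2.1, hw.2.2.1, hw.2.2.2.le⟩
    have hc : (momentMap z).1 / (2 * Real.pi) ∈ Ioo 0 (S.u z₀) :=
      ⟨div_pos h1 hpi, by rw [div_lt_iff₀ hpi]; linarith⟩
    refine ⟨_, hc, ?_⟩
    rw [← h.action₂_eq_loopAction hc, mul_div_cancel₀ _ hpi.ne']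
    exact Prod.ext rfl (le_antisymm h4 hge)
  · rintro ⟨c, hc, hz⟩
    have hmem : z ∈ toricDomain (S.region z₀) :=
      h.mem_region_iff.2 ⟨1, ⟨one_pos, le_rfl⟩, c, hc, by rw [hz]; simp⟩
    refine ⟨hmem, subset_closure hmem, fun hint => ?_⟩
    -- Enlarging `|z₂|` leaves the domain.
    have hcont : Continuous fun t : ℝ => ((z.1, (t : ℂ) * z.2) : ℂ × ℂ) := by fun_prop
    have hev : ∀ᶠ t : ℝ in 𝓝 1, ((z.1, (t : ℂ) * z.2) : ℂ × ℂ) ∈ toricDomain (S.region z₀) := by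
      refine hcont.continuousAt.eventually_mem ?_
      simpa using mem_interior_iff_mem_nhds.1 hint
    obtain ⟨t, htmem, ht⟩ := ((hev.filter_mono nhdsWithin_le_nhds).and
      (self_mem_nhdsWithin (s := Ioi (1 : ℝ)))).exists
    have h2 := htmem.2.2.2
    have h3 := hmem.2.2.1
    have hz1 := congrArg Prod.fst hz
    have hz2 := congrArg Prod.snd hz
    simp only [momentMap, norm_mul, Complex.norm_real, mul_pow, Real.norm_eq_abs, sq_abs]
      at h2 h3 hz1 hz2
    rw [hz1, mul_div_cancel_left₀ _ hpi.ne', h.action₂_eq_loopAction hc, ← hz2] at h2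
    have ht1 : (1 : ℝ) < t := ht
    nlinarith [mul_pos (mul_pos (sub_pos.2 ht1) (by linarith : 0 < t + 1)) h3]

end HasUniqueEquator

end SphereOfRevolution

/-! ### The cotangent bundle away from the poles -/

namespace SphereOfRevolution

variable (S : SphereOfRevolution)

/-- The point of the surface at height `z` and polar angle `θ`. -/
noncomputable def point (z θ : ℝ) : R3 := !₂[S.u z * Real.cos θ, S.u z * Real.sin θ, z]

/-- The coordinate vector `∂_z` at `point z θ`. -/
noncomputable def meridianVec (z θ : ℝ) : R3 :=
  !₂[deriv S.u z * Real.cos θ, deriv S.u z * Real.sin θ, 1]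

/-- The coordinate vector `∂_θ` at `point z θ`. -/
noncomputable def parallelVec (z θ : ℝ) : R3 := !₂[-(S.u z * Real.sin θ), S.u z * Real.cos θ, 0]

/-- The covector `ζ ∂_z + η ∂_θ` (under the identification by the metric) over `point z θ`,
with `e = (z, θ, ζ, η)`. -/
noncomputable def covector (e : ℝ × ℝ × ℝ × ℝ) : R3 × R3 :=
  (S.point e.1 e.2.1,
    e.2.2.1 • S.meridianVec e.1 e.2.1 + e.2.2.2 • S.parallelVec e.1 e.2.1)

theorem inner_covector (z θ ζ η ζ' η' : ℝ) :
    inner ℝ (ζ • S.meridianVec z θ + η • S.parallelVec z θ)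
      (ζ' • S.meridianVec z θ + η' • S.parallelVec z θ) =
      ζ * ζ' * S.speed z ^ 2 + η * η' * S.u z ^ 2 := by
  rw [speed_sq]
  simp [PiLp.inner_apply, Fin.sum_univ_three, meridianVec, parallelVec]
  linear_combination (ζ * ζ' * deriv S.u z ^ 2 + η * η' * S.u z ^ 2) * Real.sin_sq_add_cos_sq θ

theorem energy_covector (e : ℝ × ℝ × ℝ × ℝ) :
    energy (S.covector e) = e.2.2.1 ^ 2 * S.speed e.1 ^ 2 + e.2.2.2 ^ 2 * S.u e.1 ^ 2 := by
  rw [energy, ← real_inner_self_eq_norm_sq, covector, inner_covector]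
  ring

theorem angularMomentum_covector (e : ℝ × ℝ × ℝ × ℝ) :
    angularMomentum (S.covector e) = e.2.2.2 * S.u e.1 ^ 2 := by
  have h1 : rotationField (S.covector e).1 =
      (0 : ℝ) • S.meridianVec e.1 e.2.1 + (1 : ℝ) • S.parallelVec e.1 e.2.1 := by
    ext i
    fin_cases i <;> simp [rotationField, covector, point, parallelVec]
  rw [angularMomentum, h1, covector, inner_covector]
  ring

/-- The derivative of a family of points on the surface. -/
theorem hasFDerivAt_point {E : Type*} [NormedAddCommGroup E] [NormedSpace ℝ E] {f g : E → ℝ}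
    {f' g' : E →L[ℝ] ℝ} {e : E} (hf : HasFDerivAt f f' e) (hg : HasFDerivAt g g' e)
    (hz : f e ∈ Ioo S.a S.b) :
    HasFDerivAt (fun e => S.point (f e) (g e))
      (f'.smulRight (S.meridianVec (f e) (g e)) + g'.smulRight (S.parallelVec (f e) (g e))) e := by
  have hu : HasFDerivAt (fun e => S.u (f e)) (deriv S.u (f e) • f') e :=
    (S.hasDerivAt_u hz).comp_hasFDerivAt e hf
  rw [← hasFDerivWithinAt_univ, hasFDerivWithinAt_euclidean]
  intro i
  rw [hasFDerivWithinAt_univ]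
  fin_cases i
  · have h1 := hu.mul hg.cos
    simp only [point]
    refine h1.congr_fderiv ?_
    ext v
    simp [meridianVec, parallelVec]
    ring
  · have h1 := hu.mul hg.sin
    simp only [point]
    refine h1.congr_fderiv ?_
    ext v
    simp [meridianVec, parallelVec]
    ring
  · simp only [point]
    refine hf.congr_fderiv ?_
    ext v
    simp [meridianVec, parallelVec]

theorem contDiffAt_covector {e : ℝ × ℝ × ℝ × ℝ} (he : e.1 ∈ Ioo S.a S.b) :
    ContDiffAt ℝ ∞ S.covector e := by
  have hu : ContDiffAt ℝ ∞ (fun e : ℝ × ℝ × ℝ × ℝ => S.u e.1) e :=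
    (S.contDiffOn_u.contDiffAt (isOpen_Ioo.mem_nhds he)).comp e contDiffAt_fst
  have hu' : ContDiffAt ℝ ∞ (fun e : ℝ × ℝ × ℝ × ℝ => deriv S.u e.1) e :=
    (S.contDiffOn_deriv_u.contDiffAt (isOpen_Ioo.mem_nhds he)).comp e contDiffAt_fst
  have hcos : ContDiffAt ℝ ∞ (fun e : ℝ × ℝ × ℝ × ℝ => Real.cos e.2.1) e := by fun_prop
  have hsin : ContDiffAt ℝ ∞ (fun e : ℝ × ℝ × ℝ × ℝ => Real.sin e.2.1) e := by fun_prop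
  refine ContDiffAt.prodMk ?_ ?_
  · rw [contDiffAt_euclidean]
    intro i
    fin_cases i
    exacts [hu.mul hcos, hu.mul hsin, contDiffAt_fst]
  · have h1 : ContDiffAt ℝ ∞ (fun e : ℝ × ℝ × ℝ × ℝ => S.meridianVec e.1 e.2.1) e := by
      rw [contDiffAt_euclidean]
      intro i
      fin_cases i
      exacts [hu'.mul hcos, hu'.mul hsin, contDiffAt_const]
    have h2 : ContDiffAt ℝ ∞ (fun e : ℝ × ℝ × ℝ × ℝ => S.parallelVec e.1 e.2.1) e := by
      rw [contDiffAt_euclidean]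
      intro i
      fin_cases i
      exacts [(hu.mul hsin).neg, hu.mul hcos, contDiffAt_const]
    have h3 : ContDiffAt ℝ ∞ (fun e : ℝ × ℝ × ℝ × ℝ => e.2.2.1) e := by fun_prop
    have h4 : ContDiffAt ℝ ∞ (fun e : ℝ × ℝ × ℝ × ℝ => e.2.2.2) e := by fun_prop
    exact (h3.smul h1).add (h4.smul h2)

/-- The projection along the axis, with values in the complex plane. -/
noncomputable def planar (q : R3) : ℂ := (q 0 : ℂ) + (q 1 : ℂ) * Complex.I

theorem contDiff_planar : ContDiff ℝ ∞ planar := by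
  have h0 : ContDiff ℝ ∞ (fun q : R3 => q 0) := contDiff_euclidean.1 contDiff_id 0
  have h1 : ContDiff ℝ ∞ (fun q : R3 => q 1) := contDiff_euclidean.1 contDiff_id 1
  exact (Complex.ofRealCLM.contDiff.comp h0).add
    ((Complex.ofRealCLM.contDiff.comp h1).mul contDiff_const)

theorem planar_point (z θ : ℝ) :
    planar (S.point z θ) = (S.u z : ℂ) * Complex.exp (θ * Complex.I) := by
  rw [Complex.exp_mul_I]
  simp [planar, point]
  ring

theorem point_add_int_mul (z θ : ℝ) (n : ℤ) :
    S.point z (θ + n * (2 * Real.pi)) = S.point z θ := by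
  simp [point, Real.cos_add_int_mul_two_pi, Real.sin_add_int_mul_two_pi]

theorem covector_add_int_mul (z θ ζ η : ℝ) (n : ℤ) :
    S.covector (z, θ + n * (2 * Real.pi), ζ, η) = S.covector (z, θ, ζ, η) := by
  simp [covector, point, meridianVec, parallelVec, Real.cos_add_int_mul_two_pi,
    Real.sin_add_int_mul_two_pi]

theorem contDiff_coord (i : Fin 3) : ContDiff ℝ ∞ (fun q : R3 => q i) :=
  contDiff_euclidean.1 contDiff_id i

theorem surface_inter_eq :
    S.surface ∩ {q : R3 | q 2 ∈ Ioo S.a S.b} =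
      (fun e : ℝ × ℝ => S.point e.1 e.2) '' (Ioo S.a S.b ×ˢ univ) := by
  ext q
  constructor
  · rintro ⟨⟨z, hz, θ, rfl⟩, hq⟩
    exact ⟨(z, θ), ⟨by simpa using hq, mem_univ _⟩, rfl⟩
  · rintro ⟨⟨z, θ⟩, ⟨hz, -⟩, rfl⟩
    exact ⟨⟨z, Ioo_subset_Icc_self hz, θ, rfl⟩, by simpa [point] using hz⟩

theorem hasSmoothSections_point :
    HasSmoothSections (fun e : ℝ × ℝ => S.point e.1 e.2) (Ioo S.a S.b ×ˢ univ) := by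
  rintro ⟨z, θ⟩ ⟨hz, -⟩
  refine ⟨fun q => (q 2, angleNear θ (planar q)), ?_, ?_, ?_⟩
  · refine (contDiff_coord 2).contDiffAt.prodMk
      (ContDiffAt.comp (g := angleNear θ) (f := planar) _ ?_ contDiff_planar.contDiffAt)
    rw [planar_point]
    exact contDiffAt_angleNear (S.u_pos z hz)
  · simp only [planar_point, angleNear_self θ (S.u_pos z hz)]
    simp [point]
  · filter_upwards [self_mem_nhdsWithin]
    rintro _ ⟨⟨w, σ⟩, ⟨hw, -⟩, rfl⟩
    obtain ⟨n, hn⟩ := exists_angleNear_eq θ (S.u_pos w hw) σ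
    simp only [planar_point, hn]
    have : S.point w σ 2 = w := by simp [point]
    rw [this]
    exact ⟨⟨hw, mem_univ _⟩, S.point_add_int_mul w σ n⟩

theorem tangentConeAt_surface {z : ℝ} (hz : z ∈ Ioo S.a S.b) (θ : ℝ) :
    tangentConeAt ℝ S.surface (S.point z θ) =
      {p | ∃ ζ η : ℝ, p = ζ • S.meridianVec z θ + η • S.parallelVec z θ} := by
  have hopen : IsOpen {q : R3 | q 2 ∈ Ioo S.a S.b} :=
    isOpen_Ioo.preimage (contDiff_coord 2).continuous
  have h1 : tangentConeAt ℝ S.surface (S.point z θ) =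
      tangentConeAt ℝ (S.surface ∩ {q : R3 | q 2 ∈ Ioo S.a S.b}) (S.point z θ) :=
    (tangentConeAt_inter_nhds (hopen.mem_nhds (by simpa [point] using hz))).symm
  have hd : HasFDerivAt (fun e : ℝ × ℝ => S.point e.1 e.2) _ (z, θ) :=
    S.hasFDerivAt_point (f := Prod.fst) (g := Prod.snd) (e := (z, θ)) hasFDerivAt_fst
      hasFDerivAt_snd hz
  have hmem : ((z, θ) : ℝ × ℝ) ∈ Ioo S.a S.b ×ˢ (univ : Set ℝ) := ⟨hz, mem_univ _⟩
  rw [h1, surface_inter_eq, S.hasSmoothSections_point.tangentConeAt_image hmem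
    hd.differentiableAt, tangentConeAt_of_mem_nhds ((isOpen_Ioo.prod isOpen_univ).mem_nhds hmem),
    hd.fderiv]
  ext p
  constructor
  · rintro ⟨v, -, rfl⟩
    exact ⟨v.1, v.2, by simp⟩
  · rintro ⟨ζ, η, rfl⟩
    exact ⟨(ζ, η), mem_univ _, by simp⟩

theorem cotangentBundle_inter_eq :
    cotangentBundle S.surface ∩ {x : R3 × R3 | x.1 2 ∈ Ioo S.a S.b} =
      S.covector '' (Ioo S.a S.b ×ˢ univ) := by
  ext x
  constructor
  · rintro ⟨⟨hx1, hx2⟩, hx3⟩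
    obtain ⟨⟨z, θ⟩, ⟨hz, -⟩, hq⟩ := S.surface_inter_eq.subset ⟨hx1, hx3⟩
    simp only at hq
    rw [← hq, S.tangentConeAt_surface hz] at hx2
    obtain ⟨ζ, η, hp⟩ := hx2
    exact ⟨(z, θ, ζ, η), ⟨hz, mem_univ _⟩, Prod.ext hq hp.symm⟩
  · rintro ⟨⟨z, θ, ζ, η⟩, ⟨hz, -⟩, rfl⟩
    have := S.surface_inter_eq.superset ⟨(z, θ), ⟨hz, mem_univ _⟩, rfl⟩
    refine ⟨⟨this.1, ?_⟩, this.2⟩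
    simp only [covector]
    rw [S.tangentConeAt_surface hz]
    exact ⟨ζ, η, rfl⟩

theorem planar_covector (e : ℝ × ℝ × ℝ × ℝ) :
    planar (S.covector e).1 = (S.u e.1 : ℂ) * Complex.exp (e.2.1 * Complex.I) :=
  S.planar_point _ _

theorem covector_fst_two (e : ℝ × ℝ × ℝ × ℝ) : (S.covector e).1 2 = e.1 := by
  simp [covector, point]

theorem covector_snd_two (e : ℝ × ℝ × ℝ × ℝ) : (S.covector e).2 2 = e.2.2.1 := by
  simp [covector, meridianVec, parallelVec]

theorem contDiff_angularMomentum : ContDiff ℝ ∞ angularMomentum := by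
  have h : ContDiff ℝ ∞ rotationField := by
    rw [contDiff_euclidean]
    intro i
    fin_cases i
    exacts [(contDiff_coord 1).neg, contDiff_coord 0, contDiff_const]
  exact contDiff_snd.inner ℝ (h.comp contDiff_fst)

theorem contDiff_energyMomentum : ContDiff ℝ ∞ energyMomentum :=
  (contDiff_snd.norm_sq ℝ).prodMk contDiff_angularMomentum

theorem hasSmoothSections_covector : HasSmoothSections S.covector (Ioo S.a S.b ×ˢ univ) := by
  rintro ⟨z, θ, ζ, η⟩ ⟨hz, -⟩
  have hu := S.u_pos z hz
  refine ⟨fun x => (x.1 2, angleNear θ (planar x.1), x.2 2, angularMomentum x / S.u (x.1 2) ^ 2),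
    ?_, ?_, ?_⟩
  · have h2 : ContDiffAt ℝ ∞ (fun x : R3 × R3 => x.1 2) (S.covector (z, θ, ζ, η)) :=
      ((contDiff_coord 2).comp contDiff_fst).contDiffAt
    refine h2.prodMk (ContDiffAt.prodMk ?_ (ContDiffAt.prodMk ?_ ?_))
    · refine ContDiffAt.comp (g := angleNear θ) (f := fun x : R3 × R3 => planar x.1) _ ?_
        (contDiff_planar.comp contDiff_fst).contDiffAt
      rw [planar_covector]
      exact contDiffAt_angleNear hu
    · exact ((contDiff_coord 2).comp contDiff_snd).contDiffAt
    · have h3 : ContDiffAt ℝ ∞ (fun x : R3 × R3 => S.u (x.1 2)) (S.covector (z, θ, ζ, η)) := by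
        refine ContDiffAt.comp (g := S.u) (f := fun x : R3 × R3 => x.1 2) _ ?_ h2
        rw [covector_fst_two]
        exact S.contDiffOn_u.contDiffAt (isOpen_Ioo.mem_nhds hz)
      refine contDiff_angularMomentum.contDiffAt.div (h3.pow 2) ?_
      rw [covector_fst_two]
      exact (pow_pos hu 2).ne'
  · simp only [covector_fst_two, covector_snd_two, planar_covector, angularMomentum_covector,
      angleNear_self θ hu]
    rw [mul_div_cancel_right₀ _ (pow_pos hu 2).ne']
  · filter_upwards [self_mem_nhdsWithin]
    rintro _ ⟨⟨w, σ, ζ', η'⟩, ⟨hw, -⟩, rfl⟩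
    have hu' := S.u_pos w hw
    obtain ⟨n, hn⟩ := exists_angleNear_eq θ hu' σ
    simp only [covector_fst_two, covector_snd_two, planar_covector, angularMomentum_covector, hn]
    rw [mul_div_cancel_right₀ _ (pow_pos hu' 2).ne']
    exact ⟨⟨hw, mem_univ _⟩, S.covector_add_int_mul _ _ _ _ n⟩

theorem tangentConeAt_cotangentBundle {e : ℝ × ℝ × ℝ × ℝ} (he : e.1 ∈ Ioo S.a S.b) :
    tangentConeAt ℝ (cotangentBundle S.surface) (S.covector e) =
      range (fderiv ℝ S.covector e) := by
  have hopen : IsOpen {x : R3 × R3 | x.1 2 ∈ Ioo S.a S.b} :=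
    isOpen_Ioo.preimage ((contDiff_coord 2).continuous.comp continuous_fst)
  have hmem : e ∈ Ioo S.a S.b ×ˢ (univ : Set (ℝ × ℝ × ℝ)) := ⟨he, mem_univ _⟩
  rw [← tangentConeAt_inter_nhds (hopen.mem_nhds (x := S.covector e)
    (by rw [mem_ofPred_eq, covector_fst_two]; exact he)),
    cotangentBundle_inter_eq, S.hasSmoothSections_covector.tangentConeAt_image hmem
    ((S.contDiffAt_covector he).differentiableAt (by simp)),
    tangentConeAt_of_mem_nhds ((isOpen_Ioo.prod isOpen_univ).mem_nhds hmem), image_univ]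

end SphereOfRevolution

/-! ### The coordinates `(s, c, τ, θ)` on the regular set -/

namespace SphereOfRevolution

variable (S : SphereOfRevolution)

/-- The domain of the coordinates `(s, (c, τ), θ)`: `s` is the norm of the covector, `c` its
Clairaut constant, `τ` the polar angle in the reduced phase plane, and `θ` the polar angle on the surface. -/
def coordDomain (z₀ : ℝ) : Set (ℝ × (ℝ × ℝ) × ℝ) := {e | 0 < e.1 ∧ e.2.1 ∈ S.strip z₀}

/-- The position in the chart `covector` of the point with coordinates `e = (s, (c, τ), θ)`. The
sign `ε = ±1` is the sign of the angular momentum; for `ε = -1` the surface is traversed in the opposite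
direction. -/
noncomputable def chartCoords (ε z₀ : ℝ) (e : ℝ × (ℝ × ℝ) × ℝ) : ℝ × ℝ × ℝ × ℝ :=
  (S.height z₀ e.2.1, ε * e.2.2, e.1 * S.slope z₀ e.2.1 / S.speed (S.height z₀ e.2.1),
    ε * (e.1 * e.2.1.1) / S.u (S.height z₀ e.2.1) ^ 2)

/-- The covector with coordinates `e = (s, (c, τ), θ)`. -/
noncomputable def phasePoint (ε z₀ : ℝ) (e : ℝ × (ℝ × ℝ) × ℝ) : R3 × R3 :=
  S.covector (S.chartCoords ε z₀ e)

/-- The section of `phasePoint` that uses the branches of `τ` and `θ` near given values. -/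
noncomputable def phaseSection (ε z₀ τ θ : ℝ) (x : R3 × R3) : ℝ × (ℝ × ℝ) × ℝ :=
  (‖x.2‖, (ε * angularMomentum x / ‖x.2‖,
    angleNear τ (((z₀ - x.1 2 : ℝ) : ℂ) + ((S.speed (x.1 2) * x.2 2 / ‖x.2‖ : ℝ) : ℂ) * Complex.I)),
    ε * angleNear (ε * θ) (planar x.1))

theorem isOpen_coordDomain (z₀ : ℝ) : IsOpen (S.coordDomain z₀) :=
  (isOpen_lt continuous_const continuous_fst).inter
    ((S.isOpen_strip z₀).preimage (continuous_fst.comp continuous_snd))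

variable {S} {z₀ : ℝ}

namespace HasUniqueEquator

variable (h : S.HasUniqueEquator z₀) {ε : ℝ} (hε : ε = 1 ∨ ε = -1)
include h

theorem contDiffAt_chartCoords (ε : ℝ) {e : ℝ × (ℝ × ℝ) × ℝ} (he : e ∈ S.coordDomain z₀) :
    ContDiffAt ℝ ∞ (S.chartCoords ε z₀) e := by
  have hst := (S.isOpen_strip z₀).mem_nhds he.2
  have hproj : ContDiffAt ℝ ∞ (fun e : ℝ × (ℝ × ℝ) × ℝ => e.2.1) e := by fun_prop
  have hZ : ContDiffAt ℝ ∞ (fun e : ℝ × (ℝ × ℝ) × ℝ => S.height z₀ e.2.1) e :=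
    ContDiffAt.comp (g := S.height z₀) e (h.contDiffOn_height.contDiffAt hst) hproj
  have hX : ContDiffAt ℝ ∞ (fun e : ℝ × (ℝ × ℝ) × ℝ => S.slope z₀ e.2.1) e :=
    ContDiffAt.comp (g := S.slope z₀) e (h.contDiffOn_slope.contDiffAt hst) hproj
  have hm := isOpen_Ioo.mem_nhds (h.height_mem he.2)
  have hl : ContDiffAt ℝ ∞ (fun e : ℝ × (ℝ × ℝ) × ℝ => S.speed (S.height z₀ e.2.1)) e :=
    ContDiffAt.comp (g := S.speed) e (S.contDiffOn_speed.contDiffAt hm) hZ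
  have hu : ContDiffAt ℝ ∞ (fun e : ℝ × (ℝ × ℝ) × ℝ => S.u (S.height z₀ e.2.1)) e :=
    ContDiffAt.comp (g := S.u) e (S.contDiffOn_u.contDiffAt hm) hZ
  refine hZ.prodMk (ContDiffAt.prodMk (by fun_prop) (ContDiffAt.prodMk ?_ ?_))
  · exact (contDiffAt_fst.mul hX).div hl (S.speed_pos _).ne'
  · exact ContDiffAt.div (by fun_prop) (hu.pow 2) (pow_pos (S.u_pos _ (h.height_mem he.2)) 2).ne'

theorem contDiffAt_phasePoint (ε : ℝ) {e : ℝ × (ℝ × ℝ) × ℝ} (he : e ∈ S.coordDomain z₀) :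
    ContDiffAt ℝ ∞ (S.phasePoint ε z₀) e :=
  (S.contDiffAt_covector (e := S.chartCoords ε z₀ e) (h.height_mem he.2)).comp e
    (h.contDiffAt_chartCoords ε he)

theorem angularMomentum_phasePoint (ε : ℝ) {e : ℝ × (ℝ × ℝ) × ℝ} (he : e ∈ S.coordDomain z₀) :
    angularMomentum (S.phasePoint ε z₀ e) = ε * (e.1 * e.2.1.1) := by
  rw [phasePoint, angularMomentum_covector, chartCoords]
  exact div_mul_cancel₀ _ (pow_pos (S.u_pos _ (h.height_mem he.2)) 2).ne'

include hε

theorem energy_phasePoint {e : ℝ × (ℝ × ℝ) × ℝ} (he : e ∈ S.coordDomain z₀) :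
    energy (S.phasePoint ε z₀ e) = e.1 ^ 2 := by
  have hu := S.u_pos _ (h.height_mem he.2)
  have hl := S.speed_pos (S.height z₀ e.2.1)
  have hε2 : ε ^ 2 = 1 := by rcases hε with rfl | rfl <;> norm_num
  rw [phasePoint, energy_covector, chartCoords]
  simp only
  rw [div_pow, div_mul_cancel₀ _ (pow_pos hl 2).ne', div_pow, mul_pow ε, hε2, mul_pow e.1 e.2.1.1,
    ← h.level he.2]
  field_simp
  ring

theorem norm_phasePoint {e : ℝ × (ℝ × ℝ) × ℝ} (he : e ∈ S.coordDomain z₀) :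
    ‖(S.phasePoint ε z₀ e).2‖ = e.1 :=
  (sq_eq_sq₀ (norm_nonneg _) he.1.le).1 (h.energy_phasePoint hε he)

omit h hε in
theorem reduced_phasePoint (ε : ℝ) {e : ℝ × (ℝ × ℝ) × ℝ} (he : e ∈ S.coordDomain z₀) :
    ((z₀ - (S.phasePoint ε z₀ e).1 2 : ℝ) : ℂ) + ((S.speed ((S.phasePoint ε z₀ e).1 2) *
      (S.phasePoint ε z₀ e).2 2 / e.1 : ℝ) : ℂ) * Complex.I =
      (S.radius z₀ e.2.1 : ℂ) * Complex.exp (e.2.1.2 * Complex.I) := by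
  have hl := (S.speed_pos (S.height z₀ e.2.1)).ne'
  have hs := he.1.ne'
  have h1 : z₀ - (S.phasePoint ε z₀ e).1 2 = S.radius z₀ e.2.1 * Real.cos e.2.1.2 := by
    rw [phasePoint, covector_fst_two]; simp [chartCoords, height]
  have h2 : S.speed ((S.phasePoint ε z₀ e).1 2) * (S.phasePoint ε z₀ e).2 2 / e.1 =
      S.radius z₀ e.2.1 * Real.sin e.2.1.2 := by
    rw [phasePoint, covector_fst_two, covector_snd_two]
    simp only [chartCoords]
    rw [mul_div_cancel₀ _ hl, mul_div_cancel_left₀ _ hs, slope]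
  rw [h1, h2, Complex.exp_mul_I]
  push_cast
  ring

theorem phaseSection_phasePoint {e : ℝ × (ℝ × ℝ) × ℝ} (he : e ∈ S.coordDomain z₀) (τ θ : ℝ) :
    ∃ n m : ℤ, S.phaseSection ε z₀ τ θ (S.phasePoint ε z₀ e) =
      (e.1, (e.2.1.1, e.2.1.2 + n * (2 * Real.pi)), e.2.2 + m * (2 * Real.pi)) := by
  obtain ⟨n, hn⟩ := exists_angleNear_eq τ (h.radius_pos he.2) e.2.1.2
  obtain ⟨m, hm⟩ := exists_angleNear_eq (ε * θ) (S.u_pos _ (h.height_mem he.2)) (ε * e.2.2)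
  have hpl : planar (S.phasePoint ε z₀ e).1 =
      (S.u (S.height z₀ e.2.1) : ℂ) * Complex.exp ((ε * e.2.2 : ℝ) * Complex.I) :=
    S.planar_covector _
  have hs := he.1.ne'
  have hc : ε * (ε * (e.1 * e.2.1.1)) / e.1 = e.2.1.1 := by
    rcases hε with rfl | rfl <;> field_simp
  have hm' : ∃ m' : ℤ, ε * (ε * e.2.2 + m * (2 * Real.pi)) = e.2.2 + m' * (2 * Real.pi) := by
    rcases hε with rfl | rfl
    · exact ⟨m, by ring⟩
    · exact ⟨-m, by push_cast; ring⟩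
  obtain ⟨m', hm'⟩ := hm'
  refine ⟨n, m', ?_⟩
  rw [phaseSection, h.norm_phasePoint hε he, h.angularMomentum_phasePoint ε he,
    reduced_phasePoint ε he, hpl, hn, hm, hc, hm']

theorem phaseSection_self {e : ℝ × (ℝ × ℝ) × ℝ} (he : e ∈ S.coordDomain z₀) :
    S.phaseSection ε z₀ e.2.1.2 e.2.2 (S.phasePoint ε z₀ e) = e := by
  have hpl : planar (S.phasePoint ε z₀ e).1 =
      (S.u (S.height z₀ e.2.1) : ℂ) * Complex.exp ((ε * e.2.2 : ℝ) * Complex.I) :=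
    S.planar_covector _
  have hs := he.1.ne'
  have hc : ε * (ε * (e.1 * e.2.1.1)) / e.1 = e.2.1.1 := by
    rcases hε with rfl | rfl <;> field_simp
  have ht : ε * (ε * e.2.2) = e.2.2 := by rcases hε with rfl | rfl <;> ring
  rw [phaseSection, h.norm_phasePoint hε he, h.angularMomentum_phasePoint ε he,
    reduced_phasePoint ε he, hpl, angleNear_self _ (h.radius_pos he.2),
    angleNear_self _ (S.u_pos _ (h.height_mem he.2)), hc, ht]

omit hε in
theorem radius_add_int_mul {c : ℝ} (hc : c ∈ Ioo 0 (S.u z₀)) (τ : ℝ) (n : ℤ) :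
    S.radius z₀ (c, τ + n * (2 * Real.pi)) = S.radius z₀ (c, τ) :=
  (show Function.Periodic (fun τ => S.radius z₀ (c, τ)) (2 * Real.pi) from
    h.radius_add_two_pi hc).int_mul n τ

theorem phasePoint_shift {s c : ℝ} (hc : c ∈ Ioo 0 (S.u z₀)) (τ θ : ℝ) (n m : ℤ) :
    S.phasePoint ε z₀ (s, (c, τ + n * (2 * Real.pi)), θ + m * (2 * Real.pi)) =
      S.phasePoint ε z₀ (s, (c, τ), θ) := by
  have hz : S.height z₀ (c, τ + n * (2 * Real.pi)) = S.height z₀ (c, τ) := by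
    simp only [height, h.radius_add_int_mul hc, Real.cos_add_int_mul_two_pi]
  have hx : S.slope z₀ (c, τ + n * (2 * Real.pi)) = S.slope z₀ (c, τ) := by
    simp only [slope, h.radius_add_int_mul hc, Real.sin_add_int_mul_two_pi]
  have hm' : ∃ m' : ℤ, ε * (θ + m * (2 * Real.pi)) = ε * θ + m' * (2 * Real.pi) := by
    rcases hε with rfl | rfl
    · exact ⟨m, by ring⟩
    · exact ⟨-m, by push_cast; ring⟩
  obtain ⟨m', hm'⟩ := hm'
  simp only [phasePoint, chartCoords, hz, hx, hm', covector_add_int_mul]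

/-- The coordinates of a point are unique up to multiples of `2π` in the two angles. -/
theorem phasePoint_eq_iff {e e' : ℝ × (ℝ × ℝ) × ℝ} (he : e ∈ S.coordDomain z₀)
    (he' : e' ∈ S.coordDomain z₀) : S.phasePoint ε z₀ e = S.phasePoint ε z₀ e' ↔
      ∃ n m : ℤ, e = (e'.1, (e'.2.1.1, e'.2.1.2 + n * (2 * Real.pi)),
        e'.2.2 + m * (2 * Real.pi)) := by
  constructor
  · intro heq
    obtain ⟨n, m, hnm⟩ := h.phaseSection_phasePoint hε he' e.2.1.2 e.2.2
    rw [← heq, h.phaseSection_self hε he] at hnm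
    exact ⟨n, m, hnm⟩
  · rintro ⟨n, m, rfl⟩
    exact h.phasePoint_shift hε he'.2.1 _ _ n m

theorem contDiffAt_phaseSection {e : ℝ × (ℝ × ℝ) × ℝ} (he : e ∈ S.coordDomain z₀) :
    ContDiffAt ℝ ∞ (S.phaseSection ε z₀ e.2.1.2 e.2.2) (S.phasePoint ε z₀ e) := by
  have hs : ‖(S.phasePoint ε z₀ e).2‖ ≠ 0 := by rw [h.norm_phasePoint hε he]; exact he.1.ne'
  have hn : ContDiffAt ℝ ∞ (fun x : R3 × R3 => ‖x.2‖) (S.phasePoint ε z₀ e) :=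
    contDiffAt_snd.norm ℝ (norm_ne_zero_iff.1 hs)
  have h1 : ContDiffAt ℝ ∞ (fun x : R3 × R3 => x.1 2) (S.phasePoint ε z₀ e) :=
    ((contDiff_coord 2).comp contDiff_fst).contDiffAt
  have h2 : ContDiffAt ℝ ∞ (fun x : R3 × R3 => x.2 2) (S.phasePoint ε z₀ e) :=
    ((contDiff_coord 2).comp contDiff_snd).contDiffAt
  have hl : ContDiffAt ℝ ∞ (fun x : R3 × R3 => S.speed (x.1 2)) (S.phasePoint ε z₀ e) := by
    refine ContDiffAt.comp (g := S.speed) (f := fun x : R3 × R3 => x.1 2) _ ?_ h1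
    rw [phasePoint, covector_fst_two]
    exact S.contDiffOn_speed.contDiffAt (isOpen_Ioo.mem_nhds (h.height_mem he.2))
  have hof : ∀ f : R3 × R3 → ℝ, ContDiffAt ℝ ∞ f (S.phasePoint ε z₀ e) →
      ContDiffAt ℝ ∞ (fun x => (f x : ℂ)) (S.phasePoint ε z₀ e) := fun f hf =>
    Complex.ofRealCLM.contDiff.contDiffAt.comp _ hf
  refine hn.prodMk (ContDiffAt.prodMk (ContDiffAt.prodMk ?_ ?_) ?_)
  · exact (contDiffAt_const.mul contDiff_angularMomentum.contDiffAt).div hn hs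
  · refine ContDiffAt.comp (g := angleNear e.2.1.2) (f := fun x : R3 × R3 =>
      ((z₀ - x.1 2 : ℝ) : ℂ) + ((S.speed (x.1 2) * x.2 2 / ‖x.2‖ : ℝ) : ℂ) * Complex.I) _ ?_ ?_
    · rw [h.norm_phasePoint hε he, reduced_phasePoint ε he]
      exact contDiffAt_angleNear (h.radius_pos he.2)
    · exact (hof _ (contDiffAt_const.sub h1)).add
        ((hof _ ((hl.mul h2).div hn hs)).mul contDiffAt_const)
  · refine contDiffAt_const.mul (ContDiffAt.comp (g := angleNear (ε * e.2.2))
      (f := fun x : R3 × R3 => planar x.1) _ ?_ (contDiff_planar.comp contDiff_fst).contDiffAt)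
    have hpl : planar (S.phasePoint ε z₀ e).1 =
        (S.u (S.height z₀ e.2.1) : ℂ) * Complex.exp ((ε * e.2.2 : ℝ) * Complex.I) :=
      S.planar_covector _
    rw [hpl]
    exact contDiffAt_angleNear (S.u_pos _ (h.height_mem he.2))

theorem hasSmoothSections_phasePoint :
    HasSmoothSections (S.phasePoint ε z₀) (S.coordDomain z₀) := by
  intro e he
  refine ⟨S.phaseSection ε z₀ e.2.1.2 e.2.2, h.contDiffAt_phaseSection hε he,
    h.phaseSection_self hε he, ?_⟩
  filter_upwards [self_mem_nhdsWithin]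
  rintro _ ⟨e', he', rfl⟩
  obtain ⟨n, m, hnm⟩ := h.phaseSection_phasePoint hε he' e.2.1.2 e.2.2
  rw [hnm]
  exact ⟨⟨he'.1, he'.2.1, mem_univ _⟩, h.phasePoint_shift hε he'.2.1 _ _ n m⟩

omit hε in
theorem phasePoint_mem_cotangentBundle (ε : ℝ) {e : ℝ × (ℝ × ℝ) × ℝ} (he : e ∈ S.coordDomain z₀) :
    S.phasePoint ε z₀ e ∈ cotangentBundle S.surface :=
  (S.cotangentBundle_inter_eq.superset
    ⟨S.chartCoords ε z₀ e, ⟨h.height_mem he.2, mem_univ _⟩, rfl⟩).1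

theorem exists_phasePoint_eq_covector {e : ℝ × ℝ × ℝ × ℝ} (he : e.1 ∈ Ioo S.a S.b)
    (hJ : 0 < ε * angularMomentum (S.covector e))
    (hlt : angularMomentum (S.covector e) ^ 2 < S.u z₀ ^ 2 * energy (S.covector e)) :
    ∃ e' ∈ S.coordDomain z₀, S.phasePoint ε z₀ e' = S.covector e := by
  obtain ⟨z, θ, ζ, η⟩ := e
  simp only at he
  have hε2 : ε ^ 2 = 1 := by rcases hε with rfl | rfl <;> norm_num
  have hE := S.energy_covector (z, θ, ζ, η)
  have hA := S.angularMomentum_covector (z, θ, ζ, η)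
  simp only at hE hA
  set H := energy (S.covector (z, θ, ζ, η))
  set J := angularMomentum (S.covector (z, θ, ζ, η))
  have hu := S.u_pos z he
  have hl := S.speed_pos z
  have hu0 := h.u_pos
  have hHpos : 0 < H := by
    by_contra hcon
    have : S.u z₀ ^ 2 * H ≤ 0 := mul_nonpos_of_nonneg_of_nonpos (by positivity) (not_lt.1 hcon)
    nlinarith [sq_nonneg J]
  set s := √H with hs
  have hspos : 0 < s := Real.sqrt_pos.2 hHpos
  have hs2 : s ^ 2 = H := Real.sq_sqrt hHpos.le
  have hcpos : 0 < ε * J / s := div_pos hJ hspos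
  have hc2 : (ε * J / s) ^ 2 = J ^ 2 / H := by rw [div_pow, mul_pow, hε2, one_mul, hs2]
  have hc : ε * J / s ∈ Ioo 0 (S.u z₀) := by
    refine ⟨hcpos, lt_of_pow_lt_pow_left₀ 2 hu0.le ?_⟩
    rwa [hc2, div_lt_iff₀ hHpos]
  set ξ := S.speed z * ζ / s with hξ
  have hlev : S.u z ^ 2 * (1 - ξ ^ 2) = (ε * J / s) ^ 2 := by
    rw [hc2, hξ, div_pow, hs2, hA]
    field_simp
    rw [hE]
    ring
  let w : ℂ := ((z₀ - z : ℝ) : ℂ) + (ξ : ℂ) * Complex.I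
  have hwre : w.re = z₀ - z := by simp [w]
  have hwim : w.im = ξ := by simp [w]
  have hw : w ≠ 0 := by
    intro h0
    have h1 : z = z₀ := by
      have := congrArg Complex.re h0
      rw [hwre, Complex.zero_re] at this
      linarith
    have h2 : ξ = 0 := by rw [← hwim, h0, Complex.zero_im]
    rw [h1, h2] at hlev
    have h3 : (ε * J / s) ^ 2 < S.u z₀ ^ 2 := by have := hc.2; gcongr
    nlinarith
  have hcos : ‖w‖ * Real.cos (Complex.arg w) = z₀ - z := by
    rw [Complex.norm_mul_cos_arg, hwre]
  have hsin : ‖w‖ * Real.sin (Complex.arg w) = ξ := by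
    rw [Complex.norm_mul_sin_arg, hwim]
  have hx : (ε * J / s, Complex.arg w) ∈ S.strip z₀ := ⟨hc, mem_univ _⟩
  have hz' : z₀ - ‖w‖ * Real.cos (Complex.arg w) = z := by rw [hcos]; ring
  have hrad : S.radius z₀ (ε * J / s, Complex.arg w) = ‖w‖ := by
    refine h.radius_eq hx ⟨norm_pos_iff.2 hw, by rwa [hz'], ?_, ?_⟩
    · rw [hsin]
      have : 0 < (ε * J / s) ^ 2 := by positivity
      rw [← hlev] at this
      have := pos_of_mul_pos_right this (by positivity)
      linarith
    · rw [hz', hsin, hlev]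
  have hh : S.height z₀ (ε * J / s, Complex.arg w) = z := by rw [height, hrad]; exact hz'
  have hsl : S.slope z₀ (ε * J / s, Complex.arg w) = ξ := by rw [slope, hrad]; exact hsin
  refine ⟨(s, (ε * J / s, Complex.arg w), ε * θ), ⟨hspos, hx⟩, ?_⟩
  rw [phasePoint, chartCoords]
  simp only [hh, hsl]
  have e1 : ε * (ε * θ) = θ := by linear_combination θ * hε2
  have e2 : s * ξ / S.speed z = ζ := by rw [hξ]; field_simp
  have e3 : ε * (s * (ε * J / s)) / S.u z ^ 2 = η := by
    rw [mul_div_cancel₀ _ hspos.ne', hA]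
    field_simp
    linear_combination η * hε2
  rw [e1, e2, e3]

/-- The tautological form in the coordinates: `λ = s (p_z dz + c dθ)`. -/
theorem tautological_phasePoint {e : ℝ × (ℝ × ℝ) × ℝ} (he : e ∈ S.coordDomain z₀)
    (w : ℝ × (ℝ × ℝ) × ℝ) :
    tautological (S.phasePoint ε z₀ e) (fderiv ℝ (S.phasePoint ε z₀) e w) =
      e.1 * (S.momentum z₀ e.2.1 * fderiv ℝ (S.height z₀) e.2.1 w.2.1) +
        e.1 * e.2.1.1 * w.2.2 := by
  have hε2 : ε ^ 2 = 1 := by rcases hε with rfl | rfl <;> norm_num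
  have hm := h.height_mem he.2
  have hproj : HasFDerivAt (fun e : ℝ × (ℝ × ℝ) × ℝ => e.2.1) ((ContinuousLinearMap.fst ℝ (ℝ × ℝ)
      ℝ).comp (ContinuousLinearMap.snd ℝ ℝ ((ℝ × ℝ) × ℝ))) e :=
    ((ContinuousLinearMap.fst ℝ (ℝ × ℝ) ℝ).comp
      (ContinuousLinearMap.snd ℝ ℝ ((ℝ × ℝ) × ℝ))).hasFDerivAt
  have hth : HasFDerivAt (fun e : ℝ × (ℝ × ℝ) × ℝ => ε * e.2.2)
      (ε • (ContinuousLinearMap.snd ℝ (ℝ × ℝ) ℝ).comp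
      (ContinuousLinearMap.snd ℝ ℝ ((ℝ × ℝ) × ℝ))) e :=
    (ε • (ContinuousLinearMap.snd ℝ (ℝ × ℝ) ℝ).comp
      (ContinuousLinearMap.snd ℝ ℝ ((ℝ × ℝ) × ℝ))).hasFDerivAt
  have hZ : HasFDerivAt (fun e : ℝ × (ℝ × ℝ) × ℝ => S.height z₀ e.2.1) _ e :=
    HasFDerivAt.comp (g := S.height z₀) e
      (differentiableAt_of_contDiffOn_strip h.contDiffOn_height he.2).hasFDerivAt hproj
  have hq := S.hasFDerivAt_point hZ hth hm
  have hQ := ((h.contDiffAt_phasePoint ε he).differentiableAt (by simp)).hasFDerivAt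
  have hq' : HasFDerivAt (fun e => (S.phasePoint ε z₀ e).1) _ e := hasFDerivAt_fst.comp e hQ
  have heq := congrArg (fun l => l w) (hq'.unique hq)
  have hl := (S.speed_pos (S.height z₀ e.2.1)).ne'
  have hu := (S.u_pos _ hm).ne'
  simp only [ContinuousLinearMap.comp_apply, ContinuousLinearMap.coe_fst',
    _root_.add_apply, ContinuousLinearMap.smulRight_apply,
    _root_.smul_apply, ContinuousLinearMap.coe_snd', smul_eq_mul] at heq
  change inner ℝ (S.phasePoint ε z₀ e).2 (fderiv ℝ (S.phasePoint ε z₀) e w).1 = _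
  rw [heq, phasePoint, covector]
  simp only [chartCoords]
  rw [inner_covector, momentum]
  field_simp
  linear_combination (e.1 * e.2.1.1 * w.2.2) * hε2

end HasUniqueEquator

end SphereOfRevolution

/-! ### The critical points of `F` and the regular set -/

theorem smul_mem_tangentConeAt {V : Type*} [NormedAddCommGroup V] [NormedSpace ℝ V] {s : Set V}
    {x v : V} (hv : v ∈ tangentConeAt ℝ s x) (r : ℝ) : r • v ∈ tangentConeAt ℝ s x := by
  obtain ⟨ι, l, hl, c, d, hd₀, hds, hcd⟩ := exists_fun_of_mem_tangentConeAt hv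
  refine mem_tangentConeAt_of_seq l (fun n => r * c n) d hd₀ hds ?_
  simpa only [mul_smul] using hcd.const_smul r

namespace SphereOfRevolution

variable (S : SphereOfRevolution)

/-- A pole is not isolated, so the tangent cone there is nontrivial. -/
theorem accPt_pole {z : ℝ} (hz : z = S.a ∨ z = S.b) :
    AccPt (!₂[0, 0, z] : R3) (𝓟 S.surface) := by
  obtain ⟨l, hl, hlim, hev⟩ : ∃ l : Filter ℝ, l.NeBot ∧ Tendsto (fun t => S.point t 0) l
      (𝓝 (!₂[0, 0, z] : R3)) ∧ ∀ᶠ t in l, t ∈ Ioo S.a S.b := by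
    have hcont : ∀ y ∈ Icc S.a S.b, S.u y = 0 →
        Tendsto (fun t => S.point t 0) (𝓝[Ioo S.a S.b] y) (𝓝 (!₂[0, 0, y] : R3)) := by
      intro y hy hu
      have h1 : Tendsto S.u (𝓝[Ioo S.a S.b] y) (𝓝 0) := by
        have := (S.continuousOn_u y hy).mono Ioo_subset_Icc_self
        rwa [ContinuousWithinAt, hu] at this
      have h2 : Tendsto (fun t : ℝ => t) (𝓝[Ioo S.a S.b] y) (𝓝 y) :=
        tendsto_id.mono_left nhdsWithin_le_nhds
      have h3 : Tendsto (fun t => (![S.u t, 0, t] : Fin 3 → ℝ)) (𝓝[Ioo S.a S.b] y)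
          (𝓝 ![0, 0, y]) := by
        rw [tendsto_pi_nhds]
        intro i
        fin_cases i
        exacts [h1, tendsto_const_nhds, h2]
      have h4 := ((PiLp.continuous_toLp 2 (fun _ : Fin 3 => ℝ)).tendsto ![0, 0, y]).comp h3
      refine h4.congr fun t => ?_
      simp [point]
    rcases hz with rfl | rfl
    · refine ⟨𝓝[Ioo S.a S.b] S.a, ?_, hcont _ (left_mem_Icc.2 S.a_lt_b.le) S.u_a,
        self_mem_nhdsWithin⟩
      exact mem_closure_iff_nhdsWithin_neBot.1 (by
        rw [closure_Ioo S.a_lt_b.ne]; exact left_mem_Icc.2 S.a_lt_b.le)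
    · refine ⟨𝓝[Ioo S.a S.b] S.b, ?_, hcont _ (right_mem_Icc.2 S.a_lt_b.le) S.u_b,
        self_mem_nhdsWithin⟩
      exact mem_closure_iff_nhdsWithin_neBot.1 (by
        rw [closure_Ioo S.a_lt_b.ne]; exact right_mem_Icc.2 S.a_lt_b.le)
  rw [accPt_iff_frequently]
  refine hlim.frequently (Eventually.frequently ?_)
  filter_upwards [hev] with t ht
  refine ⟨fun heq => ?_, ⟨t, Ioo_subset_Icc_self ht, 0, rfl⟩⟩
  have h2 := congrArg (fun q : R3 => q 2) heq
  simp [point] at h2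
  rcases hz with rfl | rfl
  · exact ht.1.ne' h2
  · exact ht.2.ne h2

/-- Over a pole the energy takes all values in `[0, 1]`, since the tangent cone of the surface is
nontrivial there. -/
theorem exists_mem_criticalSet_of_energy {t : ℝ} (h0 : 0 ≤ t) (h1 : t ≤ 1) :
    ∃ x ∈ S.criticalSet, energyMomentum x = (t, 0) := by
  obtain ⟨v, hv, hv0⟩ := tangentConeAt_nonempty_of_properSpace (𝕜 := ℝ)
    (S.accPt_pole (z := S.a) (Or.inl rfl))
  have hv0' : ‖v‖ ≠ 0 := norm_ne_zero_iff.2 hv0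
  have hnorm : ‖(√t / ‖v‖) • v‖ = √t := by
    rw [norm_smul, norm_div, norm_norm, Real.norm_of_nonneg (Real.sqrt_nonneg _),
      div_mul_cancel₀ _ hv0']
  refine ⟨(S.southPole, (√t / ‖v‖) • v), ⟨⟨⟨?_, smul_mem_tangentConeAt hv _⟩, ?_⟩, Or.inl rfl⟩, ?_⟩
  · exact ⟨S.a, left_mem_Icc.2 S.a_lt_b.le, 0, by simp [southPole, S.u_a]⟩
  · simp only [hnorm]
    exact Real.sqrt_le_one.2 h1
  · refine Prod.ext ?_ ?_
    · simp only [energyMomentum, energy, hnorm, Real.sq_sqrt h0]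
    · simp [energyMomentum, angularMomentum, rotationField, southPole, PiLp.inner_apply,
        Fin.sum_univ_three]

theorem mem_Ioo_of_angularMomentum_ne_zero {x : R3 × R3} (hx : x ∈ cotangentBundle S.surface)
    (hJ : angularMomentum x ≠ 0) : x.1 2 ∈ Ioo S.a S.b := by
  obtain ⟨⟨z, hz, θ, hq⟩, -⟩ := hx
  have h2 : x.1 2 = z := by rw [hq]; simp
  have hu : S.u z ≠ 0 := by
    intro hu
    apply hJ
    simp [angularMomentum, rotationField, hq, hu, PiLp.inner_apply, Fin.sum_univ_three]
  rw [h2]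
  refine ⟨lt_of_le_of_ne hz.1 ?_, lt_of_le_of_ne hz.2 ?_⟩
  · rintro rfl; exact hu S.u_a
  · rintro rfl; exact hu S.u_b

theorem exists_eq_covector {x : R3 × R3} (hx : x ∈ cotangentBundle S.surface)
    (hJ : angularMomentum x ≠ 0) : ∃ e : ℝ × ℝ × ℝ × ℝ, e.1 ∈ Ioo S.a S.b ∧ S.covector e = x := by
  obtain ⟨e, ⟨he, -⟩, hex⟩ := S.cotangentBundle_inter_eq.subset
    ⟨hx, S.mem_Ioo_of_angularMomentum_ne_zero hx hJ⟩
  exact ⟨e, he, hex⟩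

variable {S} {z₀ : ℝ}

namespace HasUniqueEquator

variable (h : S.HasUniqueEquator z₀)
include h

/-- Clairaut's inequality. -/
theorem sq_angularMomentum_le {e : ℝ × ℝ × ℝ × ℝ} (he : e.1 ∈ Ioo S.a S.b) :
    angularMomentum (S.covector e) ^ 2 ≤ S.u z₀ ^ 2 * energy (S.covector e) := by
  have hu := S.u_pos _ he
  have hle : S.u e.1 ^ 2 ≤ S.u z₀ ^ 2 := by
    have := h.u_le (Ioo_subset_Icc_self he)
    gcongr
  have h1 : angularMomentum (S.covector e) ^ 2 ≤ S.u e.1 ^ 2 * energy (S.covector e) := by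
    rw [energy_covector, angularMomentum_covector]
    have : 0 ≤ S.u e.1 ^ 2 * (e.2.2.1 ^ 2 * S.speed e.1 ^ 2) := by positivity
    nlinarith
  have h2 : 0 ≤ energy (S.covector e) := by unfold energy; positivity
  exact h1.trans (mul_le_mul_of_nonneg_right hle h2)

/-- On the equator the function `u(z₀)² H - J²` has a minimum, so that `dH` and `dJ` are linearly
dependent. -/
theorem sq_lt_of_isRegularPoint {e : ℝ × ℝ × ℝ × ℝ} (he : e.1 ∈ Ioo S.a S.b)
    (hreg : IsRegularPoint S.surface (S.covector e)) :
    angularMomentum (S.covector e) ^ 2 < S.u z₀ ^ 2 * energy (S.covector e) := by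
  refine lt_of_le_of_ne (h.sq_angularMomentum_le he) fun heq => ?_
  have hF : HasFDerivAt (fun e => energyMomentum (S.covector e))
      ((fderiv ℝ energyMomentum (S.covector e)).comp (fderiv ℝ S.covector e)) e :=
    ((contDiff_energyMomentum.differentiable (by simp)) _).hasFDerivAt.comp e
      ((S.contDiffAt_covector he).differentiableAt (by simp)).hasFDerivAt
  have hH : HasFDerivAt (fun e => energy (S.covector e)) _ e :=
    (ContinuousLinearMap.fst ℝ ℝ ℝ).hasFDerivAt.comp e hF
  have hJ' : HasFDerivAt (fun e => angularMomentum (S.covector e)) _ e :=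
    (ContinuousLinearMap.snd ℝ ℝ ℝ).hasFDerivAt.comp e hF
  have hG := (hH.const_mul (S.u z₀ ^ 2)).sub (hJ'.pow 2)
  have hmin : IsLocalMin (fun e => S.u z₀ ^ 2 * energy (S.covector e) -
      angularMomentum (S.covector e) ^ 2) e := by
    have hop : IsOpen {e : ℝ × ℝ × ℝ × ℝ | e.1 ∈ Ioo S.a S.b} :=
      isOpen_Ioo.preimage continuous_fst
    filter_upwards [hop.mem_nhds he] with e' he'
    have := h.sq_angularMomentum_le he'
    rw [heq]
    linarith
  have hzero := hmin.hasFDerivAt_eq_zero hG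
  obtain ⟨v, hv, hv1⟩ := hreg (mem_univ ((1 : ℝ), (0 : ℝ)))
  rw [S.tangentConeAt_cotangentBundle he] at hv
  obtain ⟨w, rfl⟩ := hv
  have h1 := congrArg (fun l => l w) hzero
  simp [hv1] at h1
  exact h.u_pos.ne' h1

/-- In the coordinates `F = (s², ε s c)`, a submersion. -/
theorem isRegularPoint_phasePoint {ε : ℝ} (hε : ε = 1 ∨ ε = -1) {e : ℝ × (ℝ × ℝ) × ℝ}
    (he : e ∈ S.coordDomain z₀) : IsRegularPoint S.surface (S.phasePoint ε z₀ e) := by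
  have hD := (S.isOpen_coordDomain z₀).mem_nhds he
  have hQ := ((h.contDiffAt_phasePoint ε he).differentiableAt (by simp)).hasFDerivAt
  have hF := ((contDiff_energyMomentum.differentiable (by simp)) _).hasFDerivAt.comp e hQ
  have hF' : HasFDerivAt (fun e : ℝ × (ℝ × ℝ) × ℝ => (e.1 ^ 2, ε * (e.1 * e.2.1.1)))
      ((fderiv ℝ energyMomentum (S.phasePoint ε z₀ e)).comp (fderiv ℝ (S.phasePoint ε z₀) e))
      e := by
    refine hF.congr_of_eventuallyEq ?_
    filter_upwards [hD] with e' he'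
    exact Prod.ext (h.energy_phasePoint hε he').symm (h.angularMomentum_phasePoint ε he').symm
  have hs : HasFDerivAt (fun e : ℝ × (ℝ × ℝ) × ℝ => e.1) (ContinuousLinearMap.fst ℝ ℝ _) e :=
    hasFDerivAt_fst
  have hc : HasFDerivAt (fun e : ℝ × (ℝ × ℝ) × ℝ => e.2.1.1) ((ContinuousLinearMap.fst ℝ ℝ ℝ).comp
      ((ContinuousLinearMap.fst ℝ (ℝ × ℝ) ℝ).comp
      (ContinuousLinearMap.snd ℝ ℝ ((ℝ × ℝ) × ℝ)))) e :=
    ((ContinuousLinearMap.fst ℝ ℝ ℝ).comp ((ContinuousLinearMap.fst ℝ (ℝ × ℝ) ℝ).comp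
      (ContinuousLinearMap.snd ℝ ℝ ((ℝ × ℝ) × ℝ)))).hasFDerivAt
  have heq := hF'.unique ((hs.pow 2).prodMk ((hs.mul hc).const_mul ε))
  have hs0 := he.1.ne'
  rintro ⟨p, q⟩ -
  refine ⟨fderiv ℝ (S.phasePoint ε z₀) e (p / (2 * e.1),
    ((ε * q - p / (2 * e.1) * e.2.1.1) / e.1, 0), 0), ?_, ?_⟩
  · have h1 := hQ.hasFDerivWithinAt (s := S.coordDomain z₀)
    have h2 := h1.mapsTo_tangent_cone (x := e) (by
      rw [tangentConeAt_of_mem_nhds hD]; exact mem_univ (p / (2 * e.1),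
        ((ε * q - p / (2 * e.1) * e.2.1.1) / e.1, (0 : ℝ)), (0 : ℝ)))
    refine tangentConeAt_mono ?_ h2
    rintro _ ⟨e', he', rfl⟩
    exact h.phasePoint_mem_cotangentBundle ε he'
  · have h1 := congrArg (fun l => l (p / (2 * e.1),
      ((ε * q - p / (2 * e.1) * e.2.1.1) / e.1, (0 : ℝ)), (0 : ℝ))) heq
    simp only [ContinuousLinearMap.comp_apply] at h1
    rw [h1]
    have hε2 : ε ^ 2 = 1 := by rcases hε with rfl | rfl <;> norm_num
    refine Prod.ext ?_ ?_
    · simp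
      field_simp
    · simp
      field_simp
      linear_combination (2 * e.1 * q) * hε2

/-- Off the zero level of `J`, a point of the cotangent bundle is regular exactly if it is not
tangent to the equator. -/
theorem isRegularPoint_iff {x : R3 × R3} (hx : x ∈ cotangentBundle S.surface)
    (hJ : angularMomentum x ≠ 0) :
    IsRegularPoint S.surface x ↔ angularMomentum x ^ 2 < S.u z₀ ^ 2 * energy x := by
  obtain ⟨e, he, rfl⟩ := S.exists_eq_covector hx hJ
  refine ⟨fun hr => h.sq_lt_of_isRegularPoint he hr, fun hlt => ?_⟩
  obtain ⟨ε, hε, hpos⟩ : ∃ ε : ℝ, (ε = 1 ∨ ε = -1) ∧ 0 < ε * angularMomentum (S.covector e) := by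
    rcases lt_or_gt_of_ne hJ with h1 | h1
    · exact ⟨-1, Or.inr rfl, by linarith⟩
    · exact ⟨1, Or.inl rfl, by linarith⟩
  obtain ⟨e', he', heq⟩ := h.exists_phasePoint_eq_covector hε he hpos hlt
  rw [← heq]
  exact h.isRegularPoint_phasePoint hε he'

/-- The zero level of `J` is excluded by the fibre over a pole; off it, the value of `F` decides
whether a point is regular. -/
theorem mem_regularSet_iff {x : R3 × R3} : x ∈ S.regularSet ↔ x ∈ diskBundle S.surface ∧
    angularMomentum x ≠ 0 ∧ angularMomentum x ^ 2 < S.u z₀ ^ 2 * energy x := by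
  constructor
  · rintro ⟨hx, hval⟩
    have hJ : angularMomentum x ≠ 0 := by
      intro h0
      have hE : energy x ≤ 1 := pow_le_one₀ (norm_nonneg _) hx.2
      obtain ⟨y, hy, hyx⟩ := S.exists_mem_criticalSet_of_energy
        (t := energy x) (by unfold energy; positivity) hE
      exact hval ⟨y, hy, by rw [hyx, energyMomentum, h0]⟩
    refine ⟨hx, hJ, ?_⟩
    rw [← h.isRegularPoint_iff hx.1 hJ]
    by_contra hcon
    exact hval ⟨x, ⟨hx, Or.inr (Or.inr hcon)⟩, rfl⟩
  · rintro ⟨hx, hJ, hlt⟩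
    refine ⟨hx, ?_⟩
    rintro ⟨y, ⟨hy, hcrit⟩, hyx⟩
    have hE : energy y = energy x := congrArg Prod.fst hyx
    have hA : angularMomentum y = angularMomentum x := congrArg Prod.snd hyx
    have hm := S.mem_Ioo_of_angularMomentum_ne_zero hy.1 (by rwa [hA])
    rcases hcrit with h1 | h1 | h1
    · rw [h1] at hm; simp [southPole] at hm
    · rw [h1] at hm; simp [northPole] at hm
    · rw [h.isRegularPoint_iff hy.1 (by rwa [hA]), hE, hA] at h1
      exact h1 hlt

theorem regularSet_eq : S.regularSet = {x ∈ diskBundle S.surface |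
    IsRegularPoint S.surface x ∧ angularMomentum x ≠ 0} := by
  ext x
  rw [h.mem_regularSet_iff]
  constructor
  · rintro ⟨hx, hJ, hlt⟩
    exact ⟨hx, (h.isRegularPoint_iff hx.1 hJ).2 hlt, hJ⟩
  · rintro ⟨hx, hr, hJ⟩
    exact ⟨hx, hJ, (h.isRegularPoint_iff hx.1 hJ).1 hr⟩

theorem Uplus_eq_preimage :
    S.Uplus = diskBundle S.surface ∩ energyMomentum ⁻¹' Bplus (S.u z₀) := by
  have hu := h.u_pos
  ext x
  constructor
  · rintro ⟨hx, hpos⟩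
    obtain ⟨hd, -, hlt⟩ := h.mem_regularSet_iff.1 hx
    have hE : 0 ≤ energy x := by unfold energy; positivity
    refine ⟨hd, ?_, pow_le_one₀ (norm_nonneg _) hd.2, hpos, ?_⟩
    · refine lt_of_le_of_ne hE fun h0 => ?_
      change 0 = energy x at h0
      rw [← h0, mul_zero] at hlt
      exact absurd hlt (not_lt.2 (sq_nonneg _))
    · have := Real.lt_sqrt_of_sq_lt hlt
      rwa [Real.sqrt_mul (by positivity), Real.sqrt_sq hu.le] at this
  · rintro ⟨hd, h1, h2, h3, h4⟩
    change 0 < energy x at h1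
    change 0 < angularMomentum x at h3
    change angularMomentum x < S.u z₀ * √(energy x) at h4
    refine ⟨h.mem_regularSet_iff.2 ⟨hd, h3.ne', ?_⟩, h3⟩
    have : angularMomentum x ^ 2 < (S.u z₀ * √(energy x)) ^ 2 := by gcongr
    rwa [mul_pow, Real.sq_sqrt h1.le] at this

theorem Uminus_eq_preimage :
    S.Uminus = diskBundle S.surface ∩ energyMomentum ⁻¹' Bminus (S.u z₀) := by
  have hu := h.u_pos
  ext x
  constructor
  · rintro ⟨hx, hneg⟩
    obtain ⟨hd, -, hlt⟩ := h.mem_regularSet_iff.1 hx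
    have hE : 0 ≤ energy x := by unfold energy; positivity
    refine ⟨hd, ?_, pow_le_one₀ (norm_nonneg _) hd.2, ?_, hneg⟩
    · refine lt_of_le_of_ne hE fun h0 => ?_
      change 0 = energy x at h0
      rw [← h0, mul_zero] at hlt
      exact absurd hlt (not_lt.2 (sq_nonneg _))
    · have := Real.lt_sqrt_of_sq_lt (x := -angularMomentum x) (by rwa [neg_sq])
      rw [Real.sqrt_mul (by positivity), Real.sqrt_sq hu.le] at this
      change -(S.u z₀ * √(energy x)) < angularMomentum x
      linarith
  · rintro ⟨hd, h1, h2, h3, h4⟩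
    change 0 < energy x at h1
    change angularMomentum x < 0 at h4
    change -(S.u z₀ * √(energy x)) < angularMomentum x at h3
    refine ⟨h.mem_regularSet_iff.2 ⟨hd, h4.ne, ?_⟩, h4⟩
    have hpos : 0 ≤ -angularMomentum x := by linarith
    have : (-angularMomentum x) ^ 2 < (S.u z₀ * √(energy x)) ^ 2 := by
      have : -angularMomentum x < S.u z₀ * √(energy x) := by linarith
      gcongr
    rwa [mul_pow, Real.sq_sqrt h1.le, neg_sq] at this

/-- The part of the regular set on which `J` has the sign `ε`, in the coordinates. -/
theorem image_phasePoint {ε : ℝ} (hε : ε = 1 ∨ ε = -1) :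
    S.phasePoint ε z₀ '' {e ∈ S.coordDomain z₀ | e.1 ≤ 1} =
      {x ∈ S.regularSet | 0 < ε * angularMomentum x} := by
  have hε2 : ε ^ 2 = 1 := by rcases hε with rfl | rfl <;> norm_num
  ext x
  constructor
  · rintro ⟨e, ⟨he, he1⟩, rfl⟩
    have hpos : 0 < e.1 * e.2.1.1 := mul_pos he.1 he.2.1.1
    have hlt : e.1 * e.2.1.1 < e.1 * S.u z₀ := mul_lt_mul_of_pos_left he.2.1.2 he.1
    have hA := h.angularMomentum_phasePoint ε he
    refine ⟨h.mem_regularSet_iff.2 ⟨⟨h.phasePoint_mem_cotangentBundle ε he, ?_⟩, ?_, ?_⟩, ?_⟩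
    · rw [h.norm_phasePoint hε he]; exact he1
    · rw [hA]
      exact mul_ne_zero (by rintro rfl; norm_num at hε2) hpos.ne'
    · rw [hA, h.energy_phasePoint hε he, mul_pow, hε2, one_mul, ← mul_pow, mul_comm (S.u z₀)]
      gcongr
    · rw [hA, ← mul_assoc, ← sq, hε2, one_mul]; exact hpos
  · rintro ⟨hx, hpos⟩
    obtain ⟨hd, hJ, hlt⟩ := h.mem_regularSet_iff.1 hx
    obtain ⟨e, he, rfl⟩ := S.exists_eq_covector hd.1 hJ
    obtain ⟨e', he', heq⟩ := h.exists_phasePoint_eq_covector hε he hpos hlt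
    refine ⟨e', ⟨he', ?_⟩, heq⟩
    rw [← h.norm_phasePoint hε he', heq]
    exact hd.2

theorem image_phasePoint_one : S.phasePoint 1 z₀ '' {e ∈ S.coordDomain z₀ | e.1 ≤ 1} = S.Uplus := by
  rw [h.image_phasePoint (Or.inl rfl)]
  simp only [one_mul]
  rfl

theorem image_phasePoint_neg_one :
    S.phasePoint (-1) z₀ '' {e ∈ S.coordDomain z₀ | e.1 ≤ 1} = S.Uminus := by
  rw [h.image_phasePoint (Or.inr rfl)]
  simp only [neg_one_mul, Left.neg_pos_iff]
  rfl

theorem image_phasePoint_sphere {ε : ℝ} (hε : ε = 1 ∨ ε = -1) :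
    S.phasePoint ε z₀ '' {e ∈ S.coordDomain z₀ | e.1 = 1} =
      S.phasePoint ε z₀ '' {e ∈ S.coordDomain z₀ | e.1 ≤ 1} ∩ cosphereBundle S.surface := by
  ext x
  constructor
  · rintro ⟨e, ⟨he, he1⟩, rfl⟩
    exact ⟨⟨e, ⟨he, he1.le⟩, rfl⟩, h.phasePoint_mem_cotangentBundle ε he, by
      rw [h.norm_phasePoint hε he, he1]⟩
  · rintro ⟨⟨e, ⟨he, he1⟩, rfl⟩, -, hn⟩
    exact ⟨e, ⟨he, by rw [← h.norm_phasePoint hε he, hn]⟩, rfl⟩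

theorem isConnected_image_phasePoint (ε : ℝ) :
    IsConnected (S.phasePoint ε z₀ '' {e ∈ S.coordDomain z₀ | e.1 ≤ 1}) := by
  have hset : {e ∈ S.coordDomain z₀ | e.1 ≤ 1} =
      Ioc (0 : ℝ) 1 ×ˢ ((Ioo 0 (S.u z₀) ×ˢ (univ : Set ℝ)) ×ˢ (univ : Set ℝ)) := by
    ext e
    constructor
    · rintro ⟨⟨h1, h2⟩, h3⟩; exact ⟨⟨h1, h3⟩, h2, mem_univ _⟩
    · rintro ⟨⟨h1, h3⟩, h2, -⟩; exact ⟨⟨h1, h2⟩, h3⟩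
  refine IsConnected.image ?_ _ fun e he =>
    (h.contDiffAt_phasePoint ε he.1).continuousAt.continuousWithinAt
  rw [hset]
  exact (isConnected_Ioc one_pos).prod (((isConnected_Ioo h.u_pos).prod isConnected_univ).prod
    isConnected_univ)

theorem connectedComponentIn_regularSet :
    connectedComponentIn S.regularSet '' S.regularSet = {S.Uplus, S.Uminus} ∧
      S.Uplus ≠ S.Uminus := by
  have hp : IsConnected S.Uplus := h.image_phasePoint_one ▸ h.isConnected_image_phasePoint 1
  have hm : IsConnected S.Uminus := h.image_phasePoint_neg_one ▸ h.isConnected_image_phasePoint (-1)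
  have hcont : Continuous angularMomentum := contDiff_angularMomentum.continuous
  have hne : ∀ x ∈ S.regularSet, angularMomentum x ≠ 0 := fun x hx =>
    (h.mem_regularSet_iff.1 hx).2.1
  have key : ∀ C ⊆ S.regularSet, IsPreconnected C → ∀ x ∈ C, ∀ y ∈ C,
      0 < angularMomentum x → 0 < angularMomentum y := by
    intro C hC hpre x hx y hy hpos
    by_contra hcon
    push Not at hcon
    obtain ⟨w, hw, hw0⟩ := hpre.intermediate_value hy hx hcont.continuousOn ⟨hcon, hpos.le⟩
    exact hne w (hC hw) hw0
  have hcp : ∀ x ∈ S.Uplus, connectedComponentIn S.regularSet x = S.Uplus := fun x hx => by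
    apply Subset.antisymm
    · intro y hy
      exact ⟨connectedComponentIn_subset _ _ hy, key _ (connectedComponentIn_subset _ _)
        isPreconnected_connectedComponentIn x (mem_connectedComponentIn hx.1) y hy hx.2⟩
    · exact hp.isPreconnected.subset_connectedComponentIn hx fun y hy => hy.1
  have hcm : ∀ x ∈ S.Uminus, connectedComponentIn S.regularSet x = S.Uminus := fun x hx => by
    apply Subset.antisymm
    · intro y hy
      have hyR := connectedComponentIn_subset _ _ hy
      refine ⟨hyR, lt_of_le_of_ne (not_lt.1 fun hpos => ?_) (hne y hyR)⟩
      exact lt_asymm hx.2 (key _ (connectedComponentIn_subset _ _)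
        isPreconnected_connectedComponentIn y hy x (mem_connectedComponentIn hx.1) hpos)
    · exact hm.isPreconnected.subset_connectedComponentIn hx fun y hy => hy.1
  obtain ⟨xp, hxp⟩ := hp.nonempty
  obtain ⟨xm, hxm⟩ := hm.nonempty
  refine ⟨?_, fun heq => ?_⟩
  · apply Subset.antisymm
    · rintro _ ⟨x, hx, rfl⟩
      rcases lt_or_gt_of_ne (hne x hx) with h1 | h1
      · exact Or.inr (hcm x ⟨hx, h1⟩)
      · exact Or.inl (hcp x ⟨hx, h1⟩)
    · rintro _ (rfl | rfl)
      · exact ⟨xp, hxp.1, hcp xp hxp⟩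
      · exact ⟨xm, hxm.1, hcm xm hxm⟩
  · exact lt_asymm hxp.2 (heq ▸ hxp).2

end HasUniqueEquator

end SphereOfRevolution

/-! ### Polar coordinates on `ℂ²` -/

section Polar

theorem fderiv_polar {E : Type*} [NormedAddCommGroup E] [NormedSpace ℝ E] {r φ : E → ℝ}
    {r' φ' : E →L[ℝ] ℝ} {e : E} (hr : HasFDerivAt r r' e) (hφ : HasFDerivAt φ φ' e) :
    ∃ L : E →L[ℝ] ℂ, HasFDerivAt (fun e => (r e : ℂ) * Complex.exp (φ e * Complex.I)) L e ∧
      ∀ v, L v = ((r' v : ℂ) + (r e * φ' v : ℝ) * Complex.I) * Complex.exp (φ e * Complex.I) := by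
  have h1 : HasFDerivAt (fun e => (r e : ℂ)) (Complex.ofRealCLM.comp r') e :=
    Complex.ofRealCLM.hasFDerivAt.comp e hr
  have h2 : HasFDerivAt (fun e => (φ e : ℂ)) (Complex.ofRealCLM.comp φ') e :=
    Complex.ofRealCLM.hasFDerivAt.comp e hφ
  refine ⟨_, h1.mul (h2.mul_const Complex.I).cexp, fun v => ?_⟩
  simp
  ring

theorem exists_hasFDerivAt_sqrt {E : Type*} [NormedAddCommGroup E] [NormedSpace ℝ E] {f : E → ℝ}
    {f' : E →L[ℝ] ℝ} {e : E} (hf : HasFDerivAt f f' e) (h0 : 0 < f e) :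
    ∃ r' : E →L[ℝ] ℝ, HasFDerivAt (fun e => √(f e)) r' e ∧ ∀ v, √(f e) * r' v = f' v / 2 := by
  refine ⟨_, hf.sqrt h0.ne', fun v => ?_⟩
  have := (Real.sqrt_pos.2 h0).ne'
  rw [smul_apply, smul_eq_mul]
  field_simp

theorem stdLiouville_polar (r₁ φ₁ r₂ φ₂ a₁ b₁ a₂ b₂ : ℝ) :
    stdLiouville (r₁ * Complex.exp (φ₁ * Complex.I), r₂ * Complex.exp (φ₂ * Complex.I))
      ((a₁ + (r₁ * b₁ : ℝ) * Complex.I) * Complex.exp (φ₁ * Complex.I),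
        (a₂ + (r₂ * b₂ : ℝ) * Complex.I) * Complex.exp (φ₂ * Complex.I)) =
      r₁ ^ 2 / 2 * b₁ + r₂ ^ 2 / 2 * b₂ := by
  simp [stdLiouville, Complex.exp_ofReal_mul_I_re, Complex.exp_ofReal_mul_I_im]
  linear_combination (r₁ ^ 2 / 2 * b₁) * Real.sin_sq_add_cos_sq φ₁ +
    (r₂ ^ 2 / 2 * b₂) * Real.sin_sq_add_cos_sq φ₂

theorem stdSymplectic_polar (z : ℂ × ℂ) (r₁ φ₁ r₂ φ₂ a₁ b₁ a₂ b₂ a₁' b₁' a₂' b₂' : ℝ) :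
    stdSymplectic z ((a₁ + (r₁ * b₁ : ℝ) * Complex.I) * Complex.exp (φ₁ * Complex.I),
        (a₂ + (r₂ * b₂ : ℝ) * Complex.I) * Complex.exp (φ₂ * Complex.I))
      ((a₁' + (r₁ * b₁' : ℝ) * Complex.I) * Complex.exp (φ₁ * Complex.I),
        (a₂' + (r₂ * b₂' : ℝ) * Complex.I) * Complex.exp (φ₂ * Complex.I)) =
      (r₁ * a₁ * b₁' - r₁ * a₁' * b₁) + (r₂ * a₂ * b₂' - r₂ * a₂' * b₂) := by
  simp [stdSymplectic, Complex.exp_ofReal_mul_I_re, Complex.exp_ofReal_mul_I_im]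
  linear_combination (r₁ * a₁ * b₁' - r₁ * a₁' * b₁) * Real.sin_sq_add_cos_sq φ₁ +
    (r₂ * a₂ * b₂' - r₂ * a₂' * b₂) * Real.sin_sq_add_cos_sq φ₂

theorem polar_eq_zero {r φ a b : ℝ} (hr : r ≠ 0)
    (h : ((a : ℂ) + (r * b : ℝ) * Complex.I) * Complex.exp (φ * Complex.I) = 0) :
    a = 0 ∧ b = 0 := by
  have h1 := (mul_eq_zero.1 h).resolve_right (Complex.exp_ne_zero _)
  have h2 := congrArg Complex.re h1
  have h3 := congrArg Complex.im h1
  simp [hr] at h2 h3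
  exact ⟨h2, h3⟩

theorem exists_int_of_polar_eq {r φ φ' : ℝ} (hr : r ≠ 0)
    (h : (r : ℂ) * Complex.exp (φ * Complex.I) = r * Complex.exp (φ' * Complex.I)) :
    ∃ n : ℤ, φ = φ' + n * (2 * Real.pi) := by
  have h1 := mul_left_cancel₀ (Complex.ofReal_ne_zero.2 hr) h
  obtain ⟨n, hn⟩ := Complex.exp_eq_exp_iff_exists_int.1 h1
  refine ⟨n, ?_⟩
  have h2 := congrArg Complex.im hn
  simpa using h2

theorem exp_add_int_mul_two_pi (φ : ℝ) (n : ℤ) :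
    Complex.exp ((φ + n * (2 * Real.pi) : ℝ) * Complex.I) = Complex.exp (φ * Complex.I) := by
  rw [Complex.exp_eq_exp_iff_exists_int]
  exact ⟨n, by push_cast; ring⟩

theorem differentiable_stdLiouville : Differentiable ℝ stdLiouville := by
  have hl : IsLinearMap ℝ stdLiouville := by
    constructor
    · intro x y; ext t <;> simp [stdLiouville] <;> ring
    · intro c x; ext t <;> simp [stdLiouville] <;> ring
  exact (LinearMap.toContinuousLinearMap hl.mk').differentiable

theorem differentiable_tautological : Differentiable ℝ tautological :=
  (((ContinuousLinearMap.compL ℝ (R3 × R3) R3 ℝ).flip (ContinuousLinearMap.fst ℝ R3 R3)).comp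
    ((innerSL ℝ (E := R3)).comp (ContinuousLinearMap.snd ℝ R3 R3))).differentiable

end Polar

/-! ### Action-angle coordinates with values in `ℂ²` -/

namespace SphereOfRevolution

variable (S : SphereOfRevolution)

/-- The point of `ℂ²` with actions `2π s c` and `s g(c)` and angles `θ + A` and `2π B`. -/
noncomputable def toricPoint (z₀ : ℝ) (e : ℝ × (ℝ × ℝ) × ℝ) : ℂ × ℂ :=
  ((√(2 * (e.1 * e.2.1.1)) : ℝ) * Complex.exp ((e.2.2 + S.angleShift z₀ e.2.1 : ℝ) * Complex.I),
    (√(e.1 * S.loopAction z₀ e.2.1.1 / Real.pi) : ℝ) *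
      Complex.exp ((2 * Real.pi * S.meridianAngle z₀ e.2.1 : ℝ) * Complex.I))

/-- The differential of the first action (divided by `2π`) in the coordinates. -/
def firstActionForm (e v : ℝ × (ℝ × ℝ) × ℝ) : ℝ := e.1 * v.2.1.1 + e.2.1.1 * v.1

/-- The differential of the second action in the coordinates. -/
noncomputable def secondActionForm (z₀ : ℝ) (e v : ℝ × (ℝ × ℝ) × ℝ) : ℝ :=
  e.1 * (S.deflection z₀ (e.2.1.1, 2 * Real.pi) * v.2.1.1) + S.loopAction z₀ e.2.1.1 * v.1

/-- The differential of the first angle in the coordinates. -/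
noncomputable def firstAngleForm (z₀ : ℝ) (e v : ℝ × (ℝ × ℝ) × ℝ) : ℝ :=
  v.2.2 + fderiv ℝ (S.angleShift z₀) e.2.1 v.2.1

/-- The differential of the second angle (divided by `2π`) in the coordinates. -/
noncomputable def secondAngleForm (z₀ : ℝ) (e v : ℝ × (ℝ × ℝ) × ℝ) : ℝ :=
  fderiv ℝ (S.meridianAngle z₀) e.2.1 v.2.1

variable {S} {z₀ : ℝ}

namespace HasUniqueEquator

variable (h : S.HasUniqueEquator z₀)
include h

theorem loopAction_pos {c : ℝ} (hc : c ∈ Ioo 0 (S.u z₀)) : 0 < S.loopAction z₀ c := by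
  have h1 := h.mem_region_iff.2 ⟨1, ⟨one_pos, le_rfl⟩, c, hc, rfl⟩
  simpa using h1.2.2.1

theorem contDiffAt_toricPoint {e : ℝ × (ℝ × ℝ) × ℝ} (he : e ∈ S.coordDomain z₀) :
    ContDiffAt ℝ ∞ (S.toricPoint z₀) e := by
  have hst := (S.isOpen_strip z₀).mem_nhds he.2
  have hproj : ContDiffAt ℝ ∞ (fun e : ℝ × (ℝ × ℝ) × ℝ => e.2.1) e := by fun_prop
  have hA : ContDiffAt ℝ ∞ (fun e : ℝ × (ℝ × ℝ) × ℝ => S.angleShift z₀ e.2.1) e :=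
    ContDiffAt.comp (g := S.angleShift z₀) e (h.contDiffOn_angleShift.contDiffAt hst) hproj
  have hB : ContDiffAt ℝ ∞ (fun e : ℝ × (ℝ × ℝ) × ℝ => S.meridianAngle z₀ e.2.1) e :=
    ContDiffAt.comp (g := S.meridianAngle z₀) e (h.contDiffOn_meridianAngle.contDiffAt hst) hproj
  have hg : ContDiffAt ℝ ∞ (fun e : ℝ × (ℝ × ℝ) × ℝ => S.loopAction z₀ e.2.1.1) e :=
    ContDiffAt.comp (g := S.loopAction z₀) (f := fun e : ℝ × (ℝ × ℝ) × ℝ => e.2.1.1) e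
      (h.contDiffOn_loopAction.contDiffAt (isOpen_Ioo.mem_nhds he.2.1)) (by fun_prop)
  have hof : ∀ f : ℝ × (ℝ × ℝ) × ℝ → ℝ, ContDiffAt ℝ ∞ f e →
      ContDiffAt ℝ ∞ (fun x => (f x : ℂ)) e := fun f hf =>
    Complex.ofRealCLM.contDiff.contDiffAt.comp _ hf
  have h1 : 2 * (e.1 * e.2.1.1) ≠ 0 := by
    have := he.1; have := he.2.1.1; positivity
  have h2 : e.1 * S.loopAction z₀ e.2.1.1 / Real.pi ≠ 0 := by
    have := he.1; have := h.loopAction_pos he.2.1; have := Real.pi_pos; positivity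
  refine ContDiffAt.prodMk ?_ ?_
  · refine (hof _ (ContDiffAt.sqrt (by fun_prop) h1)).mul
      (ContDiffAt.cexp ((hof _ (ContDiffAt.add (by fun_prop) hA)).mul contDiffAt_const))
  · exact (hof _ (((contDiffAt_fst.mul hg).div_const _).sqrt h2)).mul
      (ContDiffAt.cexp ((hof _ (contDiffAt_const.mul hB)).mul contDiffAt_const))

/-- The derivative in polar form. The radial parts `a₁`, `a₂` enter only through their products with
the radii, which are the differentials of the actions. -/
theorem fderiv_toricPoint {e : ℝ × (ℝ × ℝ) × ℝ} (he : e ∈ S.coordDomain z₀) :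
    ∃ a₁ a₂ : ℝ × (ℝ × ℝ) × ℝ → ℝ, ∀ v,
      fderiv ℝ (S.toricPoint z₀) e v =
        ((a₁ v + (√(2 * (e.1 * e.2.1.1)) * S.firstAngleForm z₀ e v : ℝ) * Complex.I) *
            Complex.exp ((e.2.2 + S.angleShift z₀ e.2.1 : ℝ) * Complex.I),
          (a₂ v + (√(e.1 * S.loopAction z₀ e.2.1.1 / Real.pi) *
            (2 * Real.pi * S.secondAngleForm z₀ e v) : ℝ) * Complex.I) *
            Complex.exp ((2 * Real.pi * S.meridianAngle z₀ e.2.1 : ℝ) * Complex.I)) ∧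
      √(2 * (e.1 * e.2.1.1)) * a₁ v = firstActionForm e v ∧
      √(e.1 * S.loopAction z₀ e.2.1.1 / Real.pi) * a₂ v =
        S.secondActionForm z₀ e v / (2 * Real.pi) := by
  let E := ℝ × (ℝ × ℝ) × ℝ
  have hst := (S.isOpen_strip z₀).mem_nhds he.2
  have hs : HasFDerivAt (fun e : E => e.1) (ContinuousLinearMap.fst ℝ ℝ ((ℝ × ℝ) × ℝ)) e :=
    hasFDerivAt_fst
  let p : E →L[ℝ] ℝ × ℝ := (ContinuousLinearMap.fst ℝ (ℝ × ℝ) ℝ).comp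
      (ContinuousLinearMap.snd ℝ ℝ ((ℝ × ℝ) × ℝ))
  let q : E →L[ℝ] ℝ := (ContinuousLinearMap.snd ℝ (ℝ × ℝ) ℝ).comp
      (ContinuousLinearMap.snd ℝ ℝ ((ℝ × ℝ) × ℝ))
  have hp : HasFDerivAt (fun e : E => e.2.1) p e := p.hasFDerivAt
  have hq : HasFDerivAt (fun e : E => e.2.2) q e := q.hasFDerivAt
  have hc : HasFDerivAt (fun e : E => e.2.1.1) ((ContinuousLinearMap.fst ℝ ℝ ℝ).comp p) e :=
    ((ContinuousLinearMap.fst ℝ ℝ ℝ).comp p).hasFDerivAt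
  have hA : HasFDerivAt (fun e : E => S.angleShift z₀ e.2.1) _ e :=
    HasFDerivAt.comp (g := S.angleShift z₀) e
      (differentiableAt_of_contDiffOn_strip h.contDiffOn_angleShift he.2).hasFDerivAt hp
  have hB : HasFDerivAt (fun e : E => S.meridianAngle z₀ e.2.1) _ e :=
    HasFDerivAt.comp (g := S.meridianAngle z₀) e
      (differentiableAt_of_contDiffOn_strip h.contDiffOn_meridianAngle he.2).hasFDerivAt hp
  have hg : HasFDerivAt (fun e : E => S.loopAction z₀ e.2.1.1) _ e :=
    HasDerivAt.comp_hasFDerivAt (f := fun e : E => e.2.1.1) e (h.hasDerivAt_loopAction he.2.1) hc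
  have h1 : 0 < 2 * (e.1 * e.2.1.1) := by
    have := he.1; have := he.2.1.1; positivity
  have h2 : 0 < e.1 * S.loopAction z₀ e.2.1.1 / Real.pi := by
    have := he.1; have := h.loopAction_pos he.2.1; have := Real.pi_pos; positivity
  obtain ⟨r₁', hr₁, e₁⟩ := exists_hasFDerivAt_sqrt ((hs.mul hc).const_mul 2) h1
  obtain ⟨r₂', hr₂, e₂⟩ := exists_hasFDerivAt_sqrt ((hs.mul hg).mul_const Real.pi⁻¹)
    (by rw [← div_eq_mul_inv]; exact h2)
  obtain ⟨L₁, hL₁, hL₁'⟩ := fderiv_polar hr₁ (hq.add hA)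
  obtain ⟨L₂, hL₂, hL₂'⟩ := fderiv_polar hr₂ (hB.const_mul (2 * Real.pi))
  have hd : HasFDerivAt (S.toricPoint z₀) (L₁.prod L₂) e := hL₁.prodMk hL₂
  refine ⟨r₁', r₂', fun v => ⟨?_, (e₁ v).trans ?_, (e₂ v).trans ?_⟩⟩
  · rw [hd.fderiv]
    exact Prod.ext (hL₁' v) (hL₂' v)
  · change 2 * (e.1 * v.2.1.1 + e.2.1.1 * v.1) / 2 = e.1 * v.2.1.1 + e.2.1.1 * v.1
    ring
  · change Real.pi⁻¹ * (e.1 * (S.deflection z₀ (e.2.1.1, 2 * Real.pi) * v.2.1.1) +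
      S.loopAction z₀ e.2.1.1 * v.1) / 2 = S.secondActionForm z₀ e v / (2 * Real.pi)
    rw [secondActionForm]
    field_simp

/-- The Liouville form in action-angle coordinates. -/
theorem stdLiouville_toricPoint {e : ℝ × (ℝ × ℝ) × ℝ} (he : e ∈ S.coordDomain z₀)
    (v : ℝ × (ℝ × ℝ) × ℝ) :
    stdLiouville (S.toricPoint z₀ e) (fderiv ℝ (S.toricPoint z₀) e v) =
      e.1 * e.2.1.1 * S.firstAngleForm z₀ e v +
        e.1 * S.loopAction z₀ e.2.1.1 * S.secondAngleForm z₀ e v := by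
  obtain ⟨a₁, a₂, ha⟩ := h.fderiv_toricPoint he
  have hs := he.1
  have hc := he.2.1.1
  have hg := h.loopAction_pos he.2.1
  have hpi := Real.pi_pos
  rw [(ha v).1, toricPoint, stdLiouville_polar, Real.sq_sqrt (by positivity),
    Real.sq_sqrt (by positivity)]
  field_simp

theorem stdSymplectic_toricPoint {e : ℝ × (ℝ × ℝ) × ℝ} (he : e ∈ S.coordDomain z₀)
    (v w : ℝ × (ℝ × ℝ) × ℝ) :
    stdSymplectic (S.toricPoint z₀ e) (fderiv ℝ (S.toricPoint z₀) e v)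
        (fderiv ℝ (S.toricPoint z₀) e w) =
      (firstActionForm e v * S.firstAngleForm z₀ e w -
        firstActionForm e w * S.firstAngleForm z₀ e v) +
      (S.secondActionForm z₀ e v * S.secondAngleForm z₀ e w -
        S.secondActionForm z₀ e w * S.secondAngleForm z₀ e v) := by
  obtain ⟨a₁, a₂, ha⟩ := h.fderiv_toricPoint he
  have hpi := Real.pi_pos
  rw [(ha v).1, (ha w).1, stdSymplectic_polar, (ha v).2.1, (ha v).2.2, (ha w).2.1, (ha w).2.2]
  field_simp

/-- The differentials of `s`, `c` and of the two angles are a coframe. -/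
theorem eq_zero_of_forms {e v : ℝ × (ℝ × ℝ) × ℝ} (he : e ∈ S.coordDomain z₀) (hs : v.1 = 0)
    (hc : v.2.1.1 = 0) (hA : S.firstAngleForm z₀ e v = 0) (hB : S.secondAngleForm z₀ e v = 0) :
    v = 0 := by
  have hBτ := h.partialSnd_meridianAngle_pos he.2
  rw [secondAngleForm, fderiv_eq_partials, hc, zero_mul, zero_add] at hB
  have hτ : v.2.1.2 = 0 := (mul_eq_zero.1 hB).resolve_right hBτ.ne'
  have h21 : v.2.1 = 0 := Prod.ext hc hτ
  rw [firstAngleForm, h21, map_zero, add_zero] at hA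
  exact Prod.ext hs (Prod.ext h21 hA)

theorem fderiv_toricPoint_injective {e : ℝ × (ℝ × ℝ) × ℝ} (he : e ∈ S.coordDomain z₀)
    (v : ℝ × (ℝ × ℝ) × ℝ) (hv : fderiv ℝ (S.toricPoint z₀) e v = 0) : v = 0 := by
  obtain ⟨a₁, a₂, ha⟩ := h.fderiv_toricPoint he
  obtain ⟨h1, h2, h3⟩ := ha v
  have hs := he.1
  have hc := he.2.1.1
  have hg := h.loopAction_pos he.2.1
  have hT := h.period_pos he.2.1
  have hpi := Real.pi_pos
  have hr₁ : √(2 * (e.1 * e.2.1.1)) ≠ 0 := (Real.sqrt_pos.2 (by positivity)).ne'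
  have hr₂ : √(e.1 * S.loopAction z₀ e.2.1.1 / Real.pi) ≠ 0 :=
    (Real.sqrt_pos.2 (by positivity)).ne'
  rw [hv] at h1
  obtain ⟨ha₁, hA⟩ := polar_eq_zero hr₁ (congrArg Prod.fst h1).symm
  obtain ⟨ha₂, hB⟩ := polar_eq_zero hr₂ (congrArg Prod.snd h1).symm
  rw [ha₁, mul_zero] at h2
  rw [ha₂, mul_zero] at h3
  have h3' : S.secondActionForm z₀ e v = 0 := by
    have := h3.symm
    rwa [div_eq_zero_iff, or_iff_left (by positivity)] at this
  have hB' : S.secondAngleForm z₀ e v = 0 := (mul_eq_zero.1 hB).resolve_left (by positivity)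
  rw [firstActionForm] at h2
  rw [secondActionForm] at h3'
  rw [← S.loopAction_sub] at hT
  have hv1 : v.1 = 0 := by
    refine (mul_eq_zero.1 (?_ : (S.loopAction z₀ e.2.1.1 -
      e.2.1.1 * S.deflection z₀ (e.2.1.1, 2 * Real.pi)) * v.1 = 0)).resolve_left hT.ne'
    linear_combination h3' + S.deflection z₀ (e.2.1.1, 2 * Real.pi) * h2
  have hvc : v.2.1.1 = 0 := by
    rw [hv1, mul_zero, add_zero] at h2
    exact (mul_eq_zero.1 h2.symm).resolve_left hs.ne'
  exact h.eq_zero_of_forms he hv1 hvc hA hB'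

theorem hasSmoothSections_toricPoint :
    HasSmoothSections (S.toricPoint z₀) (S.coordDomain z₀) := by
  intro e he
  obtain ⟨g, hg, hge, hev⟩ := (h.contDiffAt_toricPoint he).exists_local_inverse
    (by simp [Complex.finrank_real_complex]) (h.fderiv_toricPoint_injective he)
  refine ⟨g, hg, hge, nhdsWithin_le_nhds ?_⟩
  have hD : ∀ᶠ y in 𝓝 (S.toricPoint z₀ e), g y ∈ S.coordDomain z₀ := by
    refine hg.continuousAt.eventually_mem ?_
    rw [hge]
    exact (S.isOpen_coordDomain z₀).mem_nhds he
  filter_upwards [hD, hev] with y h1 h2 using ⟨h1, h2⟩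

theorem momentMap_toricPoint {e : ℝ × (ℝ × ℝ) × ℝ} (he : e ∈ S.coordDomain z₀) :
    momentMap (S.toricPoint z₀ e) =
      (2 * Real.pi * (e.1 * e.2.1.1), e.1 * S.loopAction z₀ e.2.1.1) := by
  have hs := he.1
  have hc := he.2.1.1
  have hg := h.loopAction_pos he.2.1
  have hpi := Real.pi_pos
  simp only [momentMap, toricPoint, norm_mul, Complex.norm_exp_ofReal_mul_I, mul_one,
    Complex.norm_real, Real.norm_of_nonneg (Real.sqrt_nonneg _)]
  rw [Real.sq_sqrt (by positivity), Real.sq_sqrt (by positivity)]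
  refine Prod.ext ?_ ?_
  · simp only; ring
  · simp only; field_simp

theorem exists_toricPoint_eq {s c : ℝ} (hc : c ∈ Ioo 0 (S.u z₀)) {z : ℂ × ℂ}
    (hz : momentMap z = (2 * Real.pi * (s * c), s * S.loopAction z₀ c)) :
    ∃ τ θ : ℝ, S.toricPoint z₀ (s, (c, τ), θ) = z := by
  have hpi := Real.pi_pos
  obtain ⟨τ, hτ⟩ := h.surjective_meridianAngle hc (Complex.arg z.2 / (2 * Real.pi))
  simp only at hτ
  refine ⟨τ, Complex.arg z.1 - S.angleShift z₀ (c, τ), ?_⟩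
  have h1 : Real.pi * ‖z.1‖ ^ 2 = 2 * Real.pi * (s * c) := congrArg Prod.fst hz
  have h2 : Real.pi * ‖z.2‖ ^ 2 = s * S.loopAction z₀ c := congrArg Prod.snd hz
  have e1 : √(2 * (s * c)) = ‖z.1‖ := by
    rw [← Real.sqrt_sq (norm_nonneg z.1)]
    congr 1
    apply mul_left_cancel₀ hpi.ne'
    linarith
  have e2 : √(s * S.loopAction z₀ c / Real.pi) = ‖z.2‖ := by
    rw [← Real.sqrt_sq (norm_nonneg z.2), ← h2, mul_div_cancel_left₀ _ hpi.ne']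
  refine Prod.ext ?_ ?_
  · simp only [toricPoint]
    rw [e1, sub_add_cancel, Complex.norm_mul_exp_arg_mul_I]
  · simp only [toricPoint]
    rw [e2, hτ, mul_div_cancel₀ _ (by positivity), Complex.norm_mul_exp_arg_mul_I]

omit h in
theorem _root_.SphereOfRevolution.toricPoint_congr {s c τ θ τ' θ' : ℝ} {n m : ℤ}
    (hA : θ + S.angleShift z₀ (c, τ) = θ' + S.angleShift z₀ (c, τ') + n * (2 * Real.pi))
    (hB : S.meridianAngle z₀ (c, τ) = S.meridianAngle z₀ (c, τ') + m) :
    S.toricPoint z₀ (s, (c, τ), θ) = S.toricPoint z₀ (s, (c, τ'), θ') := by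
  simp only [toricPoint, hA, hB]
  rw [exp_add_int_mul_two_pi, show 2 * Real.pi * (S.meridianAngle z₀ (c, τ') + m) =
    2 * Real.pi * S.meridianAngle z₀ (c, τ') + m * (2 * Real.pi) by ring, exp_add_int_mul_two_pi]

theorem angleShift_add_int_mul {c : ℝ} (hc : c ∈ Ioo 0 (S.u z₀)) (τ : ℝ) (n : ℤ) :
    S.angleShift z₀ (c, τ + n * (2 * Real.pi)) = S.angleShift z₀ (c, τ) :=
  (show Function.Periodic (fun τ => S.angleShift z₀ (c, τ)) (2 * Real.pi) from
    h.angleShift_add_two_pi hc).int_mul n τ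

/-- The coordinates of a point of `ℂ²` have the same ambiguity as those of a covector. -/
theorem toricPoint_eq_iff {e e' : ℝ × (ℝ × ℝ) × ℝ} (he : e ∈ S.coordDomain z₀)
    (he' : e' ∈ S.coordDomain z₀) : S.toricPoint z₀ e = S.toricPoint z₀ e' ↔
      ∃ n m : ℤ, e = (e'.1, (e'.2.1.1, e'.2.1.2 + n * (2 * Real.pi)),
        e'.2.2 + m * (2 * Real.pi)) := by
  have hpi := Real.pi_pos
  constructor
  · intro heq
    have hm := congrArg momentMap heq
    rw [h.momentMap_toricPoint he, h.momentMap_toricPoint he'] at hm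
    obtain ⟨hs, hc⟩ := h.scaled_injective he.1 he.2.1 he'.1 he'.2.1
      (mul_left_cancel₀ Real.two_pi_pos.ne' (congrArg Prod.fst hm)) (congrArg Prod.snd hm)
    obtain ⟨s, ⟨c, τ⟩, θ⟩ := e
    obtain ⟨s', ⟨c', τ'⟩, θ'⟩ := e'
    simp only at hs hc
    subst hs hc
    have hcm : c ∈ Ioo 0 (S.u z₀) := he.2.1
    have hs0 : 0 < s := he.1
    have hc0 : 0 < c := hcm.1
    have hg := h.loopAction_pos hcm
    have hr₁ : √(2 * (s * c)) ≠ 0 := (Real.sqrt_pos.2 (by positivity)).ne'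
    have hr₂ : √(s * S.loopAction z₀ c / Real.pi) ≠ 0 := (Real.sqrt_pos.2 (by positivity)).ne'
    obtain ⟨m, hm1⟩ := exists_int_of_polar_eq hr₁ (congrArg Prod.fst heq)
    obtain ⟨n, hn1⟩ := exists_int_of_polar_eq hr₂ (congrArg Prod.snd heq)
    simp only at hm1 hn1
    have hn2 : S.meridianAngle z₀ (c, τ) = S.meridianAngle z₀ (c, τ' + n * (2 * Real.pi)) := by
      rw [h.meridianAngle_add_int_mul hcm]
      apply mul_left_cancel₀ Real.two_pi_pos.ne'
      linarith
    have hττ : τ = τ' + n * (2 * Real.pi) := (h.strictMono_meridianAngle hcm).injective hn2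
    refine ⟨n, m, ?_⟩
    rw [hττ, h.angleShift_add_int_mul hcm] at hm1
    refine Prod.ext rfl (Prod.ext (Prod.ext rfl hττ) ?_)
    simp only
    linarith
  · rintro ⟨n, m, rfl⟩
    refine toricPoint_congr (n := m) (m := n) ?_ ?_
    · rw [h.angleShift_add_int_mul he'.2.1]; ring
    · rw [h.meridianAngle_add_int_mul he'.2.1]

theorem image_toricPoint :
    S.toricPoint z₀ '' {e ∈ S.coordDomain z₀ | e.1 ≤ 1} = toricDomain (S.region z₀) := by
  ext z
  constructor
  · rintro ⟨e, ⟨he, he1⟩, rfl⟩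
    exact h.mem_region_iff.2 ⟨e.1, ⟨he.1, he1⟩, e.2.1.1, he.2.1, h.momentMap_toricPoint he⟩
  · intro hz
    obtain ⟨s, hs, c, hc, hm⟩ := h.mem_region_iff.1 hz
    obtain ⟨τ, θ, heq⟩ := h.exists_toricPoint_eq hc hm
    exact ⟨_, ⟨⟨hs.1, hc, mem_univ _⟩, hs.2⟩, heq⟩

theorem image_toricPoint_sphere :
    S.toricPoint z₀ '' {e ∈ S.coordDomain z₀ | e.1 = 1} =
      ownBoundary (toricDomain (S.region z₀)) := by
  rw [h.ownBoundary_toricDomain]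
  ext z
  constructor
  · rintro ⟨e, ⟨he, he1⟩, rfl⟩
    exact ⟨e.2.1.1, he.2.1, by rw [h.momentMap_toricPoint he, he1, one_mul, one_mul]⟩
  · rintro ⟨c, hc, hm⟩
    obtain ⟨τ, θ, heq⟩ := h.exists_toricPoint_eq (s := 1) hc (z := z)
      (by rw [hm, one_mul, one_mul])
    exact ⟨_, ⟨⟨one_pos, hc, mem_univ _⟩, rfl⟩, heq⟩

/-- The map from `T^*S` to `ℂ²` that preserves the coordinates preserves the primitives exactly. -/
theorem stdLiouville_eq_tautological {ε : ℝ} (hε : ε = 1 ∨ ε = -1) {e : ℝ × (ℝ × ℝ) × ℝ}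
    (he : e ∈ S.coordDomain z₀) (v : ℝ × (ℝ × ℝ) × ℝ) :
    stdLiouville (S.toricPoint z₀ e) (fderiv ℝ (S.toricPoint z₀) e v) =
      tautological (S.phasePoint ε z₀ e) (fderiv ℝ (S.phasePoint ε z₀) e v) := by
  rw [h.stdLiouville_toricPoint he, h.tautological_phasePoint hε he, ← h.angle_identity he.2,
    firstAngleForm, secondAngleForm]
  ring

end HasUniqueEquator

end SphereOfRevolution

/-! ### Contact boundaries and the action-angle map -/

section Slices

theorem image_slice {F V : Type*} {Q : ℝ × F → V} {D : Set (ℝ × F)} {r : ℝ} :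
    (fun y => Q (r, y)) '' {y | (r, y) ∈ D} = Q '' {e ∈ D | e.1 = r} := by
  ext x
  constructor
  · rintro ⟨y, hy, rfl⟩
    exact ⟨(r, y), ⟨hy, rfl⟩, rfl⟩
  · rintro ⟨⟨s, y⟩, ⟨hy, rfl⟩, rfl⟩
    exact ⟨y, hy, rfl⟩

variable {F V : Type*} [NormedAddCommGroup F] [NormedSpace ℝ F]
  [NormedAddCommGroup V] [NormedSpace ℝ V] {Q : ℝ × F → V} {D : Set (ℝ × F)} {r : ℝ}

theorem HasSmoothSections.slice (h : HasSmoothSections Q {e ∈ D | e.1 = r}) :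
    HasSmoothSections (fun y => Q (r, y)) {y | (r, y) ∈ D} := by
  intro y hy
  obtain ⟨L, hL, hLe, hev⟩ := h (r, y) ⟨hy, rfl⟩
  refine ⟨fun x => (L x).2, contDiffAt_snd.comp _ hL, congrArg Prod.snd hLe, ?_⟩
  rw [image_slice]
  filter_upwards [hev] with x ⟨⟨hx, hr⟩, hQ⟩
  have : (r, (L x).2) = L x := Prod.ext hr.symm rfl
  exact ⟨by rwa [this], by rw [this, hQ]⟩

theorem ContDiffAt.slice {y : F} (hQ : ContDiffAt ℝ ∞ Q (r, y)) :
    ContDiffAt ℝ ∞ (fun y => Q (r, y)) y :=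
  hQ.comp y (contDiffAt_const.prodMk contDiffAt_id)

theorem fderiv_slice {y : F} (hQ : ContDiffAt ℝ ∞ Q (r, y)) (w : F) :
    fderiv ℝ (fun y => Q (r, y)) y w = fderiv ℝ Q (r, y) (0, w) := by
  have := (hQ.differentiableAt (by simp)).hasFDerivAt.comp y (hasFDerivAt_prodMk_right r y)
  rw [show (fun y => Q (r, y)) = Q ∘ fun y => (r, y) from rfl, this.fderiv]
  rfl

end Slices

namespace SphereOfRevolution

variable {S : SphereOfRevolution} {z₀ : ℝ}

namespace HasUniqueEquator

variable (h : S.HasUniqueEquator z₀)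
include h

/-- Tangent vectors with prescribed first coordinate and angles. -/
theorem exists_forms_eq {e : ℝ × (ℝ × ℝ) × ℝ} (he : e ∈ S.coordDomain z₀) (γ α β : ℝ) :
    ∃ w : (ℝ × ℝ) × ℝ, w.1.1 = γ ∧ S.firstAngleForm z₀ e (0, w) = α ∧
      S.secondAngleForm z₀ e (0, w) = β := by
  have hBτ := (h.partialSnd_meridianAngle_pos he.2).ne'
  set v : ℝ × ℝ := (γ, (β - γ * partialFst (S.meridianAngle z₀) e.2.1) /
    partialSnd (S.meridianAngle z₀) e.2.1)
  refine ⟨(v, α - fderiv ℝ (S.angleShift z₀) e.2.1 v), rfl, ?_, ?_⟩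
  · rw [firstAngleForm, sub_add_cancel]
  · rw [secondAngleForm, fderiv_eq_partials]
    simp only [v]
    field_simp
    ring

/-- On `{s = 1}` the Liouville form is `c dα + g(c) dβ`, with `α`, `β` the angles. It is a contact
form because `g - c g'`, the period of the geodesic flow, does not vanish. -/
theorem isContactFormOn_slice :
    IsContactFormOn {y | (1, y) ∈ S.coordDomain z₀} fun y =>
      (stdLiouville (S.toricPoint z₀ (1, y))).comp
        (fderiv ℝ (fun y => S.toricPoint z₀ (1, y)) y) := by
  intro y hy
  have hopen : IsOpen {y | ((1 : ℝ), y) ∈ S.coordDomain z₀} :=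
    (S.isOpen_coordDomain z₀).preimage (by fun_prop)
  have hΛ := h.contDiffAt_toricPoint hy
  have hη : ∀ v, ((stdLiouville (S.toricPoint z₀ (1, y))).comp
      (fderiv ℝ (fun y => S.toricPoint z₀ (1, y)) y)) v =
      y.1.1 * S.firstAngleForm z₀ (1, y) (0, v) +
        S.loopAction z₀ y.1.1 * S.secondAngleForm z₀ (1, y) (0, v) := by
    intro v
    rw [ContinuousLinearMap.comp_apply, fderiv_slice hΛ, h.stdLiouville_toricPoint hy, one_mul,
      one_mul]
  have hd : ∀ v w, dOne (fun y => (stdLiouville (S.toricPoint z₀ (1, y))).comp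
      (fderiv ℝ (fun y => S.toricPoint z₀ (1, y)) y)) y v w =
      (v.1.1 * S.firstAngleForm z₀ (1, y) (0, w) - w.1.1 * S.firstAngleForm z₀ (1, y) (0, v)) +
      S.deflection z₀ (y.1.1, 2 * Real.pi) * (v.1.1 * S.secondAngleForm z₀ (1, y) (0, w) -
        w.1.1 * S.secondAngleForm z₀ (1, y) (0, v)) := by
    intro v w
    rw [dOne_pullback (Q := fun y => S.toricPoint z₀ (1, y)) (differentiable_stdLiouville _)
      hΛ.slice, dOne_stdLiouville, fderiv_slice hΛ, fderiv_slice hΛ, h.stdSymplectic_toricPoint hy]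
    simp only [firstActionForm, secondActionForm]
    ring
  have hc : 0 < y.1.1 := hy.2.1.1
  have hT := h.period_pos hy.2.1
  rw [← S.loopAction_sub] at hT
  rw [tangentConeAt_of_mem_nhds (hopen.mem_nhds hy)]
  refine ⟨?_, fun v _ hv hker => ?_⟩
  · obtain ⟨w, -, h1, h2⟩ := h.exists_forms_eq hy 0 1 0
    exact ⟨w, mem_univ _, by rw [hη, h1, h2]; simpa using hc.ne'⟩
  · rw [hη] at hv
    -- Both test vectors lie in the kernel of the form.
    obtain ⟨w, hw, h1, h2⟩ := h.exists_forms_eq hy 1 0 0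
    have k1 := hker w (mem_univ _) (by rw [hη, h1, h2]; ring)
    obtain ⟨w', hw', h1', h2'⟩ := h.exists_forms_eq hy 0 (S.loopAction z₀ y.1.1) (-y.1.1)
    have k2 := hker w' (mem_univ _) (by rw [hη, h1', h2']; ring)
    rw [hd, hw, h1, h2] at k1
    rw [hd, hw', h1', h2'] at k2
    have hγ : v.1.1 = 0 := by
      refine (mul_eq_zero.1 (?_ : (S.loopAction z₀ y.1.1 -
        y.1.1 * S.deflection z₀ (y.1.1, 2 * Real.pi)) * v.1.1 = 0)).resolve_left hT.ne'
      linear_combination k2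
    have hβ : S.secondAngleForm z₀ (1, y) (0, v) = 0 := by
      refine (mul_eq_zero.1 (?_ : (S.loopAction z₀ y.1.1 -
        y.1.1 * S.deflection z₀ (y.1.1, 2 * Real.pi)) * _ = 0)).resolve_left hT.ne'
      linear_combination hv + y.1.1 * k1
    have hα : S.firstAngleForm z₀ (1, y) (0, v) = 0 := by
      rw [hβ] at k1
      linear_combination -k1
    exact congrArg Prod.snd (h.eq_zero_of_forms hy (v := (0, v)) rfl hγ hα hβ)

variable {ε : ℝ} (hε : ε = 1 ∨ ε = -1)
include hε

theorem phasePoint_eq_iff_toricPoint_eq {e e' : ℝ × (ℝ × ℝ) × ℝ} (he : e ∈ S.coordDomain z₀)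
    (he' : e' ∈ S.coordDomain z₀) :
    S.phasePoint ε z₀ e = S.phasePoint ε z₀ e' ↔ S.toricPoint z₀ e = S.toricPoint z₀ e' := by
  rw [h.phasePoint_eq_iff hε he he', h.toricPoint_eq_iff he he']

theorem momentMap_toricPoint_eq_actionMap {e : ℝ × (ℝ × ℝ) × ℝ} (he : e ∈ S.coordDomain z₀) :
    momentMap (S.toricPoint z₀ e) = S.actionMap (energyMomentum (S.phasePoint ε z₀ e)) := by
  have hs := he.1
  have hc := he.2.1.1
  have habs : |ε * (e.1 * e.2.1.1)| = e.1 * e.2.1.1 := by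
    rcases hε with rfl | rfl
    · rw [one_mul, abs_of_pos (by positivity)]
    · rw [neg_one_mul, abs_neg, abs_of_pos (by positivity)]
  have hI : S.action₂ (e.1 ^ 2) (ε * (e.1 * e.2.1.1)) = S.action₂ (e.1 ^ 2) (e.1 * e.2.1.1) := by
    rcases hε with rfl | rfl
    · rw [one_mul]
    · rw [neg_one_mul, action₂_neg]
  rw [h.momentMap_toricPoint he, energyMomentum, h.energy_phasePoint hε he,
    h.angularMomentum_phasePoint ε he, actionMap, habs, hI, S.action₂_eq_sqrt_mul (by positivity),
    Real.sqrt_sq hs.le, mul_div_cancel_left₀ _ hs.ne', h.action₂_eq_loopAction he.2.1]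

/-- Equality of coordinates defines the map `Φ`. -/
theorem exists_actionAngleMap : ∃ Φ : R3 × R3 → ℂ × ℂ,
    ∀ e ∈ S.coordDomain z₀, Φ (S.phasePoint ε z₀ e) = S.toricPoint z₀ e := by
  classical
  refine ⟨fun x => if hx : ∃ e ∈ S.coordDomain z₀, S.phasePoint ε z₀ e = x then
    S.toricPoint z₀ hx.choose else 0, fun e he => ?_⟩
  have hx : ∃ e' ∈ S.coordDomain z₀, S.phasePoint ε z₀ e' = S.phasePoint ε z₀ e := ⟨e, he, rfl⟩
  simp only [dif_pos hx]
  exact (h.phasePoint_eq_iff_toricPoint_eq hε hx.choose_spec.1 he).1 hx.choose_spec.2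

theorem hasSmoothSections_phasePoint_restrict (p : ℝ → Prop) :
    HasSmoothSections (S.phasePoint ε z₀) {e ∈ S.coordDomain z₀ | p e.1} := by
  refine (h.hasSmoothSections_phasePoint hε).restrict (sep_subset _ _) fun e he e' he' heq => ?_
  obtain ⟨n, m, rfl⟩ := (h.phasePoint_eq_iff hε he.1 he').1 heq
  exact ⟨he', he.2⟩

omit hε in
theorem hasSmoothSections_toricPoint_restrict (p : ℝ → Prop) :
    HasSmoothSections (S.toricPoint z₀) {e ∈ S.coordDomain z₀ | p e.1} := by
  refine h.hasSmoothSections_toricPoint.restrict (sep_subset _ _) fun e he e' he' heq => ?_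
  obtain ⟨n, m, rfl⟩ := (h.toricPoint_eq_iff he.1 he').1 heq
  exact ⟨he', he.2⟩

/-- The map that preserves the coordinates is a diffeomorphism over any set of values of `s`, and
preserves the primitives. -/
theorem isDiffeoOn_and_pullbackOneEqOn {Φ : R3 × R3 → ℂ × ℂ}
    (hΦ : ∀ e ∈ S.coordDomain z₀, Φ (S.phasePoint ε z₀ e) = S.toricPoint z₀ e) (p : ℝ → Prop) :
    IsDiffeoOn Φ (S.phasePoint ε z₀ '' {e ∈ S.coordDomain z₀ | p e.1})
        (S.toricPoint z₀ '' {e ∈ S.coordDomain z₀ | p e.1}) ∧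
      PullbackOneEqOn Φ (S.phasePoint ε z₀ '' {e ∈ S.coordDomain z₀ | p e.1})
        stdLiouville tautological := by
  have hQ := h.hasSmoothSections_phasePoint_restrict hε p
  have hQs : ∀ e ∈ {e ∈ S.coordDomain z₀ | p e.1}, ContDiffAt ℝ ∞ (S.phasePoint ε z₀) e :=
    fun e he => h.contDiffAt_phasePoint ε he.1
  have hPs : ∀ e ∈ {e ∈ S.coordDomain z₀ | p e.1}, ContDiffAt ℝ ∞ (S.toricPoint z₀) e :=
    fun e he => h.contDiffAt_toricPoint he.1
  exact ⟨hQ.isDiffeoOn (h.hasSmoothSections_toricPoint_restrict p) hQs hPs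
      (fun e he e' he' => h.phasePoint_eq_iff_toricPoint_eq hε he.1 he'.1) fun e he => hΦ e he.1,
    hQ.pullbackOneEqOn hQs hPs (fun e he => hΦ e he.1)
      fun e he w => h.stdLiouville_eq_tautological hε he.1 w⟩

theorem isSymplectomorphismOn {Φ : R3 × R3 → ℂ × ℂ}
    (hΦ : ∀ e ∈ S.coordDomain z₀, Φ (S.phasePoint ε z₀ e) = S.toricPoint z₀ e) :
    IsSymplectomorphismOn Φ (S.phasePoint ε z₀ '' {e ∈ S.coordDomain z₀ | e.1 ≤ 1}) canSymplectic
      (toricDomain (S.region z₀)) stdSymplectic := by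
  rw [← h.image_toricPoint]
  refine ⟨(h.isDiffeoOn_and_pullbackOneEqOn hε hΦ fun s => s ≤ 1).1,
    (h.hasSmoothSections_phasePoint_restrict hε fun s => s ≤ 1).pullbackTwoEqOn
      (fun e he => h.contDiffAt_phasePoint ε he.1) (fun e he => h.contDiffAt_toricPoint he.1)
      (fun e he => hΦ e he.1) fun e he v w => ?_⟩
  -- The primitives agree on an open set of coordinates, not only where `s ≤ 1`.
  rw [← dOne_stdLiouville]
  exact dOne_eq_of_pullback_eq (S.isOpen_coordDomain z₀)
    (fun e he => h.contDiffAt_phasePoint ε he) (fun e he => h.contDiffAt_toricPoint he)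
    differentiable_tautological differentiable_stdLiouville
    (fun e he w => h.stdLiouville_eq_tautological hε he w) he.1 v w

theorem isStrictContactomorphismOn {Φ : R3 × R3 → ℂ × ℂ}
    (hΦ : ∀ e ∈ S.coordDomain z₀, Φ (S.phasePoint ε z₀ e) = S.toricPoint z₀ e) :
    IsStrictContactomorphismOn Φ (S.phasePoint ε z₀ '' {e ∈ S.coordDomain z₀ | e.1 = 1})
      tautological (ownBoundary (toricDomain (S.region z₀))) stdLiouville := by
  rw [← h.image_toricPoint_sphere]
  have hopen : IsOpen {y | ((1 : ℝ), y) ∈ S.coordDomain z₀} :=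
    (S.isOpen_coordDomain z₀).preimage (by fun_prop)
  have hD := h.isDiffeoOn_and_pullbackOneEqOn hε hΦ fun s => s = 1
  refine ⟨?_, ?_, hD⟩
  · rw [← image_slice]
    refine (h.hasSmoothSections_phasePoint_restrict hε fun s => s = 1).slice.isContactFormOn hopen
      (fun y hy => (h.contDiffAt_phasePoint ε hy).slice) differentiable_tautological
      (fun y hy w => ?_) h.isContactFormOn_slice
    rw [ContinuousLinearMap.comp_apply, fderiv_slice (h.contDiffAt_phasePoint ε hy),
      fderiv_slice (h.contDiffAt_toricPoint hy), h.stdLiouville_eq_tautological hε hy]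
  · rw [← image_slice]
    exact (h.hasSmoothSections_toricPoint_restrict fun s => s = 1).slice.isContactFormOn hopen
      (fun y hy => (h.contDiffAt_toricPoint hy).slice) differentiable_stdLiouville
      (fun y hy w => rfl) h.isContactFormOn_slice

/-- Action-angle coordinates on the part of the regular set where `J` has the sign `ε`. -/
theorem exists_actionAngle {U : Set (R3 × R3)}
    (hU : S.phasePoint ε z₀ '' {e ∈ S.coordDomain z₀ | e.1 ≤ 1} = U) :
    ∃ Φ : R3 × R3 → ℂ × ℂ,
      IsSymplectomorphismOn Φ U canSymplectic (toricDomain (S.region z₀)) stdSymplectic ∧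
      (∀ x ∈ U, momentMap (Φ x) = S.actionMap (energyMomentum x)) ∧
      PullbackOneEqOn Φ U stdLiouville tautological ∧
      IsStrictContactomorphismOn Φ (U ∩ cosphereBundle S.surface) tautological
        (ownBoundary (toricDomain (S.region z₀))) stdLiouville := by
  obtain ⟨Φ, hΦ⟩ := h.exists_actionAngleMap hε
  subst hU
  refine ⟨Φ, h.isSymplectomorphismOn hε hΦ, ?_,
    (h.isDiffeoOn_and_pullbackOneEqOn hε hΦ fun s => s ≤ 1).2, ?_⟩
  · rintro _ ⟨e, he, rfl⟩
    rw [hΦ e he.1, h.momentMap_toricPoint_eq_actionMap hε he.1]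
  · rw [← h.image_phasePoint_sphere hε]
    exact h.isStrictContactomorphismOn hε hΦ

end HasUniqueEquator

end SphereOfRevolution

theorem theorem2p1 (S : SphereOfRevolution) (z₀ : ℝ) (hz₀ : S.IsEquatorHeight z₀)
    (huniq : ∀ z, S.IsEquatorHeight z → z = z₀) :
    -- the regular set has exactly the two connected components `U₊` and `U₋`
    (connectedComponentIn S.regularSet '' S.regularSet = {S.Uplus, S.Uminus} ∧
      S.Uplus ≠ S.Uminus ∧
      S.regularSet = {x ∈ diskBundle S.surface |
        IsRegularPoint S.surface x ∧ angularMomentum x ≠ 0} ∧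
      S.Uplus = diskBundle S.surface ∩ energyMomentum ⁻¹' Bplus (S.u z₀) ∧
      S.Uminus = diskBundle S.surface ∩ energyMomentum ⁻¹' Bminus (S.u z₀)) ∧
    -- `Ω` is the region in the open quadrant below the curve `y = I₂(1, x / 2π)`,
    -- and it defines a toric domain
    ∃ Ω : Set (ℝ × ℝ),
      Ω = S.actionMap '' Bplus (S.u z₀) ∧
      Ω = S.actionMap '' Bminus (S.u z₀) ∧
      Ω = {y | 0 < y.1 ∧ y.1 < 2 * Real.pi * S.u z₀ ∧ 0 < y.2 ∧
        y.2 ≤ S.action₂ 1 (y.1 / (2 * Real.pi))} ∧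
      ContinuousOn (fun x : ℝ => S.action₂ 1 (x / (2 * Real.pi)))
        (Icc 0 (2 * Real.pi * S.u z₀)) ∧
      S.action₂ 1 (S.u z₀) = 0 ∧
      closure (interior Ω) = closure Ω ∧
      -- action-angle coordinates on `U₊`
      (∃ Φ : R3 × R3 → ℂ × ℂ,
        IsSymplectomorphismOn Φ S.Uplus canSymplectic (toricDomain Ω) stdSymplectic ∧
        (∀ x ∈ S.Uplus, momentMap (Φ x) = S.actionMap (energyMomentum x)) ∧
        PullbackOneEqOn Φ S.Uplus stdLiouville tautological ∧
        IsStrictContactomorphismOn Φ (S.Uplus ∩ cosphereBundle S.surface) tautological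
          (ownBoundary (toricDomain Ω)) stdLiouville) ∧
      -- action-angle coordinates on `U₋`
      (∃ Φ : R3 × R3 → ℂ × ℂ,
        IsSymplectomorphismOn Φ S.Uminus canSymplectic (toricDomain Ω) stdSymplectic ∧
        (∀ x ∈ S.Uminus, momentMap (Φ x) = S.actionMap (energyMomentum x)) ∧
        PullbackOneEqOn Φ S.Uminus stdLiouville tautological ∧
        IsStrictContactomorphismOn Φ (S.Uminus ∩ cosphereBundle S.surface) tautological
          (ownBoundary (toricDomain Ω)) stdLiouville) := by
  have h : S.HasUniqueEquator z₀ := ⟨hz₀, huniq⟩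
  exact ⟨⟨h.connectedComponentIn_regularSet.1, h.connectedComponentIn_regularSet.2, h.regularSet_eq,
      h.Uplus_eq_preimage, h.Uminus_eq_preimage⟩,
    S.region z₀, h.actionMap_image_Bplus.symm, h.actionMap_image_Bminus.symm, rfl,
    h.continuous_graph.continuousOn, h.action₂_u, h.closure_interior_region,
    h.exists_actionAngle (Or.inl rfl) h.image_phasePoint_one,
    h.exists_actionAngle (Or.inr rfl) h.image_phasePoint_neg_one⟩
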